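/- **Setting.** Let $J\ge 2$, $n\ge 1$, $\mathbb X=\{1,\dots,J\}$, let $\mathbb Y$ be a Polish space with its Borel $\sigma$-field and let $\mathcal L$ be a measure on $\mathbb Y$. A parameter $\theta=(\nu,Q,(f_x)_{x\in\mathbb X})$ consists of a probability vector $\nu$ on $\mathbb X$, a stochastic matrix $Q$ on $\mathbb X$, and probability densities $f_x$ with respect to $\mathcal L$. Under $\mathbb P_\theta$, $X_1,X_2,\dots$ is a Markov chain with initial distribution $\nu$ and transition matrix $Q$, and given $(X_i)_i$ the observations $Y_i$ are independent, $Y_i$ having density $f_{X_i}$. Write $\theta\in\Theta^{\mathrm{ind}}$ if all rows of $Q$ equal $\nu$, and $\theta\in\Theta^{\mathrm{dep}}$ if the rows of $Q$ are not all equal. **Risks.** For partitions $A,B$ of $[n]=\{1,\dots,n\}$ put $$\ell(A,B)=1-\frac1n\max_{M}\sum_{(C,C')\in M}\mathrm{Card}(C\cap C'),$$ the maximum being over matchings $M$ in the complete bipartite graph between the blocks of $A$ and the blocks of $B$. Let $\Pi_n$ be the partition of $[n]$ given by $i\sim j\iff X_i=X_j$. The Bayes clustering risk and the Bayes classification risk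 are $$R^{\mathrm{clust}}_n(\theta)=\inf_{g}\mathbb E_\theta\big[\ell(g(Y_{1:n}),\Pi_n)\big],\qquad R^{\mathrm{class}}_n(\theta)=\inf_{h}\mathbb E_\theta\Big[\frac1n\sum_{i=1}^n\mathbf 1_{h_i(Y_{1:n})\ne X_i}\Big],$$ with infima over measurable maps $g$ from $\mathbb Y^n$ to the set of partitions of $[n]$ and over measurable maps $h:\mathbb Y^n\to\mathbb X^n$. **Quantities.** Let $\delta=\min_{x,x'}Q_{x,x'}$ and $$\Lambda=\int_{\mathbb Y}\min_{x_0\in\mathbb X}\sum_{x\ne x_0}f_x(y)\,d\mathcal L(y),\quad \beta=\min_{i\in[n],\,j\ne k}\mathbb P_\theta(X_i\in\{j,k\}),\quad \rho_0=\frac{1-J\delta}{1-(J-1)\delta},\quad \varepsilon=\tfrac12-R^{\mathrm{class}}_n(\theta),$$ $$\alpha_n=2\min\Big(2(1+\varepsilon)\frac{(1-4\varepsilon^2)^{(n-2)/2}}{n\log\frac{1+2\varepsilon}{1-2\varepsilon}},\ \frac1{1-2\varepsilon}\sqrt{\frac{\pi}{2n}}\Big)$$ (the first term being $+\infty$ when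 $\varepsilon=0$; when $\varepsilon=\tfrac12$ one has $\Lambda=0$ and the value of $\alpha_n$ is irrelevant), $$\tilde\alpha_n=2e\Big(\frac{1-\delta}\delta\Big)^4\Big[\frac{1-\delta}\delta\sqrt{\frac{\log 2}{2n}}\Big]^{1-2/n},\quad \xi_n=\frac{4e}\beta\Big[\sqrt{\frac{\log(J!)}{2n}}\Big]^{1-4/(n\beta)},\quad \tilde\xi_n=\frac5{\beta(1-\rho_0)}\sqrt{\frac{\log(J!)}{2n}}.$$ **Statement.** Assume that $\delta>0$ and $\min_x\nu_x\ge\delta$. Then the following hold. 1. Let $J=2$. If $\theta\in\Theta^{\mathrm{ind}}$, then $(1-\alpha_n)\,\delta\Lambda\le R^{\mathrm{clust}}_n(\theta)\le(1-\delta)\Lambda$. If $\theta\in\Theta^{\mathrm{dep}}$, then $\dfrac{\delta^2(1-\tilde\alpha_n)}{1-\delta}\Lambda\le R^{\mathrm{clust}}_n(\theta)\le(1-\delta)\Lambda$. 2. Let $J>2$ and $\theta\in\Theta^{\mathrm{ind}}$. If $\delta\Lambda\ge4J^2e^{-n\beta/8}$ and $\xi_n\le\frac12$, then $\dfrac\delta4\Lambda\le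 R^{\mathrm{clust}}_n(\theta)\le(1-(J-1)\delta)\Lambda$. 3. Let $J>2$ and $\theta\in\Theta^{\mathrm{dep}}$. If $\delta^2\Lambda\ge4(1-(J-1)\delta)(J^2+1)e^{-2n(1-\rho_0)^2\beta^2/15}$ and $\tilde\xi_n\le\frac12$, then $\dfrac{\delta^2}{4(1-\delta)}\Lambda\le R^{\mathrm{clust}}_n(\theta)\le(1-(J-1)\delta)\Lambda$. -/

import Mathlib

open MeasureTheory
open scoped ENNReal

noncomputable section

namespace HMMClustering

/-! ### The model -/

/-- A parameter `θ = (ν, Q, (f_x))` of a hidden Markov model with `J` hidden states and emission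
densities with respect to the dominating measure `L` on `𝕐`. -/
structure Param (J : ℕ) {𝕐 : Type*} [MeasurableSpace 𝕐] (L : Measure 𝕐) where
  /-- initial distribution -/
  ν : Fin J → ℝ
  /-- transition matrix -/
  Q : Fin J → Fin J → ℝ
  /-- emission densities -/
  f : Fin J → 𝕐 → ℝ
  ν_nonneg : ∀ x, 0 ≤ ν x
  ν_sum : ∑ x, ν x = 1
  Q_nonneg : ∀ x x', 0 ≤ Q x x'
  Q_sum : ∀ x, ∑ x', Q x x' = 1
  f_measurable : ∀ x, Measurable (f x)
  f_nonneg : ∀ x y, 0 ≤ f x y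
  f_lintegral : ∀ x, ∫⁻ y, ENNReal.ofReal (f x y) ∂L = 1

namespace Param

variable {J : ℕ} {𝕐 : Type*} [MeasurableSpace 𝕐] {L : Measure 𝕐}

/-- Independent case: all the lines of `Q` are equal to `ν`. -/
def IsInd (θ : Param J L) : Prop := ∀ x x', θ.Q x x' = θ.ν x'

/-- Dependent case: the lines of `Q` are not all equal. -/
def IsDep (θ : Param J L) : Prop := ∃ x₁ x₂, θ.Q x₁ ≠ θ.Q x₂

/-- `δ`, the smallest entry of the transition matrix. -/
def δ (θ : Param J L) : ℝ := ⨅ p : Fin J × Fin J, θ.Q p.1 p.2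

/-- The mixing assumption. -/
def Mixing (θ : Param J L) : Prop := 0 < θ.δ ∧ ∀ x, θ.δ ≤ θ.ν x

/-- The emission distribution `F_x`, with density `f_x` with respect to `L`. -/
def emission (θ : Param J L) (x : Fin J) : Measure 𝕐 :=
  L.withDensity fun y => ENNReal.ofReal (θ.f x y)

/-- `P_θ(X_1 = x_1, …, X_n = x_n) = ν(x_1) Q(x_1, x_2) ⋯ Q(x_{n-1}, x_n)`. -/
def pathProb (θ : Param J L) {n : ℕ} (x : Fin n → Fin J) : ℝ :=
  ∏ i : Fin n, if i.val = 0 then θ.ν (x i)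
    else θ.Q (x ⟨i.val - 1, lt_of_le_of_lt (Nat.sub_le _ _) i.isLt⟩) (x i)

/-- The joint law of `(X_{1:n}, Y_{1:n})` under `P_θ`: the labels form a Markov chain with initial
distribution `ν` and transition matrix `Q`; given the labels, the observations are independent and
`Y_i` has distribution `F_{X_i}`. -/
def law (θ : Param J L) (n : ℕ) : Measure ((Fin n → Fin J) × (Fin n → 𝕐)) :=
  ∑ x : Fin n → Fin J, ENNReal.ofReal (θ.pathProb x) •
    (Measure.dirac x).prod (Measure.pi fun i => θ.emission (x i))

end Param

/-! ### Partitions and the misclassification error distance -/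

/-- The partitions of `[n]`. -/
abbrev Part (n : ℕ) := Finpartition (Finset.univ : Finset (Fin n))

/-- A set of edges `(C, C')` between blocks of two partitions is a matching if no two of its edges
share an end. -/
def IsMatching {n : ℕ} (M : Finset (Finset (Fin n) × Finset (Fin n))) : Prop :=
  ∀ e ∈ M, ∀ e' ∈ M, (e.1 = e'.1 ∨ e.2 = e'.2) → e = e'

open Classical in
/-- The largest value of `∑_{(C, C') ∈ M} Card (C ∩ C')` over the matchings `M` between the blocks
of `A` and the blocks of `B`. -/
def overlap {n : ℕ} (A B : Part n) : ℕ :=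
  ((A.parts ×ˢ B.parts).powerset.filter fun M => IsMatching M).sup
    fun M => ∑ e ∈ M, (e.1 ∩ e.2).card

/-- The clustering loss `ℓ(A, B)`. -/
def loss {n : ℕ} (A B : Part n) : ℝ := 1 - (overlap A B : ℝ) / n

open Classical in
/-- The partition of `[n]` induced by a sequence of labels: `i ∼ j` if and only if
`x_i = x_j`. -/
def labelPart {n J : ℕ} (x : Fin n → Fin J) : Part n :=
  Finpartition.ofSetoid (Setoid.ker x)

/-! ### Risks -/

/-- The `n`-clusterers: measurable maps from `𝕐^n` to the (finite, discrete) set of partitions of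
`[n]`. -/
def Clusterer (𝕐 : Type*) [MeasurableSpace 𝕐] (n : ℕ) :=
  {g : (Fin n → 𝕐) → Part n // Measurable[_, ⊤] g}

/-- The `n`-classifiers: measurable maps from `𝕐^n` to `𝕏^n`. -/
def Classifier (J : ℕ) (𝕐 : Type*) [MeasurableSpace 𝕐] (n : ℕ) :=
  {h : (Fin n → 𝕐) → (Fin n → Fin J) // Measurable h}

namespace Param

variable {J : ℕ} {𝕐 : Type*} [MeasurableSpace 𝕐] {L : Measure 𝕐}

/-- The risk of clustering. -/
def clustRisk (θ : Param J L) (n : ℕ) (g : Clusterer 𝕐 n) : ℝ :=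
  ∫ ω, loss (g.1 ω.2) (labelPart ω.1) ∂(θ.law n)

/-- The risk of classification. -/
def classRisk (θ : Param J L) (n : ℕ) (h : Classifier J 𝕐 n) : ℝ :=
  ∫ ω, (1 / (n : ℝ)) * ∑ i : Fin n, (if h.1 ω.2 i ≠ ω.1 i then (1 : ℝ) else 0) ∂(θ.law n)

/-- The Bayes risk of clustering. -/
def bayesClust (θ : Param J L) (n : ℕ) : ℝ := ⨅ g : Clusterer 𝕐 n, θ.clustRisk n g

/-- The Bayes risk of classification. -/
def bayesClass (θ : Param J L) (n : ℕ) : ℝ := ⨅ h : Classifier J 𝕐 n, θ.classRisk n h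

/-! ### The quantities in the bounds -/

/-- `Λ = ∫ min_{x₀} ∑_{x ≠ x₀} f_x(y) dL(y)`. -/
def Λ (θ : Param J L) : ℝ :=
  ∫ y, ⨅ x₀ : Fin J, ∑ x ∈ Finset.univ.erase x₀, θ.f x y ∂L

/-- `β = min_{i ∈ [n], j ≠ k} P_θ(X_i ∈ {j, k})`. -/
def β (θ : Param J L) (n : ℕ) : ℝ :=
  ⨅ t : {t : Fin n × Fin J × Fin J // t.2.1 ≠ t.2.2},
    (θ.law n).real {ω | ω.1 t.1.1 = t.1.2.1 ∨ ω.1 t.1.1 = t.1.2.2}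

/-- `ε_{n,θ} = 1/2 - inf_h R^class_n(θ, h)`. -/
def ε (θ : Param J L) (n : ℕ) : ℝ := 1 / 2 - θ.bayesClass n

/-- `α_n`. When `ε_{n,θ} = 0` the logarithm vanishes, the first term of the minimum is `+∞`, and
the minimum is the second term. -/
def α (θ : Param J L) (n : ℕ) : ℝ :=
  if θ.ε n = 0 then 2 * (1 / (1 - 2 * θ.ε n) * Real.sqrt (Real.pi / (2 * n)))
  else 2 * min
    (2 * (1 + θ.ε n) * ((1 - 4 * θ.ε n ^ 2) ^ (((n : ℝ) - 2) / 2) /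
      (n * Real.log ((1 + 2 * θ.ε n) / (1 - 2 * θ.ε n)))))
    (1 / (1 - 2 * θ.ε n) * Real.sqrt (Real.pi / (2 * n)))

/-- `α̃_n`. -/
def αTilde (θ : Param J L) (n : ℕ) : ℝ :=
  2 * Real.exp 1 * ((1 - θ.δ) / θ.δ) ^ 4 *
    ((1 - θ.δ) / θ.δ * Real.sqrt (Real.log 2 / (2 * n))) ^ (1 - 2 / (n : ℝ))

/-- `ξ_n`. -/
def ξ (θ : Param J L) (n : ℕ) : ℝ :=
  4 * Real.exp 1 / θ.β n *
    Real.sqrt (Real.log (Nat.factorial J) / (2 * n)) ^ (1 - 4 / ((n : ℝ) * θ.β n))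

/-- `ρ₀`. -/
def ρ₀ (θ : Param J L) : ℝ := (1 - J * θ.δ) / (1 - ((J : ℝ) - 1) * θ.δ)

/-- `ξ̃_n`. -/
def ξTilde (θ : Param J L) (n : ℕ) : ℝ :=
  5 / (θ.β n * (1 - θ.ρ₀)) * Real.sqrt (Real.log (Nat.factorial J) / (2 * n))

end Param

end HMMClustering

end

/-!
Clustering is never harder than classifying, since every label can be matched with itself; labelling
each observation by maximum likelihood therefore gives the upper bounds
(`Param.bayesClust_le_mul_Λ`). The lower bounds say that clustering is not much easier than
classifying, although a clusterer may use any number of blocks and the labels only have to be right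
up to a permutation.

*Blocks.* The risk is bounded below for each value `y` of the observations separately, for an
arbitrary partition `A` and the conditional law of the labels (`Param.le_bayesClust`). A partition
is first replaced by a labelling with `J` labels. For two labels this costs nothing: among three
blocks, merging two of them with probability proportional to the size of the third does not increase
the expected error, so blocks can be merged until two are left
(`exists_labelling_sum_min_mis_le`). For more labels, keeping the `J` largest blocks at most doubles
the number of errors (`exists_labelling_minMis_le`).

*Permutations.* It remains to compare the least number of errors over the relabellings with the
number of errors under one fixed relabelling. Given the observations, the labels still form a Markov
chain, and its transition matrices are reweighted by the total weights of the futures; they satisfy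
a Doeblin condition with the constant `ρ₀` of the prior chain, uniformly in the observations
(`exists_isDoeblin`). This gives a variance bound (`sum_chainWeight_mul_sq_le`) and a subgaussian
bound (`sum_chainWeight_mul_exp_le`) for numbers of errors.
- For two labels, the least number of errors is `min D (n - D) = (n - |n - 2 D|) / 2`, and the second
  moment of `n - 2 D` is enough (`sum_chainWeight_mul_min_mis_ge`). For independent labels a sharper
  constant is needed: the Bayes labels minimise the expectation of `min D (n - D)`, by a
  positivity property of supermodular functions of sums of independent signs, and their
  error is estimated by a Laplace transform (`sum_prod_mul_min_mis_ge`). There the risk of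
  classification is computed exactly (`Param.bayesClass_eq_err`).
- For more labels, either the best fixed relabelling has a large expected number of errors, and the
  subgaussian bound for all `J!` relabellings shows that the least number of errors is comparable to
  it; or it has few errors, and then every other relabelling errs on a pair of labels, which has many
  occurrences except on an event controlled by a Chernoff bound
  (`sum_chainWeight_mul_minMis_ge`).

*Size of the error.* The probability that a fixed relabelling errs on one observation is bounded
below by resampling its label uniformly, which costs a factor `δ` for each transition that involves
this label (`Param.exists_wrong_label_lower`).

Since the dominating measure `L` need not be σ-finite, all integrals are taken with respect to the
finite measure `Param.mix`, the sum of the emission distributions.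
-/

noncomputable section

namespace HMMClustering

/-! ### Clusterings as colorings -/

open Finset in
theorem mem_parts_labelPart {n J : ℕ} {x : Fin n → Fin J} {B : Finset (Fin n)} :
    B ∈ (labelPart x).parts ↔ ∃ i, B = univ.filter fun j => x j = x i := by
  classical
  constructor
  · intro hB
    obtain ⟨i, hi⟩ := (labelPart x).nonempty_of_mem_parts hB
    refine ⟨i, ?_⟩
    ext j
    rw [← (labelPart x).part_eq_of_mem hB hi]
    unfold labelPart
    rw [Finpartition.mem_part_ofSetoid_iff_rel]
    simp [eq_comm]
  · rintro ⟨i, rfl⟩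
    have : (univ.filter fun j => x j = x i) = (labelPart x).part i := by
      ext j
      unfold labelPart
      rw [Finpartition.mem_part_ofSetoid_iff_rel]
      simp [eq_comm]
    rw [this]
    exact (labelPart x).part_mem.2 (mem_univ i)

open Finset in
open scoped Classical in
/-- A matching between the blocks of `A` and the label classes of `x` is an injective assignment
of labels to blocks; the labels left unmatched are sent to fresh points `Sum.inr a`. -/
theorem exists_injective_overlap_le {n J : ℕ} (A : Part n) (x : Fin n → Fin J) :
    ∃ τ : Fin J → Finset (Fin n) ⊕ Fin J, Function.Injective τ ∧
      overlap A (labelPart x) ≤ #{i | Sum.inl (A.part i) = τ (x i)} := by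
  obtain ⟨M, hM, hsup⟩ := Finset.exists_mem_eq_sup
    ((A.parts ×ˢ (labelPart x).parts).powerset.filter fun M => IsMatching M)
    ⟨∅, by simp [IsMatching]⟩ (fun M => ∑ e ∈ M, (e.1 ∩ e.2).card)
  obtain ⟨hMsub, hMm⟩ := mem_filter.1 hM
  rw [mem_powerset] at hMsub
  let B : Fin J → Finset (Fin n) := fun a => univ.filter fun j => x j = a
  let τ : Fin J → Finset (Fin n) ⊕ Fin J := fun a =>
    if h : ∃ C, (C, B a) ∈ M then Sum.inl h.choose else Sum.inr a
  have hBinj : ∀ C a b, (C, B a) ∈ M → B a = B b → a = b := by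
    intro C a b hC hab
    have hp := (mem_product.1 (hMsub hC)).2
    obtain ⟨i, hi⟩ := mem_parts_labelPart.1 hp
    have h1 : i ∈ B a := by simp only at hi; rw [hi]; simp
    have h2 : i ∈ B b := hab ▸ h1
    simp only [B, mem_filter, mem_univ, true_and] at h1 h2
    rw [← h1, h2]
  refine ⟨τ, ?_, ?_⟩
  · intro a b hab
    simp only [τ] at hab
    split_ifs at hab with h1 h2 h2
    · have e := Sum.inl.inj hab
      have := hMm _ h1.choose_spec _ h2.choose_spec (Or.inl e)
      exact hBinj _ a b h1.choose_spec (congrArg Prod.snd this)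
    · exact Sum.inr.inj hab
  · have : overlap A (labelPart x) = ∑ e ∈ M, (e.1 ∩ e.2).card := by
      rw [← hsup]; rfl
    rw [this, ← card_biUnion]
    · apply card_le_card
      intro i hi
      simp only [mem_biUnion, mem_inter] at hi
      obtain ⟨⟨C, D⟩, he, hC, hD⟩ := hi
      have hp := mem_product.1 (hMsub he)
      obtain ⟨j, hj⟩ := mem_parts_labelPart.1 hp.2
      simp only at hj hC hD hp
      have hxi : x i = x j := by rw [hj] at hD; simpa using hD
      have hDB : D = B (x i) := by rw [hj, hxi]
      have hex : ∃ C, (C, B (x i)) ∈ M := ⟨C, hDB ▸ he⟩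
      simp only [mem_filter, mem_univ, true_and, τ, dif_pos hex]
      have := hMm _ hex.choose_spec _ he (Or.inr (by rw [hDB]))
      have hC' : hex.choose = C := congrArg Prod.fst this
      rw [hC', A.part_eq_of_mem hp.1 hC]
    · intro e he e' he' hne
      have hp := (mem_product.1 (hMsub he)).1
      have hp' := (mem_product.1 (hMsub he')).1
      have h1 : e.1 ≠ e'.1 := fun h => hne (hMm _ he _ he' (Or.inl h))
      exact (A.disjoint hp hp' h1).mono inter_subset_left inter_subset_left

open Finset in
/-- Matching each label with itself shows that clustering is never harder than classifying. -/
theorem card_agree_le_overlap {n J : ℕ} (h x : Fin n → Fin J) :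
    #{i | h i = x i} ≤ overlap (labelPart h) (labelPart x) := by
  classical
  let e : Fin n → Finset (Fin n) × Finset (Fin n) := fun i =>
    (univ.filter fun j => h j = h i, univ.filter fun j => x j = x i)
  let M := (univ.filter fun i => h i = x i).image e
  have hM : M ∈ ((labelPart h).parts ×ˢ (labelPart x).parts).powerset.filter
      fun M => IsMatching M := by
    rw [mem_filter, mem_powerset]
    constructor
    · intro p hp
      obtain ⟨i, -, rfl⟩ := mem_image.1 hp
      exact mem_product.2 ⟨mem_parts_labelPart.2 ⟨i, rfl⟩, mem_parts_labelPart.2 ⟨i, rfl⟩⟩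
    · intro p hp p' hp' hor
      obtain ⟨i, hi, rfl⟩ := mem_image.1 hp
      obtain ⟨j, hj, rfl⟩ := mem_image.1 hp'
      have hi := (mem_filter.1 hi).2
      have hj := (mem_filter.1 hj).2
      have hij : h i = h j ∧ x i = x j := by
        rcases hor with h1 | h1
        · have : i ∈ (univ.filter fun k => h k = h j) := by
            have : (univ.filter fun k => h k = h i) = univ.filter fun k => h k = h j := h1
            rw [← this]; simp
          have h2 : h i = h j := by simpa using this
          exact ⟨h2, by rw [← hi, ← hj, h2]⟩
        · have : i ∈ (univ.filter fun k => x k = x j) := by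
            have : (univ.filter fun k => x k = x i) = univ.filter fun k => x k = x j := h1
            rw [← this]; simp
          have h2 : x i = x j := by simpa using this
          exact ⟨by rw [hi, hj, h2], h2⟩
      simp only [e, hij.1, hij.2]
  calc #{i | h i = x i} ≤ #(M.biUnion fun p => p.1 ∩ p.2) := by
        apply card_le_card
        intro i hi
        rw [mem_biUnion]
        exact ⟨e i, mem_image_of_mem _ hi, by simp [e]⟩
    _ ≤ ∑ p ∈ M, #(p.1 ∩ p.2) := card_biUnion_le
    _ ≤ _ := Finset.le_sup (f := fun M => ∑ e ∈ M, (e.1 ∩ e.2).card) hM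

/-- The number of points whose color `c i` is not the color `τ (x i)` of their label. -/
def mis {n : ℕ} {α K : Type*} [DecidableEq K] (c : Fin n → K) (τ : α → K) (x : Fin n → α) : ℕ :=
  (Finset.univ.filter fun i => c i ≠ τ (x i)).card

open Finset in
theorem mis_le {n : ℕ} {α K : Type*} [DecidableEq K] (c : Fin n → K) (τ : α → K)
    (x : Fin n → α) : mis c τ x ≤ n := by
  unfold mis
  exact (card_filter_le _ _).trans (by simp)

open Finset in
theorem card_agree_add_mis {n : ℕ} {α K : Type*} [DecidableEq K] (c : Fin n → K) (τ : α → K)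
    (x : Fin n → α) : #{i | c i = τ (x i)} + mis c τ x = n := by
  unfold mis
  rw [card_filter_add_card_filter_not]; simp

open scoped Classical in
/-- The clustering loss is at least the fraction of points whose block is not the one assigned to
their label, for some injective assignment of labels to blocks or fresh points. -/
theorem exists_injective_mis_add_overlap_le {n J : ℕ} (A : Part n) (x : Fin n → Fin J) :
    ∃ τ : Fin J → Finset (Fin n) ⊕ Fin J, Function.Injective τ ∧
      mis (fun i => (Sum.inl (A.part i) : Finset (Fin n) ⊕ Fin J)) τ x + overlap A (labelPart x)
        ≤ n := by
  obtain ⟨τ, hτ, h⟩ := exists_injective_overlap_le A x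
  refine ⟨τ, hτ, ?_⟩
  have := card_agree_add_mis (fun i => (Sum.inl (A.part i) : Finset (Fin n) ⊕ Fin J)) τ x
  omega

open Finset in
/-- Keeping only the `J` colors of `T`, an injective assignment `τ` of labels to colors becomes a
relabelling `π` of `Fin J`. Besides the errors of `τ`, it only errs on points whose color is matched
by `τ` but not in `T`; and these are in turn compared with the colors of `T` missed by `τ`. -/
theorem exists_labelling_of_card_eq {n J : ℕ} {K : Type*} [DecidableEq K]
    (hJ : 0 < J) (c : Fin n → K) (T : Finset K) (hT : #T = J) :
    ∃ s : Fin n → Fin J, ∀ (x : Fin n → Fin J) (τ : Fin J → K), Function.Injective τ →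
      ∃ (π : Equiv.Perm (Fin J)) (g : Fin J → K), (∀ a, g a ∈ T) ∧ Function.Injective g ∧
        (∀ a, τ a ∈ T → g a = τ a) ∧
        mis s π x ≤ mis c τ x + #{i | c i = τ (x i) ∧ τ (x i) ∉ T} := by
  have e : T ≃ Fin J := T.equivFinOfCardEq hT
  let t0 : T := e.symm ⟨0, hJ⟩
  let s : Fin n → Fin J := fun i => if h : c i ∈ T then e ⟨c i, h⟩ else e t0
  refine ⟨s, fun x τ hτ => ?_⟩
  obtain ⟨g, hg⟩ := Finset.exists_equiv_extend_of_card_eq (t := T) (f := τ)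
    (s := univ.filter fun a => τ a ∈ T) (by simp [hT]) (by
      intro k hk
      obtain ⟨a, ha, rfl⟩ := mem_image.1 hk
      exact (mem_filter.1 ha).2) hτ.injOn
  refine ⟨g.trans e, fun a => (g a : K), fun a => (g a).2,
    fun a b hab => g.injective (Subtype.ext hab), fun a ha => hg a (by simp [ha]), ?_⟩
  unfold mis
  refine (card_le_card (?_ : _ ⊆ (univ.filter fun i => c i ≠ τ (x i)) ∪
    univ.filter fun i => c i = τ (x i) ∧ τ (x i) ∉ T)).trans (card_union_le _ _)
  intro i hi
  simp only [mem_filter, mem_univ, true_and, mem_union, ne_eq] at hi ⊢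
  by_contra hcon
  push Not at hcon
  obtain ⟨h1, h2⟩ := hcon
  apply hi
  have h3 := h2 h1
  have h4 : c i ∈ T := h1 ▸ h3
  simp only [s, dif_pos h4, Equiv.trans_apply]
  congr 1
  apply Subtype.ext
  rw [hg _ (by simp [h3])]
  exact h1

open Finset in
/-- If `T` consists of the `J` largest colors, the relabelling at most doubles the number of
errors: a point lost because its color is not in `T` is charged to a color of `T` which `τ` misses
and which is at least as large. -/
theorem exists_labelling_mis_le_two_mul {n J : ℕ} {K : Type*} [DecidableEq K] [Fintype K]
    (hJ : 0 < J) (hK : J ≤ Fintype.card K) (c : Fin n → K) :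
    ∃ s : Fin n → Fin J, ∀ (x : Fin n → Fin J) (τ : Fin J → K), Function.Injective τ →
      ∃ π : Equiv.Perm (Fin J), mis s π x ≤ 2 * mis c τ x := by
  let sz : K → ℕ := fun k => #{i | c i = k}
  obtain ⟨T, hTm, hTmax⟩ := Finset.exists_max_image (Finset.powersetCard J (univ : Finset K))
    (fun T => ∑ k ∈ T, sz k) (Finset.powersetCard_nonempty.2 (by simpa using hK))
  have hT : #T = J := (mem_powersetCard.1 hTm).2
  have hsz : ∀ k ∉ T, ∀ t ∈ T, sz k ≤ sz t := by
    intro k hk t ht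
    have hk' : k ∉ T.erase t := fun h => hk (mem_of_mem_erase h)
    have := hTmax (insert k (T.erase t)) (by
      rw [mem_powersetCard]
      refine ⟨subset_univ _, ?_⟩
      rw [card_insert_of_notMem hk', card_erase_of_mem ht, hT]; omega)
    rw [sum_insert hk', ← add_sum_erase T sz ht] at this
    omega
  obtain ⟨s, hs⟩ := exists_labelling_of_card_eq hJ c T hT
  refine ⟨s, fun x τ hτ => ?_⟩
  obtain ⟨π, g, hgT, hg, hgτ, hle⟩ := hs x τ hτ
  refine ⟨π, hle.trans ?_⟩
  rw [two_mul]
  gcongr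
  let O : Finset (Fin J) := univ.filter fun a => τ a ∉ T
  calc #{i | c i = τ (x i) ∧ τ (x i) ∉ T} ≤ #(O.biUnion fun a => univ.filter fun i => c i = τ a) := by
        apply card_le_card
        intro i hi
        simp only [mem_filter, mem_univ, true_and, mem_biUnion, O] at hi ⊢
        exact ⟨x i, hi.2, hi.1⟩
    _ ≤ ∑ a ∈ O, sz (τ a) := card_biUnion_le
    _ ≤ ∑ a ∈ O, sz (g a) := by
        apply sum_le_sum
        intro a ha
        exact hsz _ (mem_filter.1 ha).2 _ (hgT a)
    _ = #(O.biUnion fun a => univ.filter fun i => c i = g a) := by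
        rw [card_biUnion]
        intro a _ b _ hab
        rw [Function.onFun, disjoint_left]
        intro i hi hj
        simp only [mem_filter, mem_univ, true_and] at hi hj
        exact hab (hg (hi.symm.trans hj))
    _ ≤ mis c τ x := by
        apply card_le_card
        intro i hi
        simp only [mem_filter, mem_univ, true_and, mem_biUnion, O] at hi ⊢
        obtain ⟨a, ha, hci⟩ := hi
        intro h
        have hT' : τ (x i) ∈ T := by rw [← h, hci]; exact hgT a
        have : g (x i) = g a := by rw [hgτ _ hT', ← h, hci]
        rw [hg this] at hT'
        exact ha hT'

/-! ### Merging the blocks of a clustering: two labels -/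

/-- The smallest number of errors of the coloring `c` over all injective assignments of labels to
colors. -/
def minMis {n J : ℕ} {K : Type*} [DecidableEq K] (c : Fin n → K) (x : Fin n → Fin J) : ℕ :=
  ⨅ τ : Fin J ↪ K, mis c τ x

theorem minMis_le {n J : ℕ} {K : Type*} [DecidableEq K] (c : Fin n → K) (x : Fin n → Fin J)
    (τ : Fin J → K) (hτ : Function.Injective τ) : minMis c x ≤ mis c τ x :=
  ciInf_le (OrderBot.bddBelow _) (⟨τ, hτ⟩ : Fin J ↪ K)

theorem exists_minMis_eq {n J : ℕ} {K : Type*} [DecidableEq K] [Nonempty (Fin J ↪ K)]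
    (c : Fin n → K) (x : Fin n → Fin J) :
    ∃ τ : Fin J → K, Function.Injective τ ∧ minMis c x = mis c τ x := by
  obtain ⟨τ, hτ⟩ := Nat.sInf_mem (Set.range_nonempty fun τ : Fin J ↪ K => mis c τ x)
  exact ⟨τ, τ.injective, hτ.symm⟩

open scoped Classical in
/-- Whatever the number of blocks of `A`, some labelling with `J` labels only loses a factor two
against it, simultaneously for all label sequences. -/
theorem exists_labelling_minMis_le {n J : ℕ} (hJ : 0 < J) (A : Part n) :
    ∃ s : Fin n → Fin J, ∀ x : Fin n → Fin J,
      minMis s x + 2 * overlap A (labelPart x) ≤ 2 * n := by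
  obtain ⟨s, hs⟩ := exists_labelling_mis_le_two_mul hJ (K := Finset (Fin n) ⊕ Fin J)
    (by simp) (fun i => Sum.inl (A.part i))
  refine ⟨s, fun x => ?_⟩
  obtain ⟨τ, hτ, h1⟩ := exists_injective_mis_add_overlap_le A x
  obtain ⟨π, hπ⟩ := hs x τ hτ
  have := minMis_le s x π π.injective
  omega

open Finset in
/-- The number of points of color `k` and label `a`. -/
def cnt {n J : ℕ} {K : Type*} [DecidableEq K] (c : Fin n → K) (x : Fin n → Fin J) (a : Fin J)
    (k : K) : ℕ := #{i | c i = k ∧ x i = a}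

open Finset in
theorem cnt_add_mis {n : ℕ} {K : Type*} [DecidableEq K] (c : Fin n → K) (x : Fin n → Fin 2)
    (τ : Fin 2 → K) : cnt c x 0 (τ 0) + cnt c x 1 (τ 1) + mis c τ x = n := by
  have h := card_agree_add_mis c τ x
  have : #{i | c i = τ (x i)} = cnt c x 0 (τ 0) + cnt c x 1 (τ 1) := by
    unfold cnt
    rw [← card_union_of_disjoint]
    · congr 1
      ext i
      simp only [mem_filter, mem_univ, true_and, mem_union]
      have : x i = 0 ∨ x i = 1 := by omega
      rcases this with h | h <;> simp [h]
    · rw [disjoint_left]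
      intro i h1 h2
      simp only [mem_filter, mem_univ, true_and] at h1 h2
      rw [h1.2] at h2
      exact absurd h2.2 (by decide)
  omega

open Finset in
theorem card_color_eq {n : ℕ} {K : Type*} [DecidableEq K] (c : Fin n → K) (x : Fin n → Fin 2)
    (k : K) : #{i | c i = k} = cnt c x 0 k + cnt c x 1 k := by
  unfold cnt
  rw [← card_union_of_disjoint]
  · congr 1
    ext i
    simp only [mem_filter, mem_univ, true_and, mem_union]
    have : x i = 0 ∨ x i = 1 := by omega
    rcases this with h | h <;> simp [h]
  · rw [disjoint_left]
    intro i h1 h2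
    simp only [mem_filter, mem_univ, true_and] at h1 h2
    rw [h1.2] at h2
    exact absurd h2.2 (by decide)

/-- Recolor the points of color `v` with the color `u`. -/
def merge {n : ℕ} {K : Type*} [DecidableEq K] (u v : K) (c : Fin n → K) : Fin n → K :=
  fun i => if c i = v then u else c i

open Finset in
theorem cnt_merge_self {n J : ℕ} {K : Type*} [DecidableEq K] {u v : K} (huv : u ≠ v)
    (c : Fin n → K) (x : Fin n → Fin J) (a : Fin J) :
    cnt (merge u v c) x a u = cnt c x a u + cnt c x a v := by
  unfold cnt merge
  rw [← card_union_of_disjoint]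
  · congr 1
    ext i
    simp only [mem_filter, mem_univ, true_and, mem_union]
    split_ifs with h <;> simp [h, huv.symm]
  · rw [disjoint_left]
    intro i h1 h2
    simp only [mem_filter, mem_univ, true_and] at h1 h2
    exact huv (h1.1.symm.trans h2.1)

open Finset in
theorem cnt_merge_of_ne {n J : ℕ} {K : Type*} [DecidableEq K] {u v k : K} (hu : k ≠ u)
    (hv : k ≠ v) (c : Fin n → K) (x : Fin n → Fin J) (a : Fin J) :
    cnt (merge u v c) x a k = cnt c x a k := by
  unfold cnt merge
  congr 1
  ext i
  simp only [mem_filter, mem_univ, true_and]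
  split_ifs with h
  · simp [h, hu.symm, hv.symm]
  · rfl

/-- Any two distinct colors can be matched with the two labels. -/
theorem cnt_add_minMis_le {n : ℕ} {K : Type*} [DecidableEq K] (c : Fin n → K)
    (x : Fin n → Fin 2) {p q : K} (hpq : p ≠ q) :
    cnt c x 0 p + cnt c x 1 q + minMis c x ≤ n := by
  have hinj : Function.Injective ![p, q] := by
    intro i j
    fin_cases i <;> fin_cases j <;> simp [hpq, hpq.symm]
  have h1 := minMis_le c x ![p, q] hinj
  have h2 := cnt_add_mis c x ![p, q]
  simp only [Matrix.cons_val_zero, Matrix.cons_val_one] at h2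
  omega

theorem minMis_merge_bounds {n : ℕ} {K : Type*} [DecidableEq K] (c : Fin n → K)
    (x : Fin n → Fin 2) {u v w : K} (huv : u ≠ v) (hu : w ≠ u) (hv : w ≠ v) :
    cnt c x 0 u + cnt c x 0 v + cnt c x 1 w + minMis (merge u v c) x ≤ n ∧
    cnt c x 1 u + cnt c x 1 v + cnt c x 0 w + minMis (merge u v c) x ≤ n := by
  have h1 := cnt_add_minMis_le (merge u v c) x hu
  have h2 := cnt_add_minMis_le (merge u v c) x hu.symm
  rw [cnt_merge_self huv, cnt_merge_of_ne hu hv] at h1 h2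
  omega

/-- A merge which leaves the colors `p` and `q` distinct does not destroy the matching of the labels
`0` and `1` with `p` and `q`. -/
theorem minMis_merge_le {n : ℕ} {K : Type*} [DecidableEq K] (c : Fin n → K)
    (x : Fin n → Fin 2) {u v p q : K} (huv : u ≠ v) (hpq : p ≠ q)
    (h : ¬ ((p = u ∨ p = v) ∧ (q = u ∨ q = v))) :
    cnt c x 0 p + cnt c x 1 q + minMis (merge u v c) x ≤ n := by
  by_cases hp : p = u ∨ p = v
  · have hq : ¬ (q = u ∨ q = v) := fun hq => h ⟨hp, hq⟩
    push Not at hq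
    have := (minMis_merge_bounds c x huv hq.1 hq.2).1
    rcases hp with rfl | rfl <;> omega
  · push Not at hp
    by_cases hq : q = u ∨ q = v
    · have := (minMis_merge_bounds c x huv hp.1 hp.2).2
      rcases hq with rfl | rfl <;> omega
    · push Not at hq
      have := cnt_add_minMis_le (merge u v c) x hpq
      rwa [cnt_merge_of_ne hp.1 hp.2, cnt_merge_of_ne hq.1 hq.2] at this

/-- The bad merge, of the two matched blocks `u` and `v`, is compensated by the two good ones. The
two bounds on `F₁` are averaged with weights proportional to `aw` and `bw`. -/
theorem merge_average_aux {N au av aw bu bv bw F₁ F₂ F₃ : ℝ} (hau : 0 ≤ au) (hav : 0 ≤ av)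
    (haw : 0 ≤ aw) (hbu : 0 ≤ bu) (hbv : 0 ≤ bv) (hbw : 0 ≤ bw)
    (h1 : au + av + bw + F₁ ≤ N) (h1' : bu + bv + aw + F₁ ≤ N)
    (h2 : au + aw + bv + F₂ ≤ N) (h3 : bv + bw + au + F₃ ≤ N) :
    (aw + bw) * F₁ + (av + bv) * F₂ + (au + bu) * F₃ ≤
      (au + bu + (av + bv) + (aw + bw)) * (N - (au + bv)) := by
  have e1 := mul_le_mul_of_nonneg_left h1 haw
  have e2 := mul_le_mul_of_nonneg_left h1' hbw
  have e3 := mul_le_mul_of_nonneg_left h2 (add_nonneg hav hbv)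
  have e4 := mul_le_mul_of_nonneg_left h3 (add_nonneg hau hbu)
  have p1 := mul_nonneg haw hav
  have p2 := mul_nonneg hbw hbu
  have p3 := mul_nonneg haw hbw
  nlinarith

open Finset in
/-- Merging two of three blocks, the pair being drawn with probability proportional to the size of
the third block, does not increase the average number of errors. -/
theorem minMis_merge_average {n : ℕ} {K : Type*} [DecidableEq K] (c : Fin n → K)
    (x : Fin n → Fin 2) {u v w : K} (huv : u ≠ v) (huw : u ≠ w) (hvw : v ≠ w) :
    (#{i | c i = w} : ℝ) * minMis (merge u v c) x + (#{i | c i = v} : ℝ) * minMis (merge u w c) x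
      + (#{i | c i = u} : ℝ) * minMis (merge v w c) x ≤
    ((#{i | c i = u} : ℝ) + #{i | c i = v} + #{i | c i = w}) * minMis c x := by
  have : Nonempty (Fin 2 ↪ K) := ⟨⟨![u, v], by
    intro i j
    fin_cases i <;> fin_cases j <;> simp [huv, huv.symm]⟩⟩
  obtain ⟨τ, hτ, hmin⟩ := exists_minMis_eq c x
  have hpq : τ 0 ≠ τ 1 := fun h => absurd (hτ h) (by decide)
  have hmis := cnt_add_mis c x τ
  rw [← hmin] at hmis
  generalize τ 0 = p at hpq hmis
  generalize τ 1 = q at hpq hmis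
  have hF : (minMis c x : ℝ) = n - (cnt c x 0 p + cnt c x 1 q) := by
    have : ((cnt c x 0 p + cnt c x 1 q + minMis c x : ℕ) : ℝ) = n := by exact_mod_cast hmis
    push_cast at this; linarith
  rw [hF, card_color_eq c x u, card_color_eq c x v, card_color_eq c x w]
  push_cast
  have P1 := minMis_merge_bounds c x huv huw.symm hvw.symm
  have P2 := minMis_merge_bounds c x huw huv.symm hvw
  have P3 := minMis_merge_bounds c x hvw huv huw
  have cast : ∀ {a b d e : ℕ}, a + b + d + e ≤ n → (a + b + d + e : ℝ) ≤ n := by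
    intro a b d e h; exact_mod_cast h
  have Q1 := cast P1.1
  have Q1' := cast P1.2
  have Q2 := cast P2.1
  have Q2' := cast P2.2
  have Q3 := cast P3.1
  have Q3' := cast P3.2
  have z : ∀ a k, (0 : ℝ) ≤ cnt c x a k := fun a k => Nat.cast_nonneg _
  by_cases hboth : (p = u ∨ p = v ∨ p = w) ∧ (q = u ∨ q = v ∨ q = w)
  · obtain ⟨rfl | rfl | rfl, rfl | rfl | rfl⟩ := hboth
    · exact absurd rfl hpq
    · have := merge_average_aux (N := n) (F₁ := (minMis (merge p q c) x : ℝ))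
        (F₂ := (minMis (merge p w c) x : ℝ))
        (F₃ := (minMis (merge q w c) x : ℝ)) (z 0 p) (z 0 q) (z 0 w) (z 1 p) (z 1 q)
        (z 1 w) (by linarith) (by linarith) (by linarith) (by linarith)
      linarith
    · have := merge_average_aux (N := n) (F₁ := (minMis (merge p q c) x : ℝ))
        (F₂ := (minMis (merge p v c) x : ℝ))
        (F₃ := (minMis (merge v q c) x : ℝ)) (z 0 p) (z 0 q) (z 0 v) (z 1 p) (z 1 q)
        (z 1 v) (by linarith) (by linarith) (by linarith) (by linarith)
      linarith
    · have := merge_average_aux (N := n) (F₁ := (minMis (merge q p c) x : ℝ))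
        (F₂ := (minMis (merge p w c) x : ℝ))
        (F₃ := (minMis (merge q w c) x : ℝ)) (z 0 p) (z 0 q) (z 0 w) (z 1 p) (z 1 q)
        (z 1 w) (by linarith) (by linarith) (by linarith) (by linarith)
      linarith
    · exact absurd rfl hpq
    · have := merge_average_aux (N := n) (F₁ := (minMis (merge p q c) x : ℝ))
        (F₂ := (minMis (merge u p c) x : ℝ))
        (F₃ := (minMis (merge u q c) x : ℝ)) (z 0 p) (z 0 q) (z 0 u) (z 1 p) (z 1 q)
        (z 1 u) (by linarith) (by linarith) (by linarith) (by linarith)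
      linarith
    · have := merge_average_aux (N := n) (F₁ := (minMis (merge q p c) x : ℝ))
        (F₂ := (minMis (merge v p c) x : ℝ))
        (F₃ := (minMis (merge q v c) x : ℝ)) (z 0 p) (z 0 q) (z 0 v) (z 1 p) (z 1 q)
        (z 1 v) (by linarith) (by linarith) (by linarith) (by linarith)
      linarith
    · have := merge_average_aux (N := n) (F₁ := (minMis (merge q p c) x : ℝ))
        (F₂ := (minMis (merge u p c) x : ℝ))
        (F₃ := (minMis (merge u q c) x : ℝ)) (z 0 p) (z 0 q) (z 0 u) (z 1 p) (z 1 q)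
        (z 1 u) (by linarith) (by linarith) (by linarith) (by linarith)
      linarith
    · exact absurd rfl hpq
  · have key : ∀ {a b : K}, a ≠ b → (a = u ∨ a = v ∨ a = w) → (b = u ∨ b = v ∨ b = w) →
        (minMis (merge a b c) x : ℝ) ≤ n - (cnt c x 0 p + cnt c x 1 q) := by
      intro a b hab ha hb
      have : cnt c x 0 p + cnt c x 1 q + minMis (merge a b c) x ≤ n := by
        apply minMis_merge_le c x hab hpq
        rintro ⟨h1, h2⟩
        apply hboth
        constructor
        · rcases h1 with rfl | rfl <;> assumption
        · rcases h2 with rfl | rfl <;> assumption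
      have : ((cnt c x 0 p + cnt c x 1 q + minMis (merge a b c) x : ℕ) : ℝ) ≤ n := by
        exact_mod_cast this
      push_cast at this; linarith
    have k1 := mul_le_mul_of_nonneg_left (key huv (by simp) (by simp))
      (add_nonneg (z 0 w) (z 1 w))
    have k2 := mul_le_mul_of_nonneg_left (key huw (by simp) (by simp))
      (add_nonneg (z 0 v) (z 1 v))
    have k3 := mul_le_mul_of_nonneg_left (key hvw (by simp) (by simp))
      (add_nonneg (z 0 u) (z 1 u))
    linarith

open Finset in
/-- For two labels and any weights on the label sequences, two blocks are enough: as long as there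
are three blocks, some two of them can be merged without increasing the weighted error. -/
theorem exists_labelling_sum_minMis_le {n : ℕ} {K : Type*} [DecidableEq K] [Fintype K]
    (hK : 2 ≤ Fintype.card K) (w : (Fin n → Fin 2) → ℝ) (hw : ∀ x, 0 ≤ w x) (c : Fin n → K) :
    ∃ s : Fin n → Fin 2, ∑ x, w x * minMis s x ≤ ∑ x, w x * minMis c x := by
  induction h : #(univ.image c) using Nat.strong_induction_on generalizing c with
  | _ m ih =>
    by_cases hm : m ≤ 2
    · obtain ⟨T, hT, hcT⟩ := exists_superset_card_eq (s := univ.image c) (n := 2) (by omega) hK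
      obtain ⟨s, hs⟩ := exists_labelling_of_card_eq (by norm_num) c T hcT
      refine ⟨s, sum_le_sum fun x _ => mul_le_mul_of_nonneg_left ?_ (hw x)⟩
      have : Nonempty (Fin 2 ↪ K) := Function.Embedding.nonempty_of_card_le (by simpa using hK)
      obtain ⟨τ, hτ, hmin⟩ := exists_minMis_eq c x
      obtain ⟨π, -, -, -, -, hle⟩ := hs x τ hτ
      have h0 : #{i | c i = τ (x i) ∧ τ (x i) ∉ T} = 0 := by
        rw [card_eq_zero, filter_eq_empty_iff]
        rintro i - ⟨h1, h2⟩
        exact h2 (h1 ▸ hT (mem_image_of_mem _ (mem_univ i)))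
      have := minMis_le s x π π.injective
      rw [hmin]
      exact_mod_cast (by omega)
    · obtain ⟨u, hu, v, hv, k, hk, huv, huk, hvk⟩ :=
        (two_lt_card (s := univ.image c)).1 (by omega)
      have himg : ∀ {a b : K}, a ≠ b → a ∈ univ.image c → b ∈ univ.image c →
          #(univ.image (merge a b c)) < m := by
        intro a b hab ha hb
        rw [← h]
        apply card_lt_card
        rw [ssubset_iff_of_subset]
        · refine ⟨b, hb, fun hb' => ?_⟩
          obtain ⟨i, -, hi⟩ := mem_image.1 hb'
          unfold merge at hi
          split_ifs at hi with h1
          · exact hab hi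
          · exact h1 hi
        · intro y hy
          obtain ⟨i, -, rfl⟩ := mem_image.1 hy
          unfold merge
          split_ifs
          · exact ha
          · exact mem_image_of_mem _ (mem_univ i)
      have hpos : ∀ {a : K}, a ∈ univ.image c → (0 : ℝ) < #{i | c i = a} := by
        intro a ha
        obtain ⟨i, -, hi⟩ := mem_image.1 ha
        exact_mod_cast card_pos.2 ⟨i, by simp [hi]⟩
      -- if no labelling does as well as `c`, then all three merges do strictly worse than `c`,
      -- against the fact that they do not on average
      by_contra hcon
      push Not at hcon
      obtain ⟨s1, h1⟩ := ih _ (himg huv hu hv) (merge u v c) rfl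
      obtain ⟨s2, h2⟩ := ih _ (himg huk hu hk) (merge u k c) rfl
      obtain ⟨s3, h3⟩ := ih _ (himg hvk hv hk) (merge v k c) rfl
      have l1 := mul_lt_mul_of_pos_left ((hcon s1).trans_le h1) (hpos hk)
      have l2 := mul_lt_mul_of_pos_left ((hcon s2).trans_le h2) (hpos hv)
      have l3 := mul_lt_mul_of_pos_left ((hcon s3).trans_le h3) (hpos hu)
      have := sum_le_sum fun x (_ : x ∈ univ) =>
        mul_le_mul_of_nonneg_left (minMis_merge_average c x huv huk hvk) (hw x)
      simp only [mul_add, sum_add_distrib, add_mul, mul_left_comm (w _), ← mul_sum] at this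
      linarith

open Finset in
/-- Two labels have only two relabellings, and exchanging the labels turns errors into
agreements. -/
theorem min_mis_le_minMis {n : ℕ} (s x : Fin n → Fin 2) :
    min (mis s id x) (n - mis s id x) ≤ minMis s x := by
  have : Nonempty (Fin 2 ↪ Fin 2) := ⟨Function.Embedding.refl _⟩
  obtain ⟨τ, hτ, h⟩ := exists_minMis_eq s x
  rw [h]
  have h1 := cnt_add_mis s x τ
  have h2 := cnt_add_mis s x id
  have h4 := card_color_eq s x 0
  have h5 := card_color_eq s x 1
  have h6 : #{i | s i = 0} + #{i | s i = 1} = n := by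
    have := card_filter_add_card_filter_not (s := (univ : Finset (Fin n))) (fun i => s i = 0)
    rw [card_univ, Fintype.card_fin] at this
    have h7 : #{i | s i = 1} = #{i | ¬ s i = 0} := by
      congr 1
      ext i
      simp only [mem_filter, mem_univ, true_and]
      omega
    omega
  have h3 : (τ 0 = 0 ∧ τ 1 = 1) ∨ (τ 0 = 1 ∧ τ 1 = 0) := by
    have : τ 0 ≠ τ 1 := fun h => absurd (hτ h) (by decide)
    omega
  simp only [id] at h2
  rcases h3 with ⟨h3, h3'⟩ | ⟨h3, h3'⟩ <;> rw [h3, h3'] at h1 <;> omega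

open scoped Classical in
theorem exists_labelling_sum_min_mis_le {n : ℕ} (w : (Fin n → Fin 2) → ℝ) (hw : ∀ x, 0 ≤ w x)
    (A : Part n) :
    ∃ s : Fin n → Fin 2, ∑ x, w x * min (mis s id x : ℝ) (n - mis s id x) ≤
      ∑ x, w x * (n - overlap A (labelPart x) : ℝ) := by
  obtain ⟨s, hs⟩ := exists_labelling_sum_minMis_le (K := Finset (Fin n) ⊕ Fin 2) (by simp) w hw
    (fun i => Sum.inl (A.part i))
  refine ⟨s, le_trans (Finset.sum_le_sum fun x _ => ?_)
    (hs.trans (Finset.sum_le_sum fun x _ => ?_))⟩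
  · refine mul_le_mul_of_nonneg_left ?_ (hw x)
    have := min_mis_le_minMis s x
    rw [← Nat.cast_sub (mis_le s id x), ← Nat.cast_min]
    exact_mod_cast this
  · refine mul_le_mul_of_nonneg_left ?_ (hw x)
    obtain ⟨τ, hτ, h1⟩ := exists_injective_mis_add_overlap_le A x
    have h2 := minMis_le (fun i => (Sum.inl (A.part i) : Finset (Fin n) ⊕ Fin 2)) x τ hτ
    have h3 : minMis (fun i => (Sum.inl (A.part i) : Finset (Fin n) ⊕ Fin 2)) x
      + overlap A (labelPart x) ≤ n := by omega
    have : ((minMis (fun i => (Sum.inl (A.part i) : Finset (Fin n) ⊕ Fin 2)) x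
      + overlap A (labelPart x) : ℕ) : ℝ) ≤ n := by exact_mod_cast h3
    push_cast at this
    linarith

/-! ### Inhomogeneous Markov chains on a finite set -/

theorem sum_fin_cons {n J : ℕ} (F : (Fin (n + 1) → Fin J) → ℝ) :
    ∑ x, F x = ∑ b, ∑ x : Fin n → Fin J, F (Fin.cons b x) := by
  rw [← (Fin.consEquiv fun _ : Fin (n + 1) => Fin J).sum_comp, Fintype.sum_prod_type]
  rfl

/-- The weight `k₀(a, x₀) k₁(x₀, x₁) ⋯ k_{n-1}(x_{n-2}, x_{n-1})` of the path `x` started from the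
state `a`. The initial state `a` is not part of the path. -/
def chainWeight {n J : ℕ} (k : Fin n → Fin J → Fin J → ℝ) (a : Fin J) (x : Fin n → Fin J) : ℝ :=
  ∏ i, k i ((Fin.cons a x : Fin (n + 1) → Fin J) i.castSucc) (x i)

theorem chainWeight_cons {n J : ℕ} (k : Fin (n + 1) → Fin J → Fin J → ℝ) (a b : Fin J)
    (x : Fin n → Fin J) :
    chainWeight k a (Fin.cons b x) = k 0 a b * chainWeight (fun i => k i.succ) b x := by
  unfold chainWeight
  rw [Fin.prod_univ_succ]
  congr 1

theorem sum_chainWeight_mul_succ {n J : ℕ} (k : Fin (n + 1) → Fin J → Fin J → ℝ) (a : Fin J)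
    (F : (Fin (n + 1) → Fin J) → ℝ) :
    ∑ x, chainWeight k a x * F x =
      ∑ b, k 0 a b * ∑ x, chainWeight (fun i => k i.succ) b x * F (Fin.cons b x) := by
  rw [sum_fin_cons]
  refine Finset.sum_congr rfl fun b _ => ?_
  rw [Finset.mul_sum]
  refine Finset.sum_congr rfl fun x _ => ?_
  rw [chainWeight_cons, mul_assoc]

theorem chainWeight_nonneg {n J : ℕ} {k : Fin n → Fin J → Fin J → ℝ}
    (hk : ∀ i a b, 0 ≤ k i a b) (a : Fin J) (x : Fin n → Fin J) : 0 ≤ chainWeight k a x :=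
  Finset.prod_nonneg fun _ _ => hk _ _ _

theorem sum_chainWeight {n J : ℕ} {k : Fin n → Fin J → Fin J → ℝ}
    (hk : ∀ i a, ∑ b, k i a b = 1) (a : Fin J) : ∑ x, chainWeight k a x = 1 := by
  induction n generalizing a with
  | zero => simp [chainWeight]
  | succ n ih =>
    have h := sum_chainWeight_mul_succ k a (fun _ => 1)
    simp only [mul_one] at h
    rw [h]
    simp only [ih (k := fun i => k i.succ) (fun i a => hk i.succ a), mul_one, hk]

/-- The transition matrices `P i` are stochastic and satisfy a Doeblin minorization with mass
`1 - ρ`, so that each of them contracts oscillations by the factor `ρ`. -/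
structure IsDoeblin {n J : ℕ} (ρ : ℝ) (P : Fin n → Fin J → Fin J → ℝ) : Prop where
  sum_eq : ∀ i a, ∑ b, P i a b = 1
  minor : ∀ i, ∃ q : Fin J → ℝ, (∀ b, 0 ≤ q b) ∧ ∑ b, q b = 1 ∧ ∀ a b, (1 - ρ) * q b ≤ P i a b

namespace IsDoeblin

variable {n J : ℕ} {ρ : ℝ}

theorem tail {P : Fin (n + 1) → Fin J → Fin J → ℝ} (h : IsDoeblin ρ P) :
    IsDoeblin ρ fun i : Fin n => P i.succ :=
  ⟨fun i => h.sum_eq i.succ, fun i => h.minor i.succ⟩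

theorem nonneg {P : Fin n → Fin J → Fin J → ℝ} (h : IsDoeblin ρ P) (hρ : ρ ≤ 1) (i : Fin n)
    (a b : Fin J) : 0 ≤ P i a b := by
  obtain ⟨q, hq, -, hP⟩ := h.minor i
  exact (mul_nonneg (by linarith) (hq b)).trans (hP a b)

/-- Contraction of oscillations: the part `(1 - ρ) q` common to all rows cancels in differences. -/
theorem contract {P : Fin n → Fin J → Fin J → ℝ} (h : IsDoeblin ρ P) (i : Fin n)
    {f : Fin J → ℝ} {c : ℝ} (hf : ∀ b b', f b - f b' ≤ c) (a a' : Fin J) :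
    ∑ b, P i a b * f b - ∑ b, P i a' b * f b ≤ ρ * c := by
  obtain ⟨q, hq, hq1, hP⟩ := h.minor i
  have : Nonempty (Fin J) := ⟨a⟩
  obtain ⟨b₀, -, hb₀⟩ := Finset.exists_min_image Finset.univ f Finset.univ_nonempty
  -- the residual kernels have total mass `ρ`, and `f` takes values in `[f b₀, f b₀ + c]`
  have hR : ∀ d, ∑ b, (P i d b - (1 - ρ) * q b) = ρ := by
    intro d
    rw [Finset.sum_sub_distrib, h.sum_eq, ← Finset.mul_sum, hq1]; ring
  have hup : ∑ b, (P i a b - (1 - ρ) * q b) * f b ≤ ρ * (f b₀ + c) := by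
    conv_rhs => rw [← hR a, Finset.sum_mul]
    refine Finset.sum_le_sum fun b _ => mul_le_mul_of_nonneg_left ?_ (by linarith [hP a b])
    linarith [hf b b₀]
  have hlo : ρ * f b₀ ≤ ∑ b, (P i a' b - (1 - ρ) * q b) * f b := by
    conv_lhs => rw [← hR a', Finset.sum_mul]
    exact Finset.sum_le_sum fun b _ =>
      mul_le_mul_of_nonneg_left (hb₀ b (Finset.mem_univ b)) (by linarith [hP a' b])
  simp only [sub_mul, Finset.sum_sub_distrib] at hup hlo
  linarith

end IsDoeblin

/-- The expectation of `∑ φ_i(x_i)` along the chain started from `a`. -/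
def chainMean {n J : ℕ} (P : Fin n → Fin J → Fin J → ℝ) (φ : Fin n → Fin J → ℝ) (a : Fin J) : ℝ :=
  ∑ x, chainWeight P a x * ∑ i, φ i (x i)

theorem chainMean_succ {n J : ℕ} {P : Fin (n + 1) → Fin J → Fin J → ℝ}
    (hP : ∀ i a, ∑ b, P i a b = 1) (φ : Fin (n + 1) → Fin J → ℝ) (a : Fin J) :
    chainMean P φ a =
      ∑ b, P 0 a b * (φ 0 b + chainMean (fun i => P i.succ) (fun i => φ i.succ) b) := by
  unfold chainMean
  rw [sum_chainWeight_mul_succ]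
  refine Finset.sum_congr rfl fun b _ => ?_
  congr 1
  simp only [Fin.sum_univ_succ, Fin.cons_zero, Fin.cons_succ, mul_add, Finset.sum_add_distrib,
    ← Finset.sum_mul]
  rw [sum_chainWeight (k := fun i => P i.succ) (fun i a => hP i.succ a), one_mul]

/-- Changing the initial state changes the expectation of `∑ φ_i(x_i)` by at most
`ρ + ρ² + ⋯`. -/
theorem chainMean_sub_le {n J : ℕ} {ρ : ℝ} (hρ0 : 0 ≤ ρ) (hρ : ρ < 1)
    {P : Fin n → Fin J → Fin J → ℝ} (hP : IsDoeblin ρ P) {φ : Fin n → Fin J → ℝ}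
    (h0 : ∀ i b, 0 ≤ φ i b) (h1 : ∀ i b, φ i b ≤ 1) (a a' : Fin J) :
    chainMean P φ a - chainMean P φ a' ≤ ρ / (1 - ρ) := by
  induction n generalizing a a' with
  | zero => simpa [chainMean] using div_nonneg hρ0 (by linarith)
  | succ n ih =>
    rw [chainMean_succ hP.sum_eq, chainMean_succ hP.sum_eq]
    have hρ' : 1 - ρ ≠ 0 := by linarith
    have : ρ / (1 - ρ) = ρ * (1 + ρ / (1 - ρ)) := by field_simp; ring
    rw [this]
    refine hP.contract 0 (fun b b' => ?_) a a'
    have := ih hP.tail (φ := fun i => φ i.succ) (fun i => h0 i.succ) (fun i => h1 i.succ) b b'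
    linarith [h0 0 b', h1 0 b]

/-- Hoeffding's lemma for a finitely supported probability. -/
theorem sum_mul_exp_le {J : ℕ} {p : Fin J → ℝ} (hp : ∀ b, 0 ≤ p b) (hp1 : ∑ b, p b = 1)
    {f : Fin J → ℝ} {c : ℝ} (hf : ∀ b b', f b - f b' ≤ c) (t : ℝ) :
    ∑ b, p b * Real.exp (t * (f b - ∑ d, p d * f d)) ≤ Real.exp (t ^ 2 * c ^ 2 / 8) := by
  have hne : Nonempty (Fin J) := by
    by_contra hcon
    rw [not_nonempty_iff] at hcon
    simp at hp1
  obtain ⟨b₀, -, hb₀⟩ := Finset.exists_min_image Finset.univ f Finset.univ_nonempty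
  let q : PMF (Fin J) := PMF.ofFintype (fun b => ENNReal.ofReal (p b)) (by
    rw [← ENNReal.ofReal_sum_of_nonneg fun b _ => hp b, hp1, ENNReal.ofReal_one])
  have hint : ∀ F : Fin J → ℝ, ∫ b, F b ∂q.toMeasure = ∑ b, p b * F b := by
    intro F
    rw [PMF.integral_eq_sum]
    refine Finset.sum_congr rfl fun b _ => ?_
    simp [q, ENNReal.toReal_ofReal (hp b)]
  have hX := ProbabilityTheory.hasSubgaussianMGF_of_mem_Icc (μ := q.toMeasure) (X := f)
    (a := f b₀) (b := f b₀ + c) (measurable_of_finite f).aemeasurable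
    (Filter.Eventually.of_forall fun b => ⟨hb₀ b (Finset.mem_univ b), by linarith [hf b b₀]⟩)
  have h := hX.mgf_le t
  rw [ProbabilityTheory.mgf, hint, hint] at h
  refine h.trans (Real.exp_le_exp.2 (le_of_eq ?_))
  push_cast
  rw [add_sub_cancel_left, div_pow, Real.norm_eq_abs, sq_abs]
  ring

/-- Exponential concentration for additive functionals of a Doeblin chain, by Hoeffding's lemma at
each step: the value at time `i` changes the expected future by at most `1 / (1 - ρ)`. -/
theorem sum_chainWeight_mul_exp_le {n J : ℕ} {ρ : ℝ} (hρ0 : 0 ≤ ρ) (hρ : ρ < 1)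
    {P : Fin n → Fin J → Fin J → ℝ} (hP : IsDoeblin ρ P) {φ : Fin n → Fin J → ℝ}
    (h0 : ∀ i b, 0 ≤ φ i b) (h1 : ∀ i b, φ i b ≤ 1) (t : ℝ) (a : Fin J) :
    ∑ x, chainWeight P a x * Real.exp (t * (∑ i, φ i (x i) - chainMean P φ a)) ≤
      Real.exp (n * (t ^ 2 * (1 / (1 - ρ)) ^ 2 / 8)) := by
  induction n generalizing a with
  | zero => simp [chainMean, chainWeight]
  | succ n ih =>
    set m := chainMean (fun i => P i.succ) fun i => φ i.succ with hm
    have hmean : chainMean P φ a = ∑ b, P 0 a b * (φ 0 b + m b) := chainMean_succ hP.sum_eq φ a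
    rw [sum_chainWeight_mul_succ]
    have hosc : ∀ b b', (φ 0 b + m b) - (φ 0 b' + m b') ≤ 1 / (1 - ρ) := by
      intro b b'
      have h2 := chainMean_sub_le hρ0 hρ hP.tail (φ := fun i => φ i.succ) (fun i => h0 i.succ)
        (fun i => h1 i.succ) b b'
      have : 1 / (1 - ρ) = 1 + ρ / (1 - ρ) := by
        have : 1 - ρ ≠ 0 := by linarith
        field_simp; ring
      rw [this]
      linarith [h0 0 b', h1 0 b]
    calc _ = ∑ b, P 0 a b * Real.exp (t * ((φ 0 b + m b) - ∑ d, P 0 a d * (φ 0 d + m d))) *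
            ∑ x, chainWeight (fun i => P i.succ) b x *
              Real.exp (t * (∑ i : Fin n, φ i.succ (x i) - m b)) := by
          refine Finset.sum_congr rfl fun b _ => ?_
          rw [mul_assoc, Finset.mul_sum (Finset.univ) _ (Real.exp _)]
          congr 1
          refine Finset.sum_congr rfl fun x _ => ?_
          rw [mul_left_comm, ← Real.exp_add, hmean]
          congr 2
          simp only [Fin.sum_univ_succ, Fin.cons_zero, Fin.cons_succ]
          ring
      _ ≤ ∑ b, P 0 a b * Real.exp (t * ((φ 0 b + m b) - ∑ d, P 0 a d * (φ 0 d + m d))) *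
            Real.exp (n * (t ^ 2 * (1 / (1 - ρ)) ^ 2 / 8)) := by
          refine Finset.sum_le_sum fun b _ => mul_le_mul_of_nonneg_left ?_
            (mul_nonneg (hP.nonneg hρ.le 0 a b) (Real.exp_pos _).le)
          exact ih hP.tail (fun i => h0 i.succ) (fun i => h1 i.succ) b
      _ ≤ Real.exp (t ^ 2 * (1 / (1 - ρ)) ^ 2 / 8) *
            Real.exp (n * (t ^ 2 * (1 / (1 - ρ)) ^ 2 / 8)) := by
          rw [← Finset.sum_mul]
          exact mul_le_mul_of_nonneg_right
            (sum_mul_exp_le (fun b => hP.nonneg hρ.le 0 a b) (hP.sum_eq 0 a) hosc t)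
            (Real.exp_pos _).le
      _ = _ := by
          rw [← Real.exp_add]
          push_cast
          congr 1
          ring

/-- The covariance of an indicator with a function of oscillation `c` is at most `c` times the
variance of the indicator. -/
theorem cov_indicator_le {J : ℕ} {η : Fin J → ℝ} (hη : ∀ b, 0 ≤ η b) (hη1 : ∑ b, η b = 1)
    {φ m : Fin J → ℝ} (hφ : ∀ b, φ b = 0 ∨ φ b = 1) {c : ℝ} (hm : ∀ b b', m b - m b' ≤ c) :
    ∑ b, η b * (φ b * m b) ≤ (∑ b, η b * φ b) * (∑ b, η b * m b) +
      c * ((∑ b, η b * φ b) * (1 - ∑ b, η b * φ b)) := by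
  have h01 : ∀ b, 0 ≤ φ b ∧ φ b ≤ 1 := fun b => by rcases hφ b with h | h <;> simp [h]
  have key : ∑ b, ∑ b', η b * η b' * (φ b * (1 - φ b')) * (m b - m b') ≤
      ∑ b, ∑ b', η b * η b' * (φ b * (1 - φ b')) * c := by
    refine Finset.sum_le_sum fun b _ => Finset.sum_le_sum fun b' _ =>
      mul_le_mul_of_nonneg_left (hm b b') ?_
    exact mul_nonneg (mul_nonneg (hη b) (hη b'))
      (mul_nonneg (h01 b).1 (by linarith [(h01 b').2]))
  have e1 : ∑ b, ∑ b', η b * η b' * (φ b * (1 - φ b')) * (m b - m b') =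
      ∑ b, η b * (φ b * m b) - (∑ b, η b * φ b) * (∑ b, η b * m b) := by
    have : ∀ b b', η b * η b' * (φ b * (1 - φ b')) * (m b - m b') =
        (η b * (φ b * m b)) * η b' - (η b * (φ b * m b)) * (η b' * φ b')
          - (η b * φ b) * (η b' * m b') + (η b * φ b) * (η b' * (φ b' * m b')) := by
      intro b b'; ring
    simp only [this, Finset.sum_add_distrib, Finset.sum_sub_distrib, ← Finset.mul_sum,
      ← Finset.sum_mul, hη1]
    ring
  have e2 : ∑ b, ∑ b', η b * η b' * (φ b * (1 - φ b')) * c =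
      c * ((∑ b, η b * φ b) * (1 - ∑ b, η b * φ b)) := by
    have : ∀ b b', η b * η b' * (φ b * (1 - φ b')) * c =
        c * (η b * φ b) * η b' - c * (η b * φ b) * (η b' * φ b') := by
      intro b b'; ring
    simp only [this, Finset.sum_sub_distrib, ← Finset.mul_sum, ← Finset.sum_mul, hη1]
    ring
  rw [e1, e2] at key
  linarith

/-- Variance of a number of occurrences along a Doeblin chain with random initial state `η`. The
indicator at time `i` has with the sum of the later ones a covariance of at most `ρ / (1 - ρ)` times
its own variance, whence the factor `1 + 2 ρ / (1 - ρ)`. -/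
theorem sum_chainWeight_mul_sq_le {n J : ℕ} {ρ : ℝ} (hρ0 : 0 ≤ ρ) (hρ : ρ < 1)
    {P : Fin n → Fin J → Fin J → ℝ} (hP : IsDoeblin ρ P) {φ : Fin n → Fin J → ℝ}
    (hφ : ∀ i b, φ i b = 0 ∨ φ i b = 1) {η : Fin J → ℝ} (hη : ∀ b, 0 ≤ η b)
    (hη1 : ∑ b, η b = 1) (e : Fin n → ℝ)
    (he : ∀ i, e i = ∑ a, η a * ∑ x, chainWeight P a x * φ i (x i)) :
    ∑ a, η a * ∑ x, chainWeight P a x * (∑ i, φ i (x i)) ^ 2 ≤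
      (∑ i, e i) ^ 2 + (1 + ρ) / (1 - ρ) * ∑ i, e i * (1 - e i) := by
  induction n generalizing η with
  | zero => simp
  | succ n ih =>
    have h01 : ∀ i b, 0 ≤ φ i b ∧ φ i b ≤ 1 := fun i b => by rcases hφ i b with h | h <;> simp [h]
    -- the law of the first state of the path
    let η' : Fin J → ℝ := fun b => ∑ a, η a * P 0 a b
    have hη' : ∀ b, 0 ≤ η' b := fun b =>
      Finset.sum_nonneg fun a _ => mul_nonneg (hη a) (hP.nonneg hρ.le 0 a b)
    have hη'1 : ∑ b, η' b = 1 := by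
      simp only [η']
      rw [Finset.sum_comm]
      simp only [← Finset.mul_sum, hP.sum_eq, mul_one, hη1]
    have hshift : ∀ F : (Fin (n + 1) → Fin J) → ℝ, ∑ a, η a * ∑ x, chainWeight P a x * F x =
        ∑ b, η' b * ∑ x, chainWeight (fun i => P i.succ) b x * F (Fin.cons b x) := by
      intro F
      simp only [sum_chainWeight_mul_succ, η', Finset.sum_mul, Finset.mul_sum]
      rw [Finset.sum_comm]
      refine Finset.sum_congr rfl fun b _ => ?_
      rw [Finset.sum_comm]
      simp only [mul_assoc]
    have hs1 := sum_chainWeight (k := fun i => P i.succ) (fun i a => hP.sum_eq i.succ a)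
    set m := chainMean (fun i => P i.succ) fun i => φ i.succ with hm
    have he0 : e 0 = ∑ b, η' b * φ 0 b := by
      rw [he, hshift]
      simp only [Fin.cons_zero, ← Finset.sum_mul, hs1, one_mul]
    have hesucc : ∀ i : Fin n, e i.succ =
        ∑ b, η' b * ∑ x, chainWeight (fun i => P i.succ) b x * φ i.succ (x i) := by
      intro i
      rw [he, hshift]
      simp only [Fin.cons_succ]
    have hem : ∑ i : Fin n, e i.succ = ∑ b, η' b * m b := by
      simp only [hesucc, hm, chainMean, Finset.mul_sum]
      rw [Finset.sum_comm]
      refine Finset.sum_congr rfl fun b _ => ?_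
      rw [Finset.sum_comm]
    have hIH := ih hP.tail (φ := fun i => φ i.succ) (fun i => hφ i.succ) hη' hη'1
      (fun i => e i.succ) hesucc
    have hcov := cov_indicator_le hη' hη'1 (hφ 0) (m := m) (c := ρ / (1 - ρ))
      (chainMean_sub_le hρ0 hρ hP.tail (fun i b => (h01 i.succ b).1) (fun i b => (h01 i.succ b).2))
    rw [← he0, ← hem] at hcov
    have hexp : ∑ a, η a * ∑ x, chainWeight P a x * (∑ i, φ i (x i)) ^ 2 =
        e 0 + 2 * ∑ b, η' b * (φ 0 b * m b) +
          ∑ b, η' b * ∑ x, chainWeight (fun i => P i.succ) b x *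
            (∑ i : Fin n, φ i.succ (x i)) ^ 2 := by
      rw [hshift, he0, Finset.mul_sum, ← Finset.sum_add_distrib, ← Finset.sum_add_distrib]
      refine Finset.sum_congr rfl fun b _ => ?_
      have hsq : φ 0 b ^ 2 = φ 0 b := by rcases hφ 0 b with h | h <;> simp [h]
      have : ∀ x : Fin n → Fin J, chainWeight (fun i => P i.succ) b x *
          (φ 0 b + ∑ i : Fin n, φ i.succ (x i)) ^ 2 =
          chainWeight (fun i => P i.succ) b x * φ 0 b +
          2 * φ 0 b * (chainWeight (fun i => P i.succ) b x * ∑ i : Fin n, φ i.succ (x i)) +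
          chainWeight (fun i => P i.succ) b x * (∑ i : Fin n, φ i.succ (x i)) ^ 2 := by
        intro x
        conv_rhs => rw [← hsq]
        rcases hφ 0 b with h | h <;> rw [h] <;> ring
      simp only [Fin.sum_univ_succ, Fin.cons_zero, Fin.cons_succ, this, Finset.sum_add_distrib,
        ← Finset.sum_mul, hs1, ← Finset.mul_sum]
      simp only [hm, chainMean]
      ring
    rw [hexp, Fin.sum_univ_succ, Fin.sum_univ_succ]
    have hC : (1 + ρ) / (1 - ρ) = 1 + 2 * (ρ / (1 - ρ)) := by
      have : 1 - ρ ≠ 0 := by linarith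
      field_simp; ring
    rw [hC] at hIH ⊢
    nlinarith

/-- A positive kernel weight, for which `k i a b` depends on `a` only up to the factor `1 - ρ`, is
proportional to the law of a Doeblin chain: the transition probabilities are reweighted by the total
weights `Z` of the future paths (Doob's transform). -/
theorem exists_isDoeblin {n J : ℕ} {ρ : ℝ} (hρ : ρ < 1)
    {k : Fin n → Fin J → Fin J → ℝ} (u : Fin n → Fin J → ℝ) (hu : ∀ i b, 0 ≤ u i b)
    (hu1 : ∀ i, 0 < ∑ b, u i b) (hlo : ∀ i a b, (1 - ρ) * u i b ≤ k i a b)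
    (hhi : ∀ i a b, k i a b ≤ u i b) :
    ∃ (Z : Fin J → ℝ) (P : Fin n → Fin J → Fin J → ℝ), (∀ a, 0 < Z a) ∧ IsDoeblin ρ P ∧
      ∀ a x, chainWeight k a x = Z a * chainWeight P a x := by
  induction n with
  | zero =>
    exact ⟨fun _ => 1, k, fun _ => one_pos, ⟨fun i => i.elim0, fun i => i.elim0⟩,
      fun a x => by simp⟩
  | succ n ih =>
    obtain ⟨Z, P, hZ, hP, hk⟩ := ih (k := fun i => k i.succ) (fun i => u i.succ)
      (fun i => hu i.succ) (fun i => hu1 i.succ) (fun i => hlo i.succ) (fun i => hhi i.succ)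
    have h1ρ : 0 < 1 - ρ := by linarith
    have hU : 0 < ∑ b, u 0 b * Z b := by
      obtain ⟨b, -, hb⟩ := Finset.exists_lt_of_sum_lt
        (s := Finset.univ) (f := fun _ : Fin J => (0 : ℝ)) (g := u 0) (by simpa using hu1 0)
      exact Finset.sum_pos' (fun b _ => mul_nonneg (hu 0 b) (hZ b).le)
        ⟨b, Finset.mem_univ b, mul_pos hb (hZ b)⟩
    have hk0 : ∀ a b, 0 ≤ k 0 a b := fun a b =>
      (mul_nonneg h1ρ.le (hu 0 b)).trans (hlo 0 a b)
    have hW : ∀ a, 0 < ∑ b, k 0 a b * Z b := by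
      intro a
      refine lt_of_lt_of_le (mul_pos h1ρ hU) ?_
      rw [Finset.mul_sum]
      refine Finset.sum_le_sum fun b _ => ?_
      rw [← mul_assoc]
      exact mul_le_mul_of_nonneg_right (hlo 0 a b) (hZ b).le
    let W : Fin J → ℝ := fun a => ∑ b, k 0 a b * Z b
    let P₀ : Fin J → Fin J → ℝ := fun a b => k 0 a b * Z b / W a
    refine ⟨W, Fin.cons P₀ P, hW, ⟨fun i => ?_, fun i => ?_⟩, fun a x => ?_⟩
    · refine Fin.cases (fun a => ?_) (fun i a => ?_) i
      · simp only [Fin.cons_zero, P₀, ← Finset.sum_div]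
        exact div_self (hW a).ne'
      · simpa using hP.sum_eq i a
    · refine Fin.cases ?_ (fun i => ?_) i
      · refine ⟨fun b => u 0 b * Z b / ∑ d, u 0 d * Z d,
          fun b => div_nonneg (mul_nonneg (hu 0 b) (hZ b).le) hU.le, ?_, fun a b => ?_⟩
        · rw [← Finset.sum_div]; exact div_self hU.ne'
        · simp only [Fin.cons_zero, P₀]
          rw [← mul_div_assoc, ← mul_assoc]
          have hWU : W a ≤ ∑ d, u 0 d * Z d :=
            Finset.sum_le_sum fun b _ => mul_le_mul_of_nonneg_right (hhi 0 a b) (hZ b).le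
          exact div_le_div₀ (mul_nonneg (hk0 a b) (hZ b).le)
            (mul_le_mul_of_nonneg_right (hlo 0 a b) (hZ b).le) (hW a) hWU
      · simpa using hP.minor i
    · rw [← Fin.cons_self_tail x, chainWeight_cons, chainWeight_cons, hk]
      simp only [Fin.cons_zero, Fin.cons_succ, P₀]
      have : W a ≠ 0 := (hW a).ne'
      change k 0 a (x 0) * _ = W a * (k 0 a (x 0) * Z (x 0) / W a * _)
      field_simp

/-! ### Lower bounds for the posterior clustering error -/

theorem mis_eq_sum {n : ℕ} {α K : Type*} [DecidableEq K] (c : Fin n → K) (τ : α → K)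
    (x : Fin n → α) : (mis c τ x : ℝ) = ∑ i, if c i ≠ τ (x i) then (1 : ℝ) else 0 := by
  unfold mis
  rw [Finset.card_filter]
  push_cast
  rfl

theorem IsDoeblin.sum_mul_sq_le {n J : ℕ} {ρ : ℝ} (hρ0 : 0 ≤ ρ) (hρ : ρ < 1)
    {P : Fin n → Fin J → Fin J → ℝ} (hP : IsDoeblin ρ P) {φ : Fin n → Fin J → ℝ}
    (hφ : ∀ i b, φ i b = 0 ∨ φ i b = 1) (a : Fin J) (e : Fin n → ℝ)
    (he : ∀ i, e i = ∑ x, chainWeight P a x * φ i (x i)) :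
    ∑ x, chainWeight P a x * (∑ i, φ i (x i)) ^ 2 ≤
      (∑ i, e i) ^ 2 + (1 + ρ) / (1 - ρ) * ∑ i, e i * (1 - e i) := by
  have := sum_chainWeight_mul_sq_le hρ0 hρ hP hφ (η := fun b => if b = a then 1 else 0)
    (fun b => by split_ifs <;> simp) (by simp) e (fun i => by simp [he])
  simpa using this

/-- Jensen's inequality `(E|X|)² ≤ E X²`. -/
theorem sum_mul_abs_le {ι : Type*} [Fintype ι] {p X : ι → ℝ} (hp : ∀ x, 0 ≤ p x)
    (hp1 : ∑ x, p x = 1) {B : ℝ} (hB : 0 ≤ B) (h : ∑ x, p x * X x ^ 2 ≤ B ^ 2) :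
    ∑ x, p x * |X x| ≤ B := by
  have := Finset.sum_sq_le_sum_mul_sum_of_sq_le_mul Finset.univ (r := fun x => p x * |X x|)
    (f := p) (g := fun x => p x * X x ^ 2) (fun x _ => hp x)
    (fun x _ => mul_nonneg (hp x) (sq_nonneg _))
    (fun x _ => by rw [mul_pow, sq_abs]; exact le_of_eq (by ring))
  rw [hp1, one_mul] at this
  exact le_of_sq_le_sq (this.trans h) hB

/-- For two labels, the number of errors `D` of a labelling satisfies
`min D (n - D) = (n - |n - 2D|) / 2`, and the second moment of `n - 2D` is controlled by the mixing
of the posterior chain. The numbers `t i` are lower bounds for the error made when guessing the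
label of the `i`-th point. -/
theorem sum_chainWeight_mul_min_mis_ge {n : ℕ} {ρ : ℝ} (hn : 1 ≤ n) (hρ0 : 0 ≤ ρ) (hρ : ρ < 1)
    {k : Fin n → Fin 2 → Fin 2 → ℝ} (u : Fin n → Fin 2 → ℝ) (hu : ∀ i b, 0 ≤ u i b)
    (hu1 : ∀ i, 0 < ∑ b, u i b) (hlo : ∀ i a b, (1 - ρ) * u i b ≤ k i a b)
    (hhi : ∀ i a b, k i a b ≤ u i b) (a : Fin 2) (s : Fin n → Fin 2) {t : Fin n → ℝ}
    (ht : ∀ i b, t i ≤ ∑ x, if x i ≠ b then chainWeight k a x else 0)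
    {α : ℝ} (hα0 : 0 ≤ α) (hα1 : α ≤ 1) (hα : (1 + ρ) / (1 - ρ) ≤ α ^ 2 * n) :
    (1 - α) * ∑ i, t i ≤ ∑ x, chainWeight k a x * min (mis s id x : ℝ) (n - mis s id x) := by
  obtain ⟨Z, P, hZ, hP, hk⟩ := exists_isDoeblin hρ u hu hu1 hlo hhi
  have hn' : (0 : ℝ) < n := by exact_mod_cast hn
  set p : (Fin n → Fin 2) → ℝ := chainWeight P a with hp
  have hp0 : ∀ x, 0 ≤ p x := chainWeight_nonneg (fun i a b => hP.nonneg hρ.le i a b) a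
  have hp1 : ∑ x, p x = 1 := sum_chainWeight hP.sum_eq a
  simp only [hk, ← hp] at ht ⊢
  let φ : Fin n → Fin 2 → ℝ := fun i b => if s i ≠ b then 1 else 0
  let e : Fin n → ℝ := fun i => ∑ x, p x * φ i (x i)
  have hvar := hP.sum_mul_sq_le hρ0 hρ (φ := φ)
    (fun i b => by simp only [φ]; split_ifs <;> simp) a e (fun i => rfl)
  have hD : ∀ x : Fin n → Fin 2, (∑ i, φ i (x i)) = mis s id x := fun x => (mis_eq_sum s id x).symm
  simp only [hD] at hvar
  have he0 : ∀ i, 0 ≤ e i := fun i => Finset.sum_nonneg fun x _ =>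
    mul_nonneg (hp0 x) (by simp only [φ]; split_ifs <;> simp)
  have he1 : ∀ i, e i ≤ 1 := fun i => by
    rw [← hp1]
    refine Finset.sum_le_sum fun x _ => mul_le_of_le_one_right (hp0 x) ?_
    simp only [φ]; split_ifs <;> simp
  let θ : Fin n → ℝ := fun i => min (e i) (1 - e i)
  have htθ : ∀ i, t i ≤ Z a * θ i := by
    intro i
    rw [mul_min_of_nonneg _ _ (hZ a).le]
    refine le_min ((ht i (s i)).trans (le_of_eq ?_)) ((ht i (1 - s i)).trans (le_of_eq ?_))
    · simp only [e, Finset.mul_sum]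
      refine Finset.sum_congr rfl fun x _ => ?_
      simp only [φ, ne_comm (a := x i)]
      split_ifs <;> simp
    · have h1 : Z a * (1 - e i) = ∑ x, Z a * (p x - p x * φ i (x i)) := by
        rw [← Finset.mul_sum, Finset.sum_sub_distrib, hp1]
      rw [h1]
      refine Finset.sum_congr rfl fun x _ => ?_
      have h2 : (x i ≠ 1 - s i) ↔ ¬ (s i ≠ x i) := by
        generalize x i = b
        generalize s i = c
        revert b c; decide
      simp only [φ, h2]
      split_ifs <;> simp
  have hE : ∑ x, p x * (mis s id x : ℝ) = ∑ i, e i := by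
    simp only [← hD, e, Finset.mul_sum]
    rw [Finset.sum_comm]
  set S := ∑ i, θ i with hS
  have hθ0 : ∀ i, 0 ≤ θ i := fun i => le_min (he0 i) (by linarith [he1 i])
  have hθ2 : ∀ i, 2 * θ i = 1 - |1 - 2 * e i| := by
    intro i
    simp only [θ]
    rcases le_total (e i) (1 - e i) with h | h
    · rw [min_eq_left h, abs_of_nonneg (by linarith)]; ring
    · rw [min_eq_right h, abs_of_nonpos (by linarith)]; ring
  have hS0 : 0 ≤ S := Finset.sum_nonneg fun i _ => hθ0 i
  have hS2 : 2 * S = n - ∑ i, |1 - 2 * e i| := by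
    rw [hS, Finset.mul_sum]
    simp only [hθ2, Finset.sum_sub_distrib]
    simp
  have hSn : 0 ≤ n - 2 * S := by
    rw [hS2]
    have := Finset.sum_nonneg fun i (_ : i ∈ (Finset.univ : Finset (Fin n))) =>
      abs_nonneg (1 - 2 * e i)
    linarith
  have hbias : (n - 2 * ∑ i, e i : ℝ) ^ 2 ≤ (n - 2 * S) ^ 2 := by
    rw [hS2, sub_sub_cancel]
    apply sq_le_sq'
    · have := Finset.abs_sum_le_sum_abs (fun i => 1 - 2 * e i) Finset.univ
      have h2 := neg_le_of_abs_le this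
      simpa [Finset.sum_sub_distrib, ← Finset.mul_sum] using h2
    · have := Finset.abs_sum_le_sum_abs (fun i => 1 - 2 * e i) Finset.univ
      have h2 := (le_abs_self _).trans this
      simpa [Finset.sum_sub_distrib, ← Finset.mul_sum] using h2
  have hee : ∀ i, e i * (1 - e i) = θ i - θ i ^ 2 := by
    intro i
    simp only [θ]
    rcases le_total (e i) (1 - e i) with h | h
    · rw [min_eq_left h]; ring
    · rw [min_eq_right h]; ring
  have hcs : S ^ 2 ≤ n * ∑ i, θ i ^ 2 := by
    have := sq_sum_le_card_mul_sum_sq (s := Finset.univ) (f := θ)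
    simpa using this
  have hC0 : 0 ≤ (1 + ρ) / (1 - ρ) := div_nonneg (by linarith) (by linarith)
  have hvar2 : (1 + ρ) / (1 - ρ) * ∑ i, e i * (1 - e i) ≤ α ^ 2 * (S * (n - S)) := by
    simp only [hee, Finset.sum_sub_distrib]
    have hn0 : 0 ≤ S - ∑ i, θ i ^ 2 := by
      rw [hS, ← Finset.sum_sub_distrib]
      refine Finset.sum_nonneg fun i _ => ?_
      rw [← hee]
      exact mul_nonneg (he0 i) (by linarith [he1 i])
    calc _ ≤ α ^ 2 * n * (S - ∑ i, θ i ^ 2) := mul_le_mul_of_nonneg_right hα hn0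
      _ = α ^ 2 * (n * S - n * ∑ i, θ i ^ 2) := by ring
      _ ≤ α ^ 2 * (n * S - S ^ 2) := by gcongr
      _ = _ := by ring
  have hB : 0 ≤ n - 2 * (1 - α) * S := by nlinarith
  have habs : ∑ x, p x * |(n : ℝ) - 2 * mis s id x| ≤ n - 2 * (1 - α) * S := by
    refine sum_mul_abs_le hp0 hp1 hB ?_
    have hexp : ∑ x, p x * ((n : ℝ) - 2 * mis s id x) ^ 2 =
        n ^ 2 - 4 * n * ∑ i, e i + 4 * ∑ x, p x * (mis s id x : ℝ) ^ 2 := by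
      rw [← hE]
      have : ∀ x, p x * ((n : ℝ) - 2 * mis s id x) ^ 2 =
          p x * n ^ 2 - 4 * n * (p x * mis s id x) + 4 * (p x * (mis s id x : ℝ) ^ 2) := by
        intro x; ring
      simp only [this, Finset.sum_add_distrib, Finset.sum_sub_distrib, ← Finset.mul_sum,
        ← Finset.sum_mul, hp1, one_mul]
    rw [hexp]
    have hlast : 0 ≤ S * ((α - α ^ 2) * (n - 2 * S)) :=
      mul_nonneg hS0 (mul_nonneg (by nlinarith) hSn)
    nlinarith
  have hmin : ∀ x, min (mis s id x : ℝ) (n - mis s id x) =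
      (n - |(n : ℝ) - 2 * mis s id x|) / 2 := by
    intro x
    rcases le_total (mis s id x : ℝ) (n - mis s id x) with h | h
    · rw [min_eq_left h, abs_of_nonneg (by linarith)]; ring
    · rw [min_eq_right h, abs_of_nonpos (by linarith)]; ring
  have hfin : (1 - α) * S ≤ ∑ x, p x * min (mis s id x : ℝ) (n - mis s id x) := by
    have : ∀ x, p x * min (mis s id x : ℝ) (n - mis s id x) =
        n / 2 * p x - 1 / 2 * (p x * |(n : ℝ) - 2 * mis s id x|) := by
      intro x; rw [hmin]; ring
    simp only [this, Finset.sum_sub_distrib, ← Finset.mul_sum, hp1]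
    linarith
  calc (1 - α) * ∑ i, t i ≤ (1 - α) * (Z a * S) := by
        refine mul_le_mul_of_nonneg_left ?_ (by linarith)
        rw [hS, Finset.mul_sum]
        exact Finset.sum_le_sum fun i _ => htθ i
    _ = Z a * ((1 - α) * S) := by ring
    _ ≤ Z a * ∑ x, p x * min (mis s id x : ℝ) (n - mis s id x) :=
        mul_le_mul_of_nonneg_left hfin (hZ a).le
    _ = _ := by
        rw [Finset.mul_sum]
        exact Finset.sum_congr rfl fun x _ => by ring

open Finset in
/-- Any two labels have together at least `m` occurrences in the label sequence `x`. -/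
def PairsFrequent {n J : ℕ} (m : ℝ) (x : Fin n → Fin J) : Prop :=
  ∀ j k, j ≠ k → m ≤ #{i | x i = j ∨ x i = k}

open Finset in
/-- Two distinct relabellings disagree on two labels, hence cannot both be accurate. -/
theorem PairsFrequent.le_mis_add_mis {n J : ℕ} {m : ℝ} {x : Fin n → Fin J}
    (hx : PairsFrequent m x) (s : Fin n → Fin J) {π π' : Equiv.Perm (Fin J)} (h : π ≠ π') :
    m ≤ mis s π x + mis s π' x := by
  obtain ⟨j, hj⟩ : ∃ j, π j ≠ π' j := by
    by_contra hcon
    push Not at hcon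
    exact h (Equiv.ext hcon)
  have hk : ∃ k, j ≠ k ∧ π k ≠ π' k := by
    refine ⟨π.symm (π' j), ?_, ?_⟩
    · intro h'
      apply hj
      conv_lhs => rw [h']
      simp
    · rw [Equiv.apply_symm_apply]
      intro h'
      have := π'.injective h'
      apply hj
      have h2 : π j = π (π.symm (π' j)) := congrArg π this
      rwa [Equiv.apply_symm_apply] at h2
  obtain ⟨k, hjk, hk⟩ := hk
  refine (hx j k hjk).trans ?_
  have : #{i | x i = j ∨ x i = k} ≤ mis s π x + mis s π' x := by
    unfold mis
    refine (card_le_card ?_).trans (card_union_le _ _)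
    intro i hi
    simp only [mem_filter, mem_univ, true_and, mem_union] at hi ⊢
    by_contra hcon
    push Not at hcon
    have h1 : π (x i) = π' (x i) := hcon.1.symm.trans hcon.2
    rcases hi with h' | h' <;> rw [h'] at h1
    · exact hj h1
    · exact hk h1
  exact_mod_cast this

theorem exists_perm_minMis_eq {n J : ℕ} (s x : Fin n → Fin J) :
    ∃ π : Equiv.Perm (Fin J), minMis s x = mis s π x := by
  have : Nonempty (Fin J ↪ Fin J) := ⟨Function.Embedding.refl _⟩
  obtain ⟨τ, hτ, h⟩ := exists_minMis_eq s x
  exact ⟨Equiv.ofBijective τ (Finite.injective_iff_bijective.1 hτ), h⟩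

/-- When the best fixed relabelling `π₀` has a small mean error `r`, it is optimal with high
probability: the other relabellings make many errors. The error on the exceptional event is
controlled by the variance of the error of `π₀`. -/
theorem sum_mul_minMis_ge_of_small {n J : ℕ} {p : (Fin n → Fin J) → ℝ} (hp : ∀ x, 0 ≤ p x)
    (hp1 : ∑ x, p x = 1) (hn : 1 ≤ n) (s : Fin n → Fin J) (π₀ : Equiv.Perm (Fin J))
    {r C β c κ : ℝ} (hr : ∑ x, p x * (mis s π₀ x : ℝ) = r)
    (hvar : ∑ x, p x * (mis s π₀ x : ℝ) ^ 2 ≤ r ^ 2 + C * r)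
    (hβ : 0 < β) (hc0 : 0 < c) (hc : c < 1 / 4)
    (hsmall : r ≤ c * β * n) (hC : C ≤ 4 * (1 / 4 - c) ^ 2 * (1 - κ) * (n * β)) :
    κ * r ≤ ∑ x, p x * (minMis s x : ℝ) +
      n * ∑ x, p x * (open Classical in if PairsFrequent (n * β / 2) x then 0 else 1) := by
  classical
  have hn' : (0 : ℝ) < n := by exact_mod_cast hn
  have hr0 : 0 ≤ r := by
    rw [← hr]; exact Finset.sum_nonneg fun x _ => mul_nonneg (hp x) (Nat.cast_nonneg _)
  set g := 1 / 4 - c with hg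
  have hg0 : 0 < g := by rw [hg]; linarith
  set V := 4 * g ^ 2 * (n * β) with hV
  have hV0 : 0 < V := by positivity
  have hpt : ∀ x, (mis s π₀ x : ℝ) ≤ minMis s x +
      n * (if PairsFrequent (n * β / 2) x then 0 else 1) + ((mis s π₀ x : ℝ) - r) ^ 2 / V := by
    intro x
    have hq : 0 ≤ ((mis s π₀ x : ℝ) - r) ^ 2 / V := by positivity
    have hm0 : (0 : ℝ) ≤ minMis s x := Nat.cast_nonneg _
    have hDn : (mis s π₀ x : ℝ) ≤ n := by exact_mod_cast mis_le s π₀ x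
    split_ifs with hG
    · by_cases hD : (mis s π₀ x : ℝ) ≤ n * β / 4
      · obtain ⟨π, hπ⟩ := exists_perm_minMis_eq s x
        by_cases h : π = π₀
        · rw [hπ, h]; linarith
        · have h1 := hG.le_mis_add_mis s h
          rw [hπ]
          linarith
      · push Not at hD
        have h1 : 4 * g * mis s π₀ x ≤ mis s π₀ x - r := by
          have : c * (n * β) ≤ c * (4 * mis s π₀ x) :=
            mul_le_mul_of_nonneg_left (by linarith) hc0.le
          rw [hg]
          nlinarith
        have h2 : g * (n * β) ≤ mis s π₀ x - r := by nlinarith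
        have h3 : (mis s π₀ x : ℝ) * V ≤ (mis s π₀ x - r) ^ 2 := by
          have e1 : (mis s π₀ x : ℝ) * V = (4 * g * mis s π₀ x) * (g * (n * β)) := by
            rw [hV]; ring
          rw [e1, sq]
          exact mul_le_mul h1 h2 (by positivity) (le_trans (by positivity) h1)
        have := (le_div_iff₀ hV0).2 h3
        linarith
    · linarith
  have hsum := Finset.sum_le_sum fun x (_ : x ∈ Finset.univ) =>
    mul_le_mul_of_nonneg_left (hpt x) (hp x)
  have hvar' : ∑ x, p x * (((mis s π₀ x : ℝ) - r) ^ 2 / V) ≤ (1 - κ) * r := by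
    have : ∀ x, p x * (((mis s π₀ x : ℝ) - r) ^ 2 / V) =
        (p x * (mis s π₀ x : ℝ) ^ 2 - 2 * r * (p x * mis s π₀ x) + p x * r ^ 2) / V := by
      intro x; ring
    simp only [this, ← Finset.sum_div, Finset.sum_add_distrib, Finset.sum_sub_distrib,
      ← Finset.mul_sum, ← Finset.sum_mul, hp1, hr]
    rw [div_le_iff₀ hV0]
    have : C * r ≤ (1 - κ) * V * r := by
      refine mul_le_mul_of_nonneg_right (hC.trans (le_of_eq ?_)) hr0
      rw [hV]; ring
    nlinarith
  simp only [mul_add, Finset.sum_add_distrib, hr, mul_left_comm (p _) (n : ℝ),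
    ← Finset.mul_sum] at hsum
  linarith

/-- A maximal inequality: the smallest error over the `J!` relabellings is not much smaller than the
smallest mean error `r`. -/
theorem IsDoeblin.sum_mul_minMis_ge {n J : ℕ} (hn : 1 ≤ n) (hJ : 2 ≤ J) {ρ : ℝ} (hρ0 : 0 ≤ ρ)
    (hρ : ρ < 1) {P : Fin n → Fin J → Fin J → ℝ} (hP : IsDoeblin ρ P) (a : Fin J)
    (s : Fin n → Fin J) {r : ℝ}
    (hr : ∀ π : Equiv.Perm (Fin J), r ≤ ∑ x, chainWeight P a x * (mis s π x : ℝ)) :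
    r - n * (1 / (1 - ρ) * Real.sqrt (Real.log (Nat.factorial J) / (2 * n))) ≤
      ∑ x, chainWeight P a x * (minMis s x : ℝ) := by
  set p : (Fin n → Fin J) → ℝ := chainWeight P a with hp
  have hp0 : ∀ x, 0 ≤ p x := chainWeight_nonneg (fun i a b => hP.nonneg hρ.le i a b) a
  have hp1 : ∑ x, p x = 1 := sum_chainWeight hP.sum_eq a
  have hn' : (0 : ℝ) < n := by exact_mod_cast hn
  have hfac : (1 : ℝ) < Nat.factorial J := by
    have : Nat.factorial 2 ≤ Nat.factorial J := Nat.factorial_le hJ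
    have h2 : (Nat.factorial 2 : ℝ) ≤ Nat.factorial J := by exact_mod_cast this
    have : ((Nat.factorial 2 : ℕ) : ℝ) = 2 := by norm_num [Nat.factorial]
    linarith
  have hlog : 0 < Real.log (Nat.factorial J) := Real.log_pos hfac
  set v := Real.sqrt (Real.log (Nat.factorial J) / (2 * n)) with hv
  have hv0 : 0 < v := Real.sqrt_pos.2 (by positivity)
  have hv2 : Real.log (Nat.factorial J) = 2 * n * v ^ 2 := by
    rw [hv, Real.sq_sqrt (by positivity)]; field_simp
  set A := 1 / (1 - ρ) with hA
  have hA0 : 0 < A := by rw [hA]; exact div_pos one_pos (by linarith)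
  -- the exponent which balances the entropy term against the variance term
  set t := 4 * v / A with ht
  have ht0 : 0 < t := by positivity
  set B := t * (n * (A * v)) with hB
  have hBeq : B = Real.log (Nat.factorial J) + n * ((-t) ^ 2 * A ^ 2 / 8) := by
    rw [hB, hv2, ht]
    field_simp
    ring
  have hmgf : ∀ π : Equiv.Perm (Fin J),
      ∑ x, p x * Real.exp (t * (r - mis s π x)) ≤ Real.exp (n * ((-t) ^ 2 * A ^ 2 / 8)) := by
    intro π
    have h := sum_chainWeight_mul_exp_le hρ0 hρ hP (φ := fun i b => if s i ≠ π b then 1 else 0)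
      (fun i b => by split_ifs <;> simp) (fun i b => by split_ifs <;> simp) (-t) a
    refine le_trans (Finset.sum_le_sum fun x _ => mul_le_mul_of_nonneg_left
      (Real.exp_le_exp.2 ?_) (hp0 x)) h
    rw [← mis_eq_sum]
    have hm : r ≤ chainMean P (fun i b => if s i ≠ π b then 1 else 0) a := by
      refine (hr π).trans (le_of_eq ?_)
      unfold chainMean
      simp only [← mis_eq_sum, hp]
    nlinarith
  have hall : ∑ x, p x * Real.exp (t * (r - minMis s x) - B) ≤ 1 := by
    have h1 : ∀ x, Real.exp (t * (r - minMis s x)) ≤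
        ∑ π : Equiv.Perm (Fin J), Real.exp (t * (r - mis s π x)) := by
      intro x
      obtain ⟨π, hπ⟩ := exists_perm_minMis_eq s x
      rw [hπ]
      exact Finset.single_le_sum (f := fun π : Equiv.Perm (Fin J) => Real.exp (t * (r - mis s π x)))
        (fun π _ => (Real.exp_pos _).le) (Finset.mem_univ π)
    calc ∑ x, p x * Real.exp (t * (r - minMis s x) - B)
        = Real.exp (-B) * ∑ x, p x * Real.exp (t * (r - minMis s x)) := by
          rw [Finset.mul_sum]
          refine Finset.sum_congr rfl fun x _ => ?_
          rw [sub_eq_add_neg, Real.exp_add]; ring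
      _ ≤ Real.exp (-B) * ∑ x, p x * ∑ π : Equiv.Perm (Fin J), Real.exp (t * (r - mis s π x)) := by
          refine mul_le_mul_of_nonneg_left (Finset.sum_le_sum fun x _ =>
            mul_le_mul_of_nonneg_left (h1 x) (hp0 x)) (Real.exp_pos _).le
      _ = Real.exp (-B) * ∑ π : Equiv.Perm (Fin J), ∑ x, p x * Real.exp (t * (r - mis s π x)) := by
          congr 1
          simp only [Finset.mul_sum]
          rw [Finset.sum_comm]
      _ ≤ Real.exp (-B) * ∑ π : Equiv.Perm (Fin J), Real.exp (n * ((-t) ^ 2 * A ^ 2 / 8)) :=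
          mul_le_mul_of_nonneg_left (Finset.sum_le_sum fun π _ => hmgf π) (Real.exp_pos _).le
      _ = 1 := by
          rw [Finset.sum_const, Finset.card_univ, Fintype.card_perm, Fintype.card_fin, nsmul_eq_mul,
            hBeq, neg_add, Real.exp_add, Real.exp_neg, Real.exp_log (by linarith),
            Real.exp_neg (n * _)]
          field_simp
  -- linearize the exponential, which replaces Jensen's inequality
  have hlin : t * (r - ∑ x, p x * (minMis s x : ℝ)) - B ≤ 0 := by
    have h1 : ∑ x, p x * (t * (r - minMis s x) - B) ≤
        ∑ x, p x * (Real.exp (t * (r - minMis s x) - B) - 1) :=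
      Finset.sum_le_sum fun x _ => mul_le_mul_of_nonneg_left
        (by linarith [Real.add_one_le_exp (t * (r - minMis s x) - B)]) (hp0 x)
    have e1 : ∑ x, p x * (t * (r - minMis s x) - B) =
        t * (r - ∑ x, p x * (minMis s x : ℝ)) - B := by
      have : ∀ x, p x * (t * (r - minMis s x) - B) =
          p x * (t * r - B) - t * (p x * minMis s x) := by intro x; ring
      simp only [this, Finset.sum_sub_distrib, ← Finset.sum_mul, ← Finset.mul_sum, hp1]
      ring
    have e2 : ∑ x, p x * (Real.exp (t * (r - minMis s x) - B) - 1) =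
        ∑ x, p x * Real.exp (t * (r - minMis s x) - B) - 1 := by
      simp only [mul_sub, mul_one, Finset.sum_sub_distrib, hp1]
    rw [e1, e2] at h1
    linarith
  have : t * (r - ∑ x, p x * (minMis s x : ℝ) - n * (A * v)) ≤ 0 := by
    rw [hB] at hlin; linarith
  have := nonpos_of_mul_nonpos_right this ht0
  linarith

/-- Lower bound for the posterior clustering error with any number of labels. Here `c * β` is the
error level which separates two regimes: below it the best relabelling is essentially unique, above
it the maximal inequality costs only a fraction of the error. The numbers `t i` bound from below the
error made when guessing the label of the `i`-th point. -/
theorem sum_chainWeight_mul_minMis_ge {n J : ℕ} {ρ : ℝ} (hn : 1 ≤ n) (hJ : 2 ≤ J) (hρ0 : 0 ≤ ρ)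
    (hρ : ρ < 1) {k : Fin n → Fin J → Fin J → ℝ} (u : Fin n → Fin J → ℝ) (hu : ∀ i b, 0 ≤ u i b)
    (hu1 : ∀ i, 0 < ∑ b, u i b) (hlo : ∀ i a b, (1 - ρ) * u i b ≤ k i a b)
    (hhi : ∀ i a b, k i a b ≤ u i b) (a : Fin J) (s : Fin n → Fin J) {t : Fin n → ℝ}
    (ht : ∀ i b, t i ≤ ∑ x, if x i ≠ b then chainWeight k a x else 0)
    {β c κ : ℝ} (hβ : 0 < β) (hc0 : 0 < c) (hc : c < 1 / 4) (hκ0 : 0 ≤ κ) (hκ1 : κ ≤ 1)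
    (hlarge : 1 / (1 - ρ) * Real.sqrt (Real.log (Nat.factorial J) / (2 * n)) ≤ (1 - κ) * c * β)
    (hsmall : (1 + ρ) / (1 - ρ) ≤ 4 * (1 / 4 - c) ^ 2 * (1 - κ) * (n * β)) :
    κ * ∑ i, t i ≤ ∑ x, chainWeight k a x * (minMis s x : ℝ) +
      n * ∑ x, chainWeight k a x *
        (open Classical in if PairsFrequent (n * β / 2) x then 0 else 1) := by
  classical
  obtain ⟨Z, P, hZ, hP, hk⟩ := exists_isDoeblin hρ u hu hu1 hlo hhi
  have hn' : (0 : ℝ) < n := by exact_mod_cast hn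
  set p : (Fin n → Fin J) → ℝ := chainWeight P a with hp
  simp only [hk, ← hp] at ht ⊢
  have hp0 : ∀ x, 0 ≤ p x := chainWeight_nonneg (fun i a b => hP.nonneg hρ.le i a b) a
  have hp1 : ∑ x, p x = 1 := sum_chainWeight hP.sum_eq a
  obtain ⟨π₀, -, hπ₀⟩ := Finset.exists_min_image (Finset.univ : Finset (Equiv.Perm (Fin J)))
    (fun π => ∑ x, p x * (mis s π x : ℝ)) Finset.univ_nonempty
  set r := ∑ x, p x * (mis s π₀ x : ℝ) with hr
  let φ : Fin n → Fin J → ℝ := fun i b => if s i ≠ π₀ b then 1 else 0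
  let e : Fin n → ℝ := fun i => ∑ x, p x * φ i (x i)
  have hD : ∀ x : Fin n → Fin J, (∑ i, φ i (x i)) = mis s π₀ x := fun x => (mis_eq_sum s π₀ x).symm
  have hE : r = ∑ i, e i := by
    simp only [hr, ← hD, e, Finset.mul_sum]
    rw [Finset.sum_comm]
  have hmain : κ * r ≤ ∑ x, p x * (minMis s x : ℝ) +
      n * ∑ x, p x * (if PairsFrequent (n * β / 2) x then 0 else 1) := by
    have hbad : 0 ≤ n * ∑ x, p x * (if PairsFrequent (n * β / 2) x then (0 : ℝ) else 1) := by
      refine mul_nonneg hn'.le (Finset.sum_nonneg fun x _ => mul_nonneg (hp0 x) ?_)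
      split_ifs <;> simp
    by_cases h : r ≤ c * β * n
    · refine sum_mul_minMis_ge_of_small hp0 hp1 hn s π₀ hr.symm (C := (1 + ρ) / (1 - ρ)) ?_
        hβ hc0 hc h hsmall
      have hvar := hP.sum_mul_sq_le hρ0 hρ (φ := φ)
        (fun i b => by simp only [φ]; split_ifs <;> simp) a e (fun i => rfl)
      simp only [hD] at hvar
      refine hvar.trans ?_
      rw [← hE]
      have hC0 : 0 ≤ (1 + ρ) / (1 - ρ) := div_nonneg (by linarith) (by linarith)
      have : ∑ i, e i * (1 - e i) ≤ r := by
        rw [hE]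
        refine Finset.sum_le_sum fun i _ => ?_
        nlinarith [sq_nonneg (e i)]
      have := mul_le_mul_of_nonneg_left this hC0
      linarith
    · push Not at h
      have h1 := hP.sum_mul_minMis_ge hn hJ hρ0 hρ a s (r := r)
        (fun π => hπ₀ π (Finset.mem_univ π))
      have h2 := mul_le_mul_of_nonneg_left hlarge hn'.le
      have h3 : (1 - κ) * (c * β * n) ≤ (1 - κ) * r :=
        mul_le_mul_of_nonneg_left h.le (by linarith)
      have h4 : n * ((1 - κ) * c * β) = (1 - κ) * (c * β * n) := by ring
      linarith
  have htr : ∑ i, t i ≤ Z a * r := by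
    rw [hE, Finset.mul_sum]
    refine Finset.sum_le_sum fun i _ => (ht i (π₀.symm (s i))).trans (le_of_eq ?_)
    simp only [e, Finset.mul_sum]
    refine Finset.sum_congr rfl fun x _ => ?_
    have : (x i ≠ π₀.symm (s i)) ↔ s i ≠ π₀ (x i) := by
      rw [not_iff_not, Equiv.eq_symm_apply, eq_comm]
    simp only [φ, this]
    split_ifs <;> simp
  calc κ * ∑ i, t i ≤ κ * (Z a * r) := mul_le_mul_of_nonneg_left htr hκ0
    _ = Z a * (κ * r) := by ring
    _ ≤ Z a * _ := mul_le_mul_of_nonneg_left hmain (hZ a).le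
    _ = _ := by
        simp only [mul_add, Finset.mul_sum, mul_assoc, mul_left_comm (Z a)]

/-! ### Two labels and independent observations: optimality of the Bayes labels -/

theorem sum_prod_apply {n J : ℕ} (f : Fin n → Fin J → ℝ) :
    ∑ x : Fin n → Fin J, ∏ i, f i (x i) = ∏ i, ∑ b, f i b := by
  rw [Finset.prod_univ_sum, Fintype.piFinset_univ]

/-- The conditions on `H` which make `E H(U, V)` nonnegative for all independent `U` and `V` that are
sums of independent signs with nonnegative means: a sign condition at the origin after
symmetrisation, monotonicity of the symmetrised functions, and supermodularity. These conditions
are stable under averaging over one more such sign, in either variable. -/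
structure IsSkewPositive (H : ℝ → ℝ → ℝ) : Prop where
  mixed : ∀ u v, 0 ≤ H (u + 1) (v + 1) - H (u + 1) (v - 1) - H (u - 1) (v + 1) + H (u - 1) (v - 1)
  mono_right : ∀ u v, 0 ≤ H u (v + 1) - H u (v - 1) + (H (-u) (v + 1) - H (-u) (v - 1))
  mono_left : ∀ u v, 0 ≤ H (u + 1) v - H (u - 1) v + (H (u + 1) (-v) - H (u - 1) (-v))
  sym : ∀ u v, 0 ≤ H u v + H (-u) v + H u (-v) + H (-u) (-v)

namespace IsSkewPositive

theorem swap {H : ℝ → ℝ → ℝ} (h : IsSkewPositive H) : IsSkewPositive fun u v => H v u :=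
  ⟨fun u v => by linarith [h.mixed v u], fun u v => by linarith [h.mono_left v u],
    fun u v => by linarith [h.mono_right v u], fun u v => by linarith [h.sym v u]⟩

/-- Stability under averaging over one more sign in the first variable, of weights `p ≥ q`. -/
theorem average {H : ℝ → ℝ → ℝ} (h : IsSkewPositive H) {p q : ℝ} (hq : 0 ≤ q) (hpq : q ≤ p) :
    IsSkewPositive fun u v => p * H (u + 1) v + q * H (u - 1) v := by
  have hp : 0 ≤ p := hq.trans hpq
  have key : ∀ D : ℝ → ℝ, (∀ u, 0 ≤ D u + D (-u)) → (∀ u, D (u - 1) ≤ D (u + 1)) →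
      ∀ u, 0 ≤ p * D (u + 1) + q * D (u - 1) + (p * D (-u + 1) + q * D (-u - 1)) := by
    intro D hs hm u
    have e1 : -u + 1 = -(u - 1) := by ring
    have e2 : -u - 1 = -(u + 1) := by ring
    rw [e1, e2]
    have h1 := mul_nonneg hq (hs (u + 1))
    have h2 := mul_nonneg hq (hs (u - 1))
    have h3 : 0 ≤ (p - q) * (D (u + 1) + D (-(u - 1))) :=
      mul_nonneg (by linarith) (by linarith [hs (u - 1), hm u])
    linarith
  refine ⟨fun u v => ?_, fun u v => ?_, fun u v => ?_, fun u v => ?_⟩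
  · have h1 := mul_nonneg hp (h.mixed (u + 1) v)
    have h2 := mul_nonneg hq (h.mixed (u - 1) v)
    have e : u + 1 - 1 = u - 1 + 1 := by ring
    rw [e] at h1 ⊢
    linarith
  · have := key (fun u => H u (v + 1) - H u (v - 1)) (fun u => h.mono_right u v)
      (fun u => by linarith [h.mixed u v]) u
    linarith
  · have h1 := mul_nonneg hp (h.mono_left (u + 1) v)
    have h2 := mul_nonneg hq (h.mono_left (u - 1) v)
    have e : u + 1 - 1 = u - 1 + 1 := by ring
    rw [e] at h1 ⊢
    linarith
  · have := key (fun u => H u v + H u (-v)) (fun u => by linarith [h.sym u v])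
      (fun u => by linarith [h.mono_left u v]) u
    linarith

theorem abs_add_sub_abs_sub : IsSkewPositive fun u v => |u + v| - |u - v| := by
  have conv : ∀ s : ℝ, 0 ≤ |s + 2| - 2 * |s| + |s - 2| := by
    intro s
    have := abs_add_le (s + 2) (s - 2)
    rw [show s + 2 + (s - 2) = 2 * s by ring, abs_mul, abs_two] at this
    linarith
  refine ⟨fun u v => ?_, fun u v => ?_, fun u v => ?_, fun u v => ?_⟩
  · have h1 := conv (u + v)
    have h2 := conv (u - v)
    rw [show u + 1 + (v + 1) = u + v + 2 by ring, show u + 1 - (v + 1) = u - v by ring,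
      show u + 1 + (v - 1) = u + v by ring, show u + 1 - (v - 1) = u - v + 2 by ring,
      show u - 1 + (v + 1) = u + v by ring, show u - 1 - (v + 1) = u - v - 2 by ring,
      show u - 1 + (v - 1) = u + v - 2 by ring, show u - 1 - (v - 1) = u - v by ring]
    linarith
  all_goals
    have e1 : ∀ a b : ℝ, |-a + b| = |a - b| := fun a b => by rw [← abs_neg]; ring_nf
    have e2 : ∀ a b : ℝ, |-a - b| = |a + b| := fun a b => by rw [← abs_neg]; ring_nf
    simp only [e1, e2, ← sub_eq_add_neg, sub_neg_eq_add]
    linarith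

end IsSkewPositive

/-- The sign `+1` for the label `0`, and `-1` for the label `1`. -/
def labelSign (b : Fin 2) : ℝ := if b = 0 then 1 else -1

/-- The positions are split into those where `F` fails, which add up to the first argument of `H`,
and those where it holds, which add up to the second. -/
theorem IsSkewPositive.sum_prod_nonneg {n : ℕ} {w : Fin n → Fin 2 → ℝ} (hw0 : ∀ i, 0 ≤ w i 1)
    (hw : ∀ i, w i 1 ≤ w i 0) (F : Fin n → Prop) [DecidablePred F] {H : ℝ → ℝ → ℝ}
    (hH : IsSkewPositive H) :
    0 ≤ ∑ x : Fin n → Fin 2, (∏ i, w i (x i)) *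
      H (∑ i, if F i then 0 else labelSign (x i)) (∑ i, if F i then labelSign (x i) else 0) := by
  induction n generalizing H with
  | zero => simp; linarith [hH.sym 0 0, neg_zero (G := ℝ), (by simpa using hH.sym 0 0 :
      0 ≤ H 0 0 + H 0 0 + H 0 0 + H 0 0)]
  | succ n ih =>
    rw [sum_fin_cons, Finset.sum_comm]
    simp only [Fin.prod_univ_succ, Fin.sum_univ_succ (n := n), Fin.cons_zero, Fin.cons_succ,
      Fin.sum_univ_two, Fin.isValue]
    by_cases hF : F 0
    · have := ih (w := fun i => w i.succ) (fun i => hw0 i.succ) (fun i => hw i.succ)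
        (fun i => F i.succ) (hH.swap.average (hw0 0) (hw 0)).swap
      refine this.trans (le_of_eq (Finset.sum_congr rfl fun x _ => ?_))
      simp only [if_pos hF, labelSign, if_true, zero_add, one_ne_zero, if_false]
      rw [add_comm (1 : ℝ), add_comm (-1 : ℝ), ← sub_eq_add_neg]
      ring
    · have := ih (w := fun i => w i.succ) (fun i => hw0 i.succ) (fun i => hw i.succ)
        (fun i => F i.succ) (hH.average (hw0 0) (hw 0))
      refine this.trans (le_of_eq (Finset.sum_congr rfl fun x _ => ?_))
      simp only [if_neg hF, labelSign, if_true, zero_add, one_ne_zero, if_false]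
      rw [add_comm (1 : ℝ), add_comm (-1 : ℝ), ← sub_eq_add_neg]
      ring

theorem sum_prod_mul_indicator {n : ℕ} (w : Fin n → Fin 2 → ℝ) (i : Fin n) (b : Fin 2) :
    ∑ x : Fin n → Fin 2, (∏ j, w j (x j)) * (if x i = b then 1 else 0) =
      ∏ j, if j = i then w j b else ∑ d, w j d := by
  have : ∀ x : Fin n → Fin 2, (∏ j, w j (x j)) * (if x i = b then 1 else 0) =
      ∏ j, w j (x j) * (if j = i then (if x j = b then 1 else 0) else 1) := by
    intro x
    rw [Finset.prod_mul_distrib]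
    congr 1
    rw [Finset.prod_ite_eq' Finset.univ i (fun j => if x j = b then (1 : ℝ) else 0)]
    simp
  simp only [this]
  rw [sum_prod_apply (fun j d => w j d * (if j = i then (if d = b then 1 else 0) else 1))]
  refine Finset.prod_congr rfl fun j _ => ?_
  split_ifs <;> simp

/-- Independent labels. Among all labellings, the Bayes labels minimise the clustering error, and
that error is then bounded below using `min D (n - D) = D - (2D - n)⁺` and
`(2D - n)⁺ ≤ 2 / (e l) * exp (l (D - n / 2))`. -/
theorem sum_prod_mul_min_mis_ge {n : ℕ} {w : Fin n → Fin 2 → ℝ} (hw : ∀ i b, 0 ≤ w i b)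
    (s : Fin n → Fin 2) {l : ℝ} (hl : 0 < l) :
    (∑ i, ∏ j, if j = i then min (w j 0) (w j 1) else w j 0 + w j 1) -
      2 / (Real.exp 1 * l) * ∏ i, (max (w i 0) (w i 1) * Real.exp (-(l / 2)) +
        min (w i 0) (w i 1) * Real.exp (l / 2)) ≤
    ∑ x, (∏ i, w i (x i)) * min (mis s id x : ℝ) (n - mis s id x) := by
  classical
  -- relabel so that the Bayes label is `0` everywhere; `F` is the set where `s` differs from it
  let t : Fin n → Fin 2 := fun i => if w i 1 ≤ w i 0 then 0 else 1
  let w' : Fin n → Fin 2 → ℝ := fun i b => w i (t i + b)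
  have hw'0 : ∀ i, w' i 0 = max (w i 0) (w i 1) := by
    intro i
    simp only [w', t]
    split_ifs with h
    · simpa using h
    · simp [max_eq_right (not_le.1 h).le]
  have hw'1 : ∀ i, w' i 1 = min (w i 0) (w i 1) := by
    intro i
    simp only [w', t]
    split_ifs with h
    · simpa using h
    · simp [min_eq_left (not_le.1 h).le]
  have hle : ∀ i, w' i 1 ≤ w' i 0 := fun i => by rw [hw'0, hw'1]; exact min_le_max
  have hw'nn : ∀ i b, 0 ≤ w' i b := fun i b => hw i _
  let F : Fin n → Prop := fun i => s i ≠ t i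
  let U : (Fin n → Fin 2) → ℝ := fun x => ∑ i, if F i then 0 else labelSign (x i)
  let V : (Fin n → Fin 2) → ℝ := fun x => ∑ i, if F i then labelSign (x i) else 0
  have hmis : ∀ x : Fin n → Fin 2, (n : ℝ) - 2 * mis s id (t + x) = U x - V x := by
    intro x
    have hn : (n : ℝ) = ∑ _i : Fin n, (1 : ℝ) := by simp
    rw [mis_eq_sum, hn, Finset.mul_sum, ← Finset.sum_sub_distrib]
    simp only [U, V, ← Finset.sum_sub_distrib]
    refine Finset.sum_congr rfl fun i _ => ?_
    have key : ∀ a b c : Fin 2, a ≠ b + c ↔ ((a ≠ b ∧ c = 0) ∨ (a = b ∧ c ≠ 0)) := by decide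
    simp only [F, labelSign, Pi.add_apply, id, key]
    by_cases hF : s i = t i <;> by_cases hx : x i = 0 <;> simp [hF, hx] <;> norm_num
  have hUV : ∀ x : Fin n → Fin 2, U x + V x = n - 2 * ∑ i, if x i = 1 then 1 else 0 := by
    intro x
    have hn : (n : ℝ) = ∑ _i : Fin n, (1 : ℝ) := by simp
    rw [hn, Finset.mul_sum, ← Finset.sum_sub_distrib]
    simp only [U, V, ← Finset.sum_add_distrib]
    refine Finset.sum_congr rfl fun i _ => ?_
    simp only [labelSign]
    generalize x i = c
    fin_cases c <;> by_cases hF : F i <;> simp [hF] <;> norm_num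
  -- the Bayes labels have the smallest clustering error
  have hcmp : ∑ x : Fin n → Fin 2, (∏ i, w' i (x i)) * |U x - V x| ≤
      ∑ x, (∏ i, w' i (x i)) * |U x + V x| := by
    have := IsSkewPositive.abs_add_sub_abs_sub.sum_prod_nonneg (fun i => hw'nn i 1) hle F
    simp only [mul_sub, Finset.sum_sub_distrib] at this
    exact sub_nonneg.1 this
  have hp0 : ∀ x : Fin n → Fin 2, 0 ≤ ∏ i, w' i (x i) := fun x =>
    Finset.prod_nonneg fun i _ => hw'nn i _
  have hchange : ∑ x, (∏ i, w i (x i)) * min (mis s id x : ℝ) (n - mis s id x) =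
      ∑ x, (∏ i, w' i (x i)) * ((n - |U x - V x|) / 2) := by
    rw [← Equiv.sum_comp (Equiv.addLeft t)]
    refine Finset.sum_congr rfl fun x _ => ?_
    simp only [Equiv.coe_addLeft]
    congr 1
    rw [← hmis]
    rcases le_total (mis s id (t + x) : ℝ) (n - mis s id (t + x)) with h | h
    · rw [min_eq_left h, abs_of_nonneg (by linarith)]; ring
    · rw [min_eq_right h, abs_of_nonpos (by linarith)]; ring
  have hexp1 : 0 < Real.exp 1 := Real.exp_pos 1
  have hpt : ∀ x : Fin n → Fin 2, (∑ i, if x i = 1 then (1 : ℝ) else 0) -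
      2 / (Real.exp 1 * l) * Real.exp (-(l / 2) * (U x + V x)) ≤ (n - |U x + V x|) / 2 := by
    intro x
    have h1 := hUV x
    set X := U x + V x
    have h2 : (∑ i, if x i = 1 then (1 : ℝ) else 0) = (n - X) / 2 := by linarith
    rw [h2]
    -- the constant comes from `e v ≤ exp v` for `v = -(l / 2) * X`
    have h3 : (|X| - X) / 2 ≤ 2 / (Real.exp 1 * l) * Real.exp (-(l / 2) * X) := by
      rcases le_total 0 X with h | h
      · rw [abs_of_nonneg h, sub_self, zero_div]; positivity
      · rw [abs_of_nonpos h]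
        have h4 := Real.add_one_le_exp (-(l / 2) * X - 1)
        rw [Real.exp_sub] at h4
        have h5 : 2 / (Real.exp 1 * l) * Real.exp (-(l / 2) * X) =
            2 / l * (Real.exp (-(l / 2) * X) / Real.exp 1) := by field_simp
        rw [h5]
        have h6 := mul_le_mul_of_nonneg_left h4 (by positivity : 0 ≤ 2 / l)
        have h7 : 2 / l * (-(l / 2) * X - 1 + 1) = -X := by field_simp; ring
        linarith
    linarith
  have hfirst : ∑ x : Fin n → Fin 2, (∏ j, w' j (x j)) * (∑ i, if x i = 1 then (1 : ℝ) else 0) =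
      ∑ i, ∏ j, if j = i then min (w j 0) (w j 1) else w j 0 + w j 1 := by
    simp only [Finset.mul_sum]
    rw [Finset.sum_comm]
    refine Finset.sum_congr rfl fun i _ => ?_
    rw [sum_prod_mul_indicator]
    refine Finset.prod_congr rfl fun j _ => ?_
    rw [Fin.sum_univ_two, hw'0, hw'1, max_add_min]
  have hsecond : ∑ x : Fin n → Fin 2, (∏ j, w' j (x j)) * Real.exp (-(l / 2) * (U x + V x)) =
      ∏ i, (max (w i 0) (w i 1) * Real.exp (-(l / 2)) +
        min (w i 0) (w i 1) * Real.exp (l / 2)) := by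
    have : ∀ x : Fin n → Fin 2, (∏ j, w' j (x j)) * Real.exp (-(l / 2) * (U x + V x)) =
        ∏ j, w' j (x j) * Real.exp (-(l / 2) * labelSign (x j)) := by
      intro x
      rw [Finset.prod_mul_distrib, ← Real.exp_sum, ← Finset.mul_sum]
      congr 3
      simp only [U, V, ← Finset.sum_add_distrib]
      refine Finset.sum_congr rfl fun i _ => ?_
      split_ifs <;> simp
    simp only [this]
    rw [sum_prod_apply (fun j b => w' j b * Real.exp (-(l / 2) * labelSign b))]
    refine Finset.prod_congr rfl fun i _ => ?_
    simp [Fin.sum_univ_two, hw'0, hw'1, labelSign]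
  rw [hchange, ← hfirst, ← hsecond, Finset.mul_sum, ← Finset.sum_sub_distrib]
  calc _ ≤ ∑ x, (∏ i, w' i (x i)) * ((n - |U x + V x|) / 2) := by
        refine Finset.sum_le_sum fun x _ => ?_
        have := mul_le_mul_of_nonneg_left (hpt x) (hp0 x)
        linarith
    _ ≤ _ := by
        have : ∀ y : (Fin n → Fin 2) → ℝ, ∑ x, (∏ i, w' i (x i)) * ((n - y x) / 2) =
            n / 2 * ∑ x : Fin n → Fin 2, (∏ i, w' i (x i)) -
              1 / 2 * ∑ x, (∏ i, w' i (x i)) * y x := by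
          intro y
          rw [Finset.mul_sum, Finset.mul_sum, ← Finset.sum_sub_distrib]
          exact Finset.sum_congr rfl fun x _ => by ring
        rw [this fun x => |U x + V x|, this fun x => |U x - V x|]
        linarith

/-! ### The frequencies of pairs of labels -/

open Finset in
/-- A union bound over the ordered pairs of labels. -/
theorem sum_mul_not_pairsFrequent_le {n J : ℕ} {p : (Fin n → Fin J) → ℝ} (hp : ∀ x, 0 ≤ p x)
    {m B : ℝ} (hB0 : 0 ≤ B)
    (hB : ∀ j k, j ≠ k → ∑ x, p x *
      (if m ≤ ∑ i, (if x i = j ∨ x i = k then (1 : ℝ) else 0) then 0 else 1) ≤ B) :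
    ∑ x, p x * (open Classical in if PairsFrequent m x then (0 : ℝ) else 1) ≤ (J : ℝ) ^ 2 * B := by
  classical
  let g : Fin J × Fin J → (Fin n → Fin J) → ℝ := fun q x => if q.1 ≠ q.2 then
    (if m ≤ ∑ i, (if x i = q.1 ∨ x i = q.2 then (1 : ℝ) else 0) then 0 else 1) else 0
  have hg : ∀ q x, 0 ≤ g q x := fun q x => by simp only [g]; split_ifs <;> simp
  have hpt : ∀ x, (if PairsFrequent m x then (0 : ℝ) else 1) ≤ ∑ q, g q x := by
    intro x
    split_ifs with h
    · exact sum_nonneg fun q _ => hg q x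
    · unfold PairsFrequent at h
      push Not at h
      obtain ⟨j, k, hjk, hlt⟩ := h
      refine le_trans (le_of_eq ?_) (single_le_sum (fun q _ => hg q x) (mem_univ (j, k)))
      rw [card_filter] at hlt
      push_cast at hlt
      simp only [g, ne_eq, hjk, not_false_eq_true, if_true, if_neg (not_le.2 hlt)]
  calc _ ≤ ∑ x, p x * ∑ q, g q x :=
        sum_le_sum fun x _ => mul_le_mul_of_nonneg_left (hpt x) (hp x)
    _ = ∑ q, ∑ x, p x * g q x := by
        simp only [mul_sum]
        rw [sum_comm]
    _ ≤ ∑ _q : Fin J × Fin J, B := by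
        refine sum_le_sum fun q _ => ?_
        by_cases h : q.1 ≠ q.2
        · simpa only [g, if_pos h] using hB q.1 q.2 h
        · simpa only [g, if_neg h, mul_zero, sum_const_zero] using hB0
    _ = _ := by simp [sq]

/-- Lower tail for the number of visits of a Doeblin chain. -/
theorem IsDoeblin.lower_tail {n J : ℕ} (hn : 1 ≤ n) {ρ : ℝ} (hρ0 : 0 ≤ ρ)
    (hρ : ρ < 1) {P : Fin n → Fin J → Fin J → ℝ} (hP : IsDoeblin ρ P) (a : Fin J)
    {φ : Fin J → ℝ} (h0 : ∀ b, 0 ≤ φ b) (h1 : ∀ b, φ b ≤ 1) {β : ℝ} (hβ : 0 < β)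
    (hmean : ∀ i, β ≤ ∑ x, chainWeight P a x * φ (x i)) :
    ∑ x, chainWeight P a x * (if n * β / 2 ≤ ∑ i, φ (x i) then (0 : ℝ) else 1) ≤
      Real.exp (-(n * (1 - ρ) ^ 2 * β ^ 2) / 2) := by
  have hn' : (0 : ℝ) < n := by exact_mod_cast hn
  have hp0 : ∀ x, 0 ≤ chainWeight P a x :=
    chainWeight_nonneg (fun i a b => hP.nonneg hρ.le i a b) a
  have hρ1 : 0 < 1 - ρ := by linarith
  -- the optimal exponent in the Chernoff bound
  set t := 2 * β * (1 - ρ) ^ 2 with ht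
  have ht0 : 0 < t := by positivity
  have hM : n * β ≤ chainMean P (fun _ => φ) a := by
    unfold chainMean
    simp only [Finset.mul_sum]
    rw [Finset.sum_comm]
    calc (n : ℝ) * β = ∑ _i : Fin n, β := by simp
      _ ≤ _ := Finset.sum_le_sum fun i _ => hmean i
  have h := sum_chainWeight_mul_exp_le hρ0 hρ hP (φ := fun _ => φ) (fun _ => h0) (fun _ => h1)
    (-t) a
  calc _ ≤ ∑ x, chainWeight P a x * (Real.exp (-(t * (n * β / 2))) *
        Real.exp (-t * (∑ i, φ (x i) - chainMean P (fun _ => φ) a))) := by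
        refine Finset.sum_le_sum fun x _ => mul_le_mul_of_nonneg_left ?_ (hp0 x)
        rw [← Real.exp_add]
        split_ifs with hx
        · exact (Real.exp_pos _).le
        · rw [Real.one_le_exp_iff]
          push Not at hx
          nlinarith
    _ = Real.exp (-(t * (n * β / 2))) * ∑ x, chainWeight P a x *
        Real.exp (-t * (∑ i, φ (x i) - chainMean P (fun _ => φ) a)) := by
        rw [Finset.mul_sum]
        exact Finset.sum_congr rfl fun x _ => by ring
    _ ≤ Real.exp (-(t * (n * β / 2))) * Real.exp (n * ((-t) ^ 2 * (1 / (1 - ρ)) ^ 2 / 8)) :=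
        mul_le_mul_of_nonneg_left h (Real.exp_pos _).le
    _ = _ := by
        rw [← Real.exp_add]
        congr 1
        rw [ht]
        field_simp
        ring

/-- Multiplicative Chernoff bound for the lower tail in the independent case, with exponent
`log 2`. -/
theorem sum_prod_mul_lower_tail {n J : ℕ} {ν : Fin J → ℝ} (hν : ∀ b, 0 ≤ ν b)
    (hν1 : ∑ b, ν b = 1) {φ : Fin J → ℝ} (hφ : ∀ b, φ b = 0 ∨ φ b = 1) {β : ℝ} (hβ0 : 0 ≤ β)
    (hβ : β ≤ ∑ b, ν b * φ b) :
    ∑ x : Fin n → Fin J, (∏ i, ν (x i)) * (if n * β / 2 ≤ ∑ i, φ (x i) then (0 : ℝ) else 1) ≤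
      Real.exp (-(n * β) / 8) := by
  have hn0 : (0 : ℝ) ≤ n := Nat.cast_nonneg n
  set t := Real.log 2 with ht
  have ht0 : 0 < t := Real.log_pos one_lt_two
  have ht1 : t < 3 / 4 := by linarith [Real.log_two_lt_d9]
  have hfac : ∑ b, ν b * Real.exp (-t * φ b) ≤ Real.exp (-(β / 2)) := by
    have : ∀ b, ν b * Real.exp (-t * φ b) = ν b - 1 / 2 * (ν b * φ b) := by
      intro b
      rcases hφ b with h | h
      · simp [h]
      · rw [h, mul_one, Real.exp_neg, ht, Real.exp_log two_pos]; ring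
    simp only [this, Finset.sum_sub_distrib, ← Finset.mul_sum, hν1]
    linarith [Real.add_one_le_exp (-(β / 2))]
  have hfac0 : 0 ≤ ∑ b, ν b * Real.exp (-t * φ b) :=
    Finset.sum_nonneg fun b _ => mul_nonneg (hν b) (Real.exp_pos _).le
  calc _ ≤ ∑ x : Fin n → Fin J, Real.exp (t * (n * β / 2)) *
        ∏ i, ν (x i) * Real.exp (-t * φ (x i)) := by
        refine Finset.sum_le_sum fun x _ => ?_
        rw [Finset.prod_mul_distrib, mul_left_comm, ← Real.exp_sum, ← Finset.mul_sum,
          ← Real.exp_add]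
        refine mul_le_mul_of_nonneg_left ?_ (Finset.prod_nonneg fun i _ => hν _)
        split_ifs with hx
        · exact (Real.exp_pos _).le
        · rw [Real.one_le_exp_iff]
          push Not at hx
          nlinarith
    _ = Real.exp (t * (n * β / 2)) * (∑ b, ν b * Real.exp (-t * φ b)) ^ n := by
        rw [← Finset.mul_sum, sum_prod_apply (fun _ b => ν b * Real.exp (-t * φ b))]
        simp
    _ ≤ Real.exp (t * (n * β / 2)) * Real.exp (-(β / 2)) ^ n := by gcongr
    _ ≤ _ := by
        rw [← Real.exp_nat_mul, ← Real.exp_add]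
        apply Real.exp_le_exp.2
        have : 0 ≤ n * β := mul_nonneg hn0 hβ0
        nlinarith

namespace Param

variable {J : ℕ} {𝕐 : Type*} [MeasurableSpace 𝕐] {L : Measure 𝕐}

/-! ### Densities with respect to the mixture of the emission distributions -/

theorem J_pos (θ : Param J L) : 0 < J := by
  rcases Nat.eq_zero_or_pos J with h | h
  · subst h
    have := θ.ν_sum
    simp at this
  · exact h

/-- The sum of the emission densities. -/
def mixDensity (θ : Param J L) (y : 𝕐) : ℝ := ∑ x, θ.f x y

/-- The sum of the emission distributions. It is finite and dominates all of them, whereas `L` need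
not be σ-finite. -/
def mix (θ : Param J L) : Measure 𝕐 := L.withDensity fun y => ENNReal.ofReal (θ.mixDensity y)

/-- The density of the emission distribution `F_x` with respect to `θ.mix`. On the null set where
all the `f_x` vanish, its value is chosen so that the densities always sum to one. -/
def g (θ : Param J L) (x : Fin J) (y : 𝕐) : ℝ :=
  if θ.mixDensity y = 0 then 1 / J else θ.f x y / θ.mixDensity y

theorem mixDensity_nonneg (θ : Param J L) (y : 𝕐) : 0 ≤ θ.mixDensity y :=
  Finset.sum_nonneg fun x _ => θ.f_nonneg x y

theorem measurable_mixDensity (θ : Param J L) : Measurable θ.mixDensity :=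
  Finset.measurable_sum _ fun x _ => θ.f_measurable x

theorem g_nonneg (θ : Param J L) (x : Fin J) (y : 𝕐) : 0 ≤ θ.g x y := by
  unfold g
  split_ifs
  · positivity
  · exact div_nonneg (θ.f_nonneg x y) (θ.mixDensity_nonneg y)

theorem sum_g (θ : Param J L) (y : 𝕐) : ∑ x, θ.g x y = 1 := by
  unfold g
  split_ifs with h
  · have : (J : ℝ) ≠ 0 := by exact_mod_cast θ.J_pos.ne'
    simp [this]
  · rw [← Finset.sum_div]; exact div_self h

theorem g_le_one (θ : Param J L) (x : Fin J) (y : 𝕐) : θ.g x y ≤ 1 := by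
  rw [← θ.sum_g y]
  exact Finset.single_le_sum (f := fun x => θ.g x y) (fun x _ => θ.g_nonneg x y)
    (Finset.mem_univ x)

theorem measurable_g (θ : Param J L) (x : Fin J) : Measurable (θ.g x) := by
  unfold g
  exact Measurable.ite (θ.measurable_mixDensity (measurableSet_singleton 0)) measurable_const
    ((θ.f_measurable x).div θ.measurable_mixDensity)

theorem mixDensity_mul_g (θ : Param J L) (x : Fin J) (y : 𝕐) :
    θ.mixDensity y * θ.g x y = θ.f x y := by
  unfold g
  split_ifs with h
  · have h2 : ∀ x ∈ Finset.univ, θ.f x y = 0 :=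
      (Finset.sum_eq_zero_iff_of_nonneg fun x _ => θ.f_nonneg x y).1 h
    rw [h, h2 x (Finset.mem_univ x), zero_mul]
  · rw [mul_div_cancel₀ _ h]

theorem emission_eq (θ : Param J L) (x : Fin J) :
    θ.emission x = θ.mix.withDensity fun y => ENNReal.ofReal (θ.g x y) := by
  unfold emission mix
  rw [← withDensity_mul _ θ.measurable_mixDensity.ennreal_ofReal
    (θ.measurable_g x).ennreal_ofReal]
  congr 1
  funext y
  rw [Pi.mul_apply, ← ENNReal.ofReal_mul (θ.mixDensity_nonneg y), mixDensity_mul_g]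

instance (θ : Param J L) (x : Fin J) : IsProbabilityMeasure (θ.emission x) :=
  ⟨by rw [emission, withDensity_apply _ MeasurableSet.univ, Measure.restrict_univ,
    θ.f_lintegral x]⟩

instance (θ : Param J L) : IsFiniteMeasure θ.mix := by
  refine ⟨?_⟩
  rw [mix, withDensity_apply _ MeasurableSet.univ, Measure.restrict_univ]
  have : ∀ y, ENNReal.ofReal (θ.mixDensity y) = ∑ x, ENNReal.ofReal (θ.f x y) := fun y =>
    ENNReal.ofReal_sum_of_nonneg fun x _ => θ.f_nonneg x y
  simp only [this]
  rw [lintegral_finsetSum _ fun x _ => (θ.f_measurable x).ennreal_ofReal]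
  simp [θ.f_lintegral]

theorem integrable_of_le {μ : Measure 𝕐} [IsFiniteMeasure μ] {h : 𝕐 → ℝ} (hm : Measurable h)
    {C : ℝ} (hC : ∀ y, |h y| ≤ C) : Integrable h μ :=
  Integrable.of_bound hm.aestronglyMeasurable C (Filter.Eventually.of_forall hC)

theorem integrable_g (θ : Param J L) (x : Fin J) : Integrable (θ.g x) θ.mix :=
  integrable_of_le (θ.measurable_g x) (C := 1) fun y => by
    rw [abs_of_nonneg (θ.g_nonneg x y)]; exact θ.g_le_one x y

theorem integral_g (θ : Param J L) (x : Fin J) : ∫ y, θ.g x y ∂θ.mix = 1 := by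
  rw [integral_eq_lintegral_of_nonneg_ae (Filter.Eventually.of_forall (θ.g_nonneg x))
    (θ.measurable_g x).aestronglyMeasurable]
  have h : θ.emission x Set.univ = 1 := measure_univ
  rw [emission_eq, withDensity_apply _ MeasurableSet.univ, Measure.restrict_univ] at h
  rw [h, ENNReal.toReal_one]

theorem integral_emission (θ : Param J L) (x : Fin J) (h : 𝕐 → ℝ) :
    ∫ y, h y ∂θ.emission x = ∫ y, θ.g x y * h y ∂θ.mix := by
  rw [emission_eq, integral_withDensity_eq_integral_toReal_smul
    (θ.measurable_g x).ennreal_ofReal (Filter.Eventually.of_forall fun y => ENNReal.ofReal_lt_top)]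
  refine integral_congr_ae (Filter.Eventually.of_forall fun y => ?_)
  simp only [ENNReal.toReal_ofReal (θ.g_nonneg x y), smul_eq_mul]

theorem pi_emission (θ : Param J L) {n : ℕ} (x : Fin n → Fin J) :
    Measure.pi (fun i => θ.emission (x i)) = (Measure.pi fun _ : Fin n => θ.mix).withDensity
      fun y => ENNReal.ofReal (∏ i, θ.g (x i) (y i)) := by
  symm
  refine (Measure.pi_eq fun s hs => ?_).symm
  have hS : MeasurableSet (Set.univ.pi s) := MeasurableSet.univ_pi hs
  rw [withDensity_apply _ hS, ← lintegral_indicator hS]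
  have hind : ∀ y : Fin n → 𝕐, (Set.univ.pi s).indicator
      (fun y => ENNReal.ofReal (∏ i, θ.g (x i) (y i))) y =
      ENNReal.ofReal (∏ i, (s i).indicator (θ.g (x i)) (y i)) := by
    intro y
    by_cases hy : y ∈ Set.univ.pi s
    · rw [Set.indicator_of_mem hy]
      congr 1
      refine Finset.prod_congr rfl fun i _ => ?_
      rw [Set.indicator_of_mem (hy i (Set.mem_univ i))]
    · rw [Set.indicator_of_notMem hy]
      obtain ⟨i, hi⟩ : ∃ i, y i ∉ s i := by
        by_contra hcon
        push Not at hcon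
        exact hy fun i _ => hcon i
      rw [Finset.prod_eq_zero (Finset.mem_univ i) (Set.indicator_of_notMem hi _),
        ENNReal.ofReal_zero]
  have hnn : ∀ i y, 0 ≤ (s i).indicator (θ.g (x i)) y := fun i y =>
    Set.indicator_nonneg (fun y _ => θ.g_nonneg _ y) y
  have hint : ∀ i, Integrable ((s i).indicator (θ.g (x i))) θ.mix := fun i =>
    (θ.integrable_g (x i)).indicator (hs i)
  simp only [hind]
  rw [← ofReal_integral_eq_lintegral_ofReal (Integrable.fintype_prod hint)
    (Filter.Eventually.of_forall fun y => Finset.prod_nonneg fun i _ => hnn i _),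
    integral_fintype_prod_eq_prod (fun i => (s i).indicator (θ.g (x i))),
    ENNReal.ofReal_prod_of_nonneg fun i _ => integral_nonneg (hnn i)]
  refine Finset.prod_congr rfl fun i _ => ?_
  rw [ofReal_integral_eq_lintegral_ofReal (hint i) (Filter.Eventually.of_forall (hnn i)),
    emission_eq, withDensity_apply _ (hs i), ← lintegral_indicator (hs i)]
  refine lintegral_congr fun y => ?_
  by_cases hy : y ∈ s i
  · rw [Set.indicator_of_mem hy, Set.indicator_of_mem hy]
  · rw [Set.indicator_of_notMem hy, Set.indicator_of_notMem hy, ENNReal.ofReal_zero]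

/-- The joint density `P(X_{1:n} = x) ∏ g_{x_i}(y_i)` of labels and observations. -/
def lik (θ : Param J L) {n : ℕ} (y : Fin n → 𝕐) (x : Fin n → Fin J) : ℝ :=
  θ.pathProb x * ∏ i, θ.g (x i) (y i)

theorem pathProb_nonneg (θ : Param J L) {n : ℕ} (x : Fin n → Fin J) : 0 ≤ θ.pathProb x :=
  Finset.prod_nonneg fun i _ => by split_ifs; exacts [θ.ν_nonneg _, θ.Q_nonneg _ _]

theorem lik_nonneg (θ : Param J L) {n : ℕ} (y : Fin n → 𝕐) (x : Fin n → Fin J) :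
    0 ≤ θ.lik y x :=
  mul_nonneg (θ.pathProb_nonneg x) (Finset.prod_nonneg fun _ _ => θ.g_nonneg _ _)

theorem measurable_prod_g (θ : Param J L) {n : ℕ} (x : Fin n → Fin J) :
    Measurable fun y : Fin n → 𝕐 => ∏ i, θ.g (x i) (y i) :=
  Finset.measurable_prod _ fun i _ => (θ.measurable_g (x i)).comp (measurable_pi_apply i)

theorem lik_le (θ : Param J L) {n : ℕ} (y : Fin n → 𝕐) (x : Fin n → Fin J) :
    θ.lik y x ≤ θ.pathProb x :=
  mul_le_of_le_one_right (θ.pathProb_nonneg x)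
    (Finset.prod_le_one (fun _ _ => θ.g_nonneg _ _) fun _ _ => θ.g_le_one _ _)

theorem integrable_lik_mul (θ : Param J L) {n : ℕ} (x : Fin n → Fin J) {F : (Fin n → 𝕐) → ℝ}
    (hF : Measurable F) {C : ℝ} (hC : ∀ y, |F y| ≤ C) :
    Integrable (fun y => θ.lik y x * F y) (Measure.pi fun _ => θ.mix) := by
  refine integrable_of_le (((θ.measurable_prod_g x).const_mul _).mul hF)
    (C := θ.pathProb x * C) fun y => ?_
  rw [abs_mul, abs_of_nonneg (θ.lik_nonneg y x)]
  exact mul_le_mul (θ.lik_le y x) (hC y) (abs_nonneg _) (θ.pathProb_nonneg x)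

theorem integral_pi_emission (θ : Param J L) {n : ℕ} (x : Fin n → Fin J) (F : (Fin n → 𝕐) → ℝ) :
    ∫ y, F y ∂Measure.pi (fun i => θ.emission (x i)) =
      ∫ y, (∏ i, θ.g (x i) (y i)) * F y ∂Measure.pi fun _ => θ.mix := by
  rw [pi_emission, integral_withDensity_eq_integral_toReal_smul
    (θ.measurable_prod_g x).ennreal_ofReal
    (Filter.Eventually.of_forall fun y => ENNReal.ofReal_lt_top)]
  refine integral_congr_ae (Filter.Eventually.of_forall fun y => ?_)
  simp only [ENNReal.toReal_ofReal (Finset.prod_nonneg fun i _ => θ.g_nonneg (x i) (y i)),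
    smul_eq_mul]

theorem integral_law_eq_sum (θ : Param J L) {n : ℕ}
    {F : (Fin n → Fin J) × (Fin n → 𝕐) → ℝ} (hF : ∀ x, Measurable fun y => F (x, y)) {C : ℝ}
    (hC : ∀ ω, |F ω| ≤ C) :
    ∫ ω, F ω ∂θ.law n =
      ∑ x, θ.pathProb x * ∫ y, F (x, y) ∂Measure.pi (fun i => θ.emission (x i)) := by
  have hFm : Measurable F := measurable_from_prod_countable_right hF
  have hint : ∀ x : Fin n → Fin J, Integrable F
      (ENNReal.ofReal (θ.pathProb x) •
        (Measure.dirac x).prod (Measure.pi fun i => θ.emission (x i))) := fun x =>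
    (Integrable.of_bound hFm.aestronglyMeasurable C (Filter.Eventually.of_forall hC)).smul_measure
      ENNReal.ofReal_ne_top
  rw [law, integral_finsetSum_measure fun x _ => hint x]
  refine Finset.sum_congr rfl fun x _ => ?_
  rw [integral_smul_measure, ENNReal.toReal_ofReal (θ.pathProb_nonneg x), smul_eq_mul,
    Measure.dirac_prod, integral_map (by fun_prop) hFm.aestronglyMeasurable]

/-- Integration against the joint law through the joint density. -/
theorem integral_law (θ : Param J L) {n : ℕ}
    {F : (Fin n → Fin J) × (Fin n → 𝕐) → ℝ} (hF : ∀ x, Measurable fun y => F (x, y)) {C : ℝ}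
    (hC : ∀ ω, |F ω| ≤ C) :
    ∫ ω, F ω ∂θ.law n = ∫ y, ∑ x, θ.lik y x * F (x, y) ∂Measure.pi fun _ => θ.mix := by
  rw [integral_finsetSum _ fun x _ => θ.integrable_lik_mul x (hF x) fun y => hC (x, y),
    θ.integral_law_eq_sum hF hC]
  refine Finset.sum_congr rfl fun x _ => ?_
  rw [integral_pi_emission, ← integral_const_mul]
  simp only [lik, mul_assoc]

/-- The integrand of `Λ`, for the densities with respect to `θ.mix`. -/
def minG (θ : Param J L) (y : 𝕐) : ℝ := ⨅ x₀ : Fin J, ∑ x ∈ Finset.univ.erase x₀, θ.g x y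

theorem minG_nonneg (θ : Param J L) (y : 𝕐) : 0 ≤ θ.minG y :=
  Real.iInf_nonneg fun _ => Finset.sum_nonneg fun x _ => θ.g_nonneg x y

theorem minG_le (θ : Param J L) (x₀ : Fin J) (y : 𝕐) :
    θ.minG y ≤ ∑ x ∈ Finset.univ.erase x₀, θ.g x y :=
  ciInf_le (Set.finite_range _).bddBelow x₀

theorem minG_le_one (θ : Param J L) (y : 𝕐) : θ.minG y ≤ 1 := by
  refine (θ.minG_le ⟨0, θ.J_pos⟩ y).trans ?_
  rw [← θ.sum_g y]
  exact Finset.sum_le_sum_of_subset_of_nonneg (Finset.subset_univ _) fun x _ _ => θ.g_nonneg x y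

theorem measurable_minG (θ : Param J L) : Measurable θ.minG :=
  Measurable.iInf fun _ => Finset.measurable_sum _ fun x _ => θ.measurable_g x

theorem integrable_minG (θ : Param J L) : Integrable θ.minG θ.mix :=
  integrable_of_le θ.measurable_minG (C := 1) fun y => by
    rw [abs_of_nonneg (θ.minG_nonneg y)]; exact θ.minG_le_one y

theorem Λ_eq (θ : Param J L) : θ.Λ = ∫ y, θ.minG y ∂θ.mix := by
  rw [mix, integral_withDensity_eq_integral_toReal_smul θ.measurable_mixDensity.ennreal_ofReal
    (Filter.Eventually.of_forall fun y => ENNReal.ofReal_lt_top)]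
  unfold Λ
  refine integral_congr_ae (Filter.Eventually.of_forall fun y => ?_)
  simp only [ENNReal.toReal_ofReal (θ.mixDensity_nonneg y), smul_eq_mul, minG]
  rw [Real.mul_iInf_of_nonneg (θ.mixDensity_nonneg y)]
  simp only [Finset.mul_sum, mixDensity_mul_g]

theorem Λ_nonneg (θ : Param J L) : 0 ≤ θ.Λ := by
  rw [Λ_eq]; exact integral_nonneg θ.minG_nonneg

theorem Λ_le (θ : Param J L) : θ.Λ ≤ J := by
  rw [Λ_eq]
  calc ∫ y, θ.minG y ∂θ.mix ≤ ∫ y, ∑ x, θ.g x y ∂θ.mix := by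
        refine integral_mono θ.integrable_minG
          (integrable_finsetSum _ fun x _ => θ.integrable_g x) fun y => ?_
        simp only [sum_g]
        exact θ.minG_le_one y
    _ = J := by
        rw [integral_finsetSum _ fun x _ => θ.integrable_g x]
        simp [integral_g]

/-! ### The label chain -/

/-- The transition kernels of the label chain, started from an arbitrary fictitious state. -/
def kern (θ : Param J L) {n : ℕ} (i : Fin n) (a b : Fin J) : ℝ :=
  if i.val = 0 then θ.ν b else θ.Q a b

theorem pathProb_eq (θ : Param J L) {n : ℕ} (a : Fin J) (x : Fin n → Fin J) :
    θ.pathProb x = chainWeight θ.kern a x := by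
  unfold pathProb chainWeight kern
  refine Finset.prod_congr rfl fun i _ => ?_
  split_ifs with h
  · rfl
  · congr 1
    have : i.castSucc = Fin.succ ⟨i.val - 1, lt_of_le_of_lt (Nat.sub_le _ _) i.isLt⟩ := by
      apply Fin.ext
      simp only [Fin.val_castSucc, Fin.val_succ]
      omega
    rw [this, Fin.cons_succ]

theorem lik_eq (θ : Param J L) {n : ℕ} (a : Fin J) (y : Fin n → 𝕐) (x : Fin n → Fin J) :
    θ.lik y x = chainWeight (fun i a b => θ.kern i a b * θ.g b (y i)) a x := by
  rw [lik, θ.pathProb_eq a]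
  unfold chainWeight
  rw [Finset.prod_mul_distrib]

theorem kern_sum (θ : Param J L) {n : ℕ} (i : Fin n) (a : Fin J) : ∑ b, θ.kern i a b = 1 := by
  unfold kern
  split_ifs
  exacts [θ.ν_sum, θ.Q_sum a]

theorem kern_nonneg (θ : Param J L) {n : ℕ} (i : Fin n) (a b : Fin J) : 0 ≤ θ.kern i a b := by
  unfold kern
  split_ifs
  exacts [θ.ν_nonneg b, θ.Q_nonneg a b]

theorem sum_pathProb (θ : Param J L) (n : ℕ) : ∑ x : Fin n → Fin J, θ.pathProb x = 1 := by
  simp only [θ.pathProb_eq ⟨0, θ.J_pos⟩]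
  exact sum_chainWeight θ.kern_sum _

theorem δ_le_kern (θ : Param J L) (h : θ.Mixing) {n : ℕ} (i : Fin n) (a b : Fin J) :
    θ.δ ≤ θ.kern i a b := by
  unfold kern
  split_ifs
  · exact h.2 b
  · exact ciInf_le (Set.finite_range fun p : Fin J × Fin J => θ.Q p.1 p.2).bddBelow (a, b)

theorem J_mul_δ_le (θ : Param J L) (h : θ.Mixing) : J * θ.δ ≤ 1 := by
  rw [← θ.ν_sum]
  calc J * θ.δ = ∑ _x : Fin J, θ.δ := by simp
    _ ≤ _ := Finset.sum_le_sum fun x _ => h.2 x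

theorem kern_le (θ : Param J L) (h : θ.Mixing) {n : ℕ} (i : Fin n) (a b : Fin J) :
    θ.kern i a b ≤ 1 - ((J : ℝ) - 1) * θ.δ := by
  have h1 := θ.kern_sum i a
  rw [← Finset.add_sum_erase _ _ (Finset.mem_univ b)] at h1
  have h2 : ((J : ℝ) - 1) * θ.δ ≤ ∑ b' ∈ Finset.univ.erase b, θ.kern i a b' := by
    calc ((J : ℝ) - 1) * θ.δ = ∑ _b' ∈ Finset.univ.erase b, θ.δ := by
          rw [Finset.sum_const, Finset.card_erase_of_mem (Finset.mem_univ b), Finset.card_univ,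
            Fintype.card_fin, nsmul_eq_mul, Nat.cast_sub θ.J_pos, Nat.cast_one]
      _ ≤ _ := Finset.sum_le_sum fun b' _ => θ.δ_le_kern h i a b'
  linarith

end Param

/-! ### Resampling one label -/

/-- The map `(x, b) ↦ (x with x_i replaced by b, x_i)` is an involution. -/
theorem sum_sum_update {n J : ℕ} (i : Fin n) (F : (Fin n → Fin J) → ℝ) :
    ∑ x : Fin n → Fin J, ∑ b, F (Function.update x i b) = J * ∑ x, F x := by
  have hinv : Function.Involutive fun p : (Fin n → Fin J) × Fin J =>
      (Function.update p.1 i p.2, p.1 i) := by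
    rintro ⟨x, b⟩
    simp
  rw [← Fintype.sum_prod_type' fun x b => F (Function.update x i b)]
  have h := Equiv.sum_comp hinv.toPerm fun p : (Fin n → Fin J) × Fin J => F p.1
  refine h.trans ?_
  rw [Fintype.sum_prod_type]
  simp [Finset.mul_sum]

theorem sum_prod_mul_apply {n J : ℕ} {ν : Fin J → ℝ} (hν : ∑ b, ν b = 1) (φ : Fin J → ℝ)
    (i : Fin n) : ∑ x : Fin n → Fin J, (∏ j, ν (x j)) * φ (x i) = ∑ b, ν b * φ b := by
  have h : ∀ x : Fin n → Fin J, (∏ j, ν (x j)) * φ (x i) =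
      ∏ j, if j = i then ν (x j) * φ (x j) else ν (x j) := fun x => by
    rw [← Finset.mul_prod_erase _ _ (Finset.mem_univ i),
      ← Finset.mul_prod_erase _ _ (Finset.mem_univ i), if_pos rfl, mul_right_comm]
    congr 1
    refine Finset.prod_congr rfl fun j hj => ?_
    rw [if_neg (Finset.ne_of_mem_erase hj)]
  simp only [h]
  rw [sum_prod_apply fun j b => if j = i then ν b * φ b else ν b, Finset.prod_eq_single i]
  · simp
  · intro j _ hj
    simp only [if_neg hj, hν]
  · simp

/-- If the transition probabilities are at most `M`, so are the probabilities `P(X_i = b)`. -/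
theorem sum_chainWeight_mul_apply_le {n J : ℕ} {k : Fin n → Fin J → Fin J → ℝ} {M : ℝ}
    (hk0 : ∀ i a b, 0 ≤ k i a b) (hk1 : ∀ i a, ∑ b, k i a b = 1) (hM : ∀ i a b, k i a b ≤ M)
    {e : Fin J → ℝ} (he : ∀ b, 0 ≤ e b) (a : Fin J) (i : Fin n) :
    ∑ x, chainWeight k a x * e (x i) ≤ M * ∑ b, e b := by
  induction n generalizing a with
  | zero => exact i.elim0
  | succ n ih =>
    rw [sum_chainWeight_mul_succ]
    refine Fin.cases ?_ (fun i => ?_) i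
    · simp only [Fin.cons_zero, ← Finset.sum_mul,
        sum_chainWeight (k := fun i : Fin n => k i.succ) (fun i a => hk1 i.succ a), one_mul]
      rw [Finset.mul_sum]
      exact Finset.sum_le_sum fun b _ => mul_le_mul_of_nonneg_right (hM 0 a b) (he b)
    · simp only [Fin.cons_succ]
      calc ∑ b, k 0 a b * ∑ x, chainWeight (fun i => k i.succ) b x * e (x i)
          ≤ ∑ b, k 0 a b * (M * ∑ b, e b) :=
            Finset.sum_le_sum fun b _ => mul_le_mul_of_nonneg_left
              (ih (k := fun i => k i.succ) (fun i => hk0 i.succ) (fun i => hk1 i.succ)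
                (fun i => hM i.succ) b i) (hk0 0 a b)
        _ = M * ∑ b, e b := by rw [← Finset.sum_mul, hk1, one_mul]

namespace Param

variable {J : ℕ} {𝕐 : Type*} [MeasurableSpace 𝕐] {L : Measure 𝕐}

/-! ### The probability of a wrong label -/

/-- If the law of the label path dominates `c` times a law `p` under which the label `i` is uniform
and independent of the other labels, then the joint density of the observations and of the event
that a given guess of the label `i` is wrong dominates a function of integral `c / J * Λ`, whatever
the guess. -/
theorem exists_wrong_label_lower (θ : Param J L) {n : ℕ} (i : Fin n) {p : (Fin n → Fin J) → ℝ}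
    (hp0 : ∀ x, 0 ≤ p x) (hp1 : ∑ x, p x = 1)
    (hp : ∀ x b, p (Function.update x i b) = p x) {c : ℝ} (hc : 0 ≤ c)
    (hcp : ∀ x, c * p x ≤ θ.pathProb x) :
    ∃ T : (Fin n → 𝕐) → ℝ, Integrable T (Measure.pi fun _ => θ.mix) ∧
      ∫ y, T y ∂(Measure.pi fun _ => θ.mix) = c / J * θ.Λ ∧
      ∀ y b, T y ≤ ∑ x, if x i ≠ b then θ.lik y x else 0 := by
  have hJ : (0 : ℝ) < J := by exact_mod_cast θ.J_pos
  let G : (Fin n → Fin J) → Fin n → 𝕐 → ℝ := fun x j => if j = i then θ.minG else θ.g (x j)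
  have hG : ∀ x j, Integrable (G x j) θ.mix := fun x j => by
    by_cases h : j = i
    · simp only [G, h, if_true]; exact θ.integrable_minG
    · simp only [G, h, if_false]; exact θ.integrable_g _
  have hGint : ∀ x, ∫ y, ∏ j, G x j (y j) ∂(Measure.pi fun _ => θ.mix) = θ.Λ := fun x => by
    rw [integral_fintype_prod_eq_prod (fun j => G x j), Finset.prod_eq_single i]
    · simp only [G, if_true, Λ_eq]
    · intro j _ hj
      simp only [G, hj, if_false, integral_g]
    · simp
  refine ⟨fun y => c / J * ∑ x, p x * ∏ j, G x j (y j), ?_, ?_, ?_⟩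
  · exact (integrable_finsetSum _ fun x _ =>
      (Integrable.fintype_prod (hG x)).const_mul _).const_mul _
  · rw [integral_const_mul, integral_finsetSum _ fun x _ =>
      (Integrable.fintype_prod (hG x)).const_mul _]
    simp only [integral_const_mul, hGint, ← Finset.sum_mul, hp1, one_mul]
  · intro y b
    set F : (Fin n → Fin J) → ℝ := fun x =>
      c * p x * (if x i ≠ b then ∏ j, θ.g (x j) (y j) else 0) with hF
    have h1 : ∑ x, F x ≤ ∑ x, if x i ≠ b then θ.lik y x else 0 := by
      refine Finset.sum_le_sum fun x _ => ?_
      simp only [hF, lik]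
      split_ifs
      · exact mul_le_mul_of_nonneg_right (hcp x) (Finset.prod_nonneg fun j _ => θ.g_nonneg _ _)
      · simp
    refine le_trans ?_ h1
    beta_reduce
    rw [div_mul_eq_mul_div, div_le_iff₀ hJ, mul_comm _ (J : ℝ), ← sum_sum_update i F,
      Finset.mul_sum]
    refine Finset.sum_le_sum fun x _ => ?_
    simp only [hF, hp, Function.update_self]
    rw [← Finset.mul_sum, ← mul_assoc]
    refine mul_le_mul_of_nonneg_left ?_ (mul_nonneg hc (hp0 x))
    have h2 : ∀ b', ∏ j, θ.g (Function.update x i b' j) (y j) =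
        θ.g b' (y i) * ∏ j ∈ Finset.univ.erase i, θ.g (x j) (y j) := fun b' => by
      rw [← Finset.mul_prod_erase _ _ (Finset.mem_univ i), Function.update_self]
      congr 1
      refine Finset.prod_congr rfl fun j hj => ?_
      rw [Function.update_of_ne (Finset.ne_of_mem_erase hj)]
    have h3 : ∏ j, G x j (y j) = θ.minG (y i) * ∏ j ∈ Finset.univ.erase i, θ.g (x j) (y j) := by
      rw [← Finset.mul_prod_erase _ _ (Finset.mem_univ i)]
      congr 1
      · simp [G]
      · refine Finset.prod_congr rfl fun j hj => ?_
        simp only [G, Finset.ne_of_mem_erase hj, if_false]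
    simp only [h2]
    rw [h3, ← Finset.sum_filter, ← Finset.sum_mul]
    refine mul_le_mul_of_nonneg_right ?_ (Finset.prod_nonneg fun j _ => θ.g_nonneg _ _)
    rw [Finset.filter_ne']
    exact θ.minG_le b (y i)

theorem exists_wrong_label_lower_of_isInd (θ : Param J L) (hm : θ.Mixing) (hI : θ.IsInd) {n : ℕ}
    (i : Fin n) :
    ∃ T : (Fin n → 𝕐) → ℝ, Integrable T (Measure.pi fun _ => θ.mix) ∧
      ∫ y, T y ∂(Measure.pi fun _ => θ.mix) = θ.δ * θ.Λ ∧
      ∀ y b, T y ≤ ∑ x, if x i ≠ b then θ.lik y x else 0 := by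
  have hJ : (0 : ℝ) < J := by exact_mod_cast θ.J_pos
  have h := θ.exists_wrong_label_lower i
    (p := fun x => ∏ j, if j = i then 1 / (J : ℝ) else θ.ν (x j)) (c := J * θ.δ)
    (fun x => Finset.prod_nonneg fun j _ => by split_ifs; exacts [by positivity, θ.ν_nonneg _])
    ?_ ?_ (mul_nonneg hJ.le hm.1.le) ?_
  · rwa [mul_div_cancel_left₀ _ hJ.ne'] at h
  · rw [sum_prod_apply fun j b => if j = i then 1 / (J : ℝ) else θ.ν b]
    refine Finset.prod_eq_one fun j _ => ?_
    split_ifs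
    · simp [hJ.ne']
    · exact θ.ν_sum
  · intro x b
    refine Finset.prod_congr rfl fun j _ => ?_
    split_ifs with hj
    · rfl
    · rw [Function.update_of_ne hj]
  · intro x
    have h1 : J * θ.δ = ∏ j : Fin n, if j = i then J * θ.δ else 1 := by simp
    rw [h1, ← Finset.prod_mul_distrib]
    refine Finset.prod_le_prod (fun j _ => ?_) fun j _ => ?_
    · split_ifs
      · exact mul_nonneg (mul_nonneg hJ.le hm.1.le) (by positivity)
      · simpa using θ.ν_nonneg _
    · rw [hI _ _, ite_self]
      split_ifs with hj
      · rw [mul_one_div, mul_div_cancel_left₀ _ hJ.ne']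
        exact hm.2 _
      · rw [one_mul]

/-- In a Markov chain, resampling a label affects the transitions into and out of it, and costs a
factor `δ` for each of them. -/
theorem exists_wrong_label_lower_of_mixing (θ : Param J L) (hm : θ.Mixing) {n : ℕ} (i : Fin n) :
    ∃ T : (Fin n → 𝕐) → ℝ, Integrable T (Measure.pi fun _ => θ.mix) ∧
      ∫ y, T y ∂(Measure.pi fun _ => θ.mix) = J * θ.δ ^ 2 * θ.Λ ∧
      ∀ y b, T y ≤ ∑ x, if x i ≠ b then θ.lik y x else 0 := by
  classical
  have hJ : (0 : ℝ) < J := by exact_mod_cast θ.J_pos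
  have hd0 : 0 ≤ J * θ.δ := mul_nonneg hJ.le hm.1.le
  -- the labels `i` and `i + 1` are drawn uniformly and independently of the past
  let S : Fin n → Prop := fun j => j = i ∨ j.val = i.val + 1
  let k : Fin n → Fin J → Fin J → ℝ := fun j a b => if S j then 1 / (J : ℝ) else θ.kern j a b
  let a₀ : Fin J := ⟨0, θ.J_pos⟩
  have hk0 : ∀ j a b, 0 ≤ k j a b := fun j a b => by
    simp only [k]; split_ifs; exacts [by positivity, θ.kern_nonneg _ _ _]
  have h := θ.exists_wrong_label_lower i (p := chainWeight k a₀) (c := (J * θ.δ) ^ 2)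
    (chainWeight_nonneg hk0 a₀) ?_ ?_ (sq_nonneg _) ?_
  · have h2 : (J * θ.δ) ^ 2 / J = J * θ.δ ^ 2 := by field_simp
    rwa [h2] at h
  · refine sum_chainWeight (fun j a => ?_) a₀
    simp only [k]
    split_ifs
    · simp [hJ.ne']
    · exact θ.kern_sum j a
  · intro x b
    unfold chainWeight
    refine Finset.prod_congr rfl fun j _ => ?_
    by_cases hS : S j
    · simp only [k, hS, if_true]
    · have hj : j ≠ i := fun h => hS (Or.inl h)
      have hj' : j.val ≠ i.val + 1 := fun h => hS (Or.inr h)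
      rw [Function.update_of_ne hj]
      congr 1
      rcases Nat.eq_zero_or_pos j.val with h0 | h0
      · have : j.castSucc = (0 : Fin (n + 1)) := Fin.ext h0
        rw [this, Fin.cons_zero, Fin.cons_zero]
      · have : j.castSucc = Fin.succ ⟨j.val - 1, lt_of_le_of_lt (Nat.sub_le _ _) j.isLt⟩ := by
          apply Fin.ext
          simp only [Fin.val_castSucc, Fin.val_succ]
          omega
        rw [this, Fin.cons_succ, Fin.cons_succ, Function.update_of_ne]
        intro h
        have := congrArg Fin.val h
        simp only at this
        omega
  · intro x
    rw [θ.pathProb_eq a₀]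
    have h1 : (J * θ.δ) ^ 2 ≤ ∏ j : Fin n, if S j then J * θ.δ else 1 := by
      have h2 : ∀ j : Fin n, (if S j then J * θ.δ else 1) =
          (if j = i then J * θ.δ else 1) * if j.val = i.val + 1 then J * θ.δ else 1 := fun j => by
        by_cases hj : j = i
        · simp [S, hj]
        · simp [S, hj]
      simp only [h2]
      rw [Finset.prod_mul_distrib, sq, Finset.prod_ite_eq' Finset.univ i, if_pos (Finset.mem_univ i)]
      refine mul_le_mul_of_nonneg_left ?_ hd0
      by_cases hi : i.val + 1 < n
      · have h3 : ∀ j : Fin n, (j.val = i.val + 1) ↔ (j = ⟨i.val + 1, hi⟩) := fun j => by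
          rw [Fin.ext_iff]
        simp only [h3]
        rw [Finset.prod_ite_eq' Finset.univ _, if_pos (Finset.mem_univ _)]
      · rw [Finset.prod_eq_one]
        · exact θ.J_mul_δ_le hm
        · intro j _
          rw [if_neg]
          have := j.isLt
          omega
    refine (mul_le_mul_of_nonneg_right h1 (chainWeight_nonneg hk0 a₀ x)).trans ?_
    unfold chainWeight
    rw [← Finset.prod_mul_distrib]
    refine Finset.prod_le_prod (fun j _ => ?_) fun j _ => ?_
    · refine mul_nonneg ?_ (hk0 _ _ _)
      split_ifs
      exacts [hd0, zero_le_one]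
    · simp only [k]
      split_ifs
      · rw [mul_one_div, mul_div_cancel_left₀ _ hJ.ne']
        exact θ.δ_le_kern hm _ _ _
      · rw [one_mul]

end Param

/-! ### Reduction of the risks to pointwise bounds -/

theorem loss_nonneg {n J : ℕ} (A : Part n) (x : Fin n → Fin J) : 0 ≤ loss A (labelPart x) := by
  obtain ⟨τ, -, h⟩ := exists_injective_mis_add_overlap_le A x
  have h2 : (overlap A (labelPart x) : ℝ) ≤ n := by
    exact_mod_cast (Nat.le_add_left _ _).trans h
  unfold loss
  have := div_le_one_of_le₀ h2 (Nat.cast_nonneg n)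
  linarith

theorem loss_le_one {n : ℕ} (A B : Part n) : loss A B ≤ 1 := by
  unfold loss
  have : (0 : ℝ) ≤ overlap A B / n := by positivity
  linarith

namespace Param

variable {J : ℕ} {𝕐 : Type*} [MeasurableSpace 𝕐] {L : Measure 𝕐}

theorem clustRisk_eq (θ : Param J L) {n : ℕ} (g : Clusterer 𝕐 n) :
    θ.clustRisk n g = ∫ y, ∑ x, θ.lik y x * loss (g.1 y) (labelPart x)
      ∂Measure.pi fun _ => θ.mix := by
  refine θ.integral_law (F := fun ω => loss (g.1 ω.2) (labelPart ω.1)) (C := 1) (fun x => ?_)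
    fun ω => ?_
  · exact (measurable_from_top (f := fun A => loss A (labelPart x))).comp g.2
  · rw [abs_of_nonneg (loss_nonneg _ _)]
    exact loss_le_one _ _

theorem clustRisk_nonneg (θ : Param J L) {n : ℕ} (g : Clusterer 𝕐 n) : 0 ≤ θ.clustRisk n g :=
  integral_nonneg fun _ => loss_nonneg _ _

instance {n : ℕ} : Nonempty (Clusterer 𝕐 n) := ⟨⟨fun _ => ⊥, measurable_const⟩⟩

theorem bayesClust_nonneg (θ : Param J L) (n : ℕ) : 0 ≤ θ.bayesClust n :=
  Real.iInf_nonneg fun g => θ.clustRisk_nonneg g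

theorem bayesClust_le (θ : Param J L) {n : ℕ} (g : Clusterer 𝕐 n) :
    θ.bayesClust n ≤ θ.clustRisk n g :=
  ciInf_le ⟨0, by rintro _ ⟨g, rfl⟩; exact θ.clustRisk_nonneg g⟩ g

/-- The risk of clustering is bounded below observation by observation: for each `y` the partition
`A` is arbitrary. -/
theorem le_bayesClust (θ : Param J L) {n : ℕ} {Φ : (Fin n → 𝕐) → ℝ}
    (hΦ : Integrable Φ (Measure.pi fun _ => θ.mix))
    (h : ∀ y (A : Part n), Φ y ≤ ∑ x, θ.lik y x * loss A (labelPart x)) :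
    ∫ y, Φ y ∂(Measure.pi fun _ => θ.mix) ≤ θ.bayesClust n := by
  refine le_ciInf fun g => ?_
  rw [clustRisk_eq]
  refine integral_mono hΦ (integrable_finsetSum _ fun x _ =>
    θ.integrable_lik_mul x (C := 1) ?_ fun y => ?_) fun y => h y _
  · exact (measurable_from_top (f := fun A => loss A (labelPart x))).comp g.2
  · rw [abs_of_nonneg (loss_nonneg _ _)]
    exact loss_le_one _ _

end Param

/-! ### The upper bound on the risk of clustering -/

/-- A measurable choice of an index at which a finite family of measurable functions is
maximal. -/
theorem exists_measurable_argmax {J : ℕ} (hJ : 0 < J) {𝕐 : Type*} [MeasurableSpace 𝕐]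
    {f : Fin J → 𝕐 → ℝ} (hf : ∀ x, Measurable (f x)) :
    ∃ t : 𝕐 → Fin J, Measurable t ∧ ∀ y x, f x y ≤ f (t y) y := by
  obtain ⟨m, rfl⟩ : ∃ m, J = m + 1 := ⟨J - 1, by omega⟩
  induction m with
  | zero =>
    refine ⟨fun _ => 0, measurable_const, fun y x => ?_⟩
    rw [Fin.fin_one_eq_zero x]
  | succ m ih =>
    obtain ⟨t, ht, hmax⟩ := ih (f := fun x => f x.succ) (Nat.succ_pos m) fun x => hf x.succ
    have hm : Measurable fun y => f (t y).succ y := by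
      have : Measurable (Function.uncurry fun (x : Fin (m + 1)) y => f x.succ y) :=
        measurable_from_prod_countable_right fun x => hf x.succ
      exact this.comp (ht.prodMk measurable_id)
    refine ⟨fun y => if f (t y).succ y ≤ f 0 y then 0 else (t y).succ,
      Measurable.ite (measurableSet_le hm (hf 0)) measurable_const
        ((measurable_of_countable Fin.succ).comp ht), fun y x => ?_⟩
    beta_reduce
    split_ifs with h
    · refine Fin.cases le_rfl (fun x => (hmax y x).trans h) x
    · exact Fin.cases (not_le.1 h).le (fun x => hmax y x) x

namespace Param

variable {J : ℕ} {𝕐 : Type*} [MeasurableSpace 𝕐] {L : Measure 𝕐}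

/-- Classification through the maximum likelihood label of each single observation. -/
theorem bayesClust_le_mul_Λ (θ : Param J L) (hm : θ.Mixing) {n : ℕ} (hn : 1 ≤ n) :
    θ.bayesClust n ≤ (1 - ((J : ℝ) - 1) * θ.δ) * θ.Λ := by
  have hn' : (0 : ℝ) < n := by exact_mod_cast hn
  obtain ⟨t, ht, hmax⟩ := exists_measurable_argmax θ.J_pos θ.measurable_g
  have hth : Measurable fun (y : Fin n → 𝕐) i => t (y i) :=
    measurable_pi_lambda _ fun i => ht.comp (measurable_pi_apply i)
  let c : Clusterer 𝕐 n := ⟨fun y => labelPart fun i => t (y i),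
    fun s _ => hth (Set.to_countable
      ((fun x : Fin n → Fin J => (labelPart x : Part n)) ⁻¹' s)).measurableSet⟩
  have hind : ∀ b, Measurable fun y : 𝕐 => if t y ≠ b then (1 : ℝ) else 0 := fun b =>
    (measurable_of_countable fun x : Fin J => if x ≠ b then (1 : ℝ) else 0).comp ht
  -- `e b` is the probability that the label `b` is not recovered from one observation
  let e : Fin J → ℝ := fun b => ∫ y, (if t y ≠ b then (1 : ℝ) else 0) ∂θ.emission b
  have he : ∑ b, e b = θ.Λ := by
    simp only [e, integral_emission]
    rw [← integral_finsetSum, Λ_eq]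
    · refine integral_congr_ae (Filter.Eventually.of_forall fun y => ?_)
      simp only [mul_ite, mul_one, mul_zero]
      rw [← Finset.sum_filter]
      have h1 : Finset.univ.filter (fun b => t y ≠ b) = Finset.univ.erase (t y) := by
        ext b; simp [eq_comm]
      rw [h1]
      refine le_antisymm ?_ (θ.minG_le (t y) y)
      have : Nonempty (Fin J) := ⟨t y⟩
      refine le_ciInf fun x₀ => ?_
      have e1 := Finset.add_sum_erase Finset.univ (fun x => θ.g x y) (Finset.mem_univ (t y))
      have e2 := Finset.add_sum_erase Finset.univ (fun x => θ.g x y) (Finset.mem_univ x₀)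
      have := hmax y x₀
      linarith
    · intro b _
      refine integrable_of_le ((θ.measurable_g b).mul (hind b)) (C := 1) fun y => ?_
      split_ifs
      · rw [mul_one, abs_of_nonneg (θ.g_nonneg b y)]; exact θ.g_le_one b y
      · simp
  refine (θ.bayesClust_le c).trans ?_
  have hmeas : ∀ x : Fin n → Fin J,
      Measurable fun y : Fin n → 𝕐 => loss (c.1 y) (labelPart x) := fun x =>
    (measurable_from_top (f := fun A => loss A (labelPart x))).comp c.2
  have hb : ∀ ω : (Fin n → Fin J) × (Fin n → 𝕐), |loss (c.1 ω.2) (labelPart ω.1)| ≤ 1 :=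
    fun ω => by
      rw [abs_of_nonneg (loss_nonneg _ _)]
      exact loss_le_one _ _
  unfold clustRisk
  rw [θ.integral_law_eq_sum (F := fun ω => loss (c.1 ω.2) (labelPart ω.1)) hmeas hb]
  have hx : ∀ x : Fin n → Fin J,
      ∫ y, loss (c.1 y) (labelPart x) ∂Measure.pi (fun i => θ.emission (x i)) ≤
        (1 / n) * ∑ i, e (x i) := by
    intro x
    have hi : ∀ i, Integrable (fun y : Fin n → 𝕐 => if t (y i) ≠ x i then (1 : ℝ) else 0)
        (Measure.pi fun i => θ.emission (x i)) := fun i =>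
      Integrable.of_bound ((hind (x i)).comp (measurable_pi_apply i)).aestronglyMeasurable 1
        (Filter.Eventually.of_forall fun y => by split_ifs <;> simp)
    have h2 : (1 / n : ℝ) * ∑ i, e (x i) = ∫ y, (1 / n : ℝ) * ∑ i, (if t (y i) ≠ x i then (1 : ℝ)
        else 0) ∂Measure.pi fun i => θ.emission (x i) := by
      rw [integral_const_mul, integral_finsetSum _ fun i _ => hi i]
      congr 1
      refine Finset.sum_congr rfl fun i _ => ?_
      exact (integral_comp_eval (μ := fun i => θ.emission (x i)) (i := i)
        (f := fun y => if t y ≠ x i then (1 : ℝ) else 0)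
        (hind (x i)).aestronglyMeasurable).symm
    rw [h2]
    refine integral_mono ?_ ((integrable_finsetSum _ fun i _ => hi i).const_mul _) fun y => ?_
    · exact Integrable.of_bound (hmeas x).aestronglyMeasurable 1
        (Filter.Eventually.of_forall fun y => hb (x, y))
    · have h3 := card_agree_le_overlap (fun i => t (y i)) x
      have h4 : (∑ i, (if t (y i) ≠ x i then (1 : ℝ) else 0)) +
          (Finset.univ.filter fun i => t (y i) = x i).card = n := by
        rw [Finset.sum_boole, ← Nat.cast_add, add_comm]
        have := Finset.card_filter_add_card_filter_not (s := (Finset.univ : Finset (Fin n)))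
          (fun i => t (y i) = x i)
        rw [Finset.card_univ, Fintype.card_fin] at this
        exact_mod_cast this
      have h5 : ((Finset.univ.filter fun i => t (y i) = x i).card : ℝ) ≤
        overlap (c.1 y) (labelPart x) := by exact_mod_cast h3
      change 1 - (overlap (c.1 y) (labelPart x) : ℝ) / n ≤ _
      rw [one_div_mul_eq_div, le_div_iff₀ hn', sub_mul, div_mul_cancel₀ _ hn'.ne']
      linarith
  calc ∑ x, θ.pathProb x *
        ∫ y, loss (c.1 y) (labelPart x) ∂Measure.pi (fun i => θ.emission (x i))
      ≤ ∑ x, θ.pathProb x * ((1 / n) * ∑ i, e (x i)) :=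
        Finset.sum_le_sum fun x _ => mul_le_mul_of_nonneg_left (hx x) (θ.pathProb_nonneg x)
    _ = (1 / n) * ∑ i, ∑ x : Fin n → Fin J, θ.pathProb x * e (x i) := by
        rw [Finset.sum_comm, Finset.mul_sum]
        refine Finset.sum_congr rfl fun x _ => ?_
        rw [← Finset.mul_sum]
        ring
    _ ≤ (1 / n) * ∑ _i : Fin n, (1 - ((J : ℝ) - 1) * θ.δ) * θ.Λ := by
        refine mul_le_mul_of_nonneg_left (Finset.sum_le_sum fun i _ => ?_) (by positivity)
        simp only [θ.pathProb_eq ⟨0, θ.J_pos⟩]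
        rw [← he]
        exact sum_chainWeight_mul_apply_le θ.kern_nonneg θ.kern_sum (θ.kern_le hm)
          (fun b => integral_nonneg_of_ae (Filter.Eventually.of_forall fun y => by
            change (0 : ℝ) ≤ if t y ≠ b then 1 else 0
            split_ifs <;> simp)) _ i
    _ = _ := by
        rw [Finset.sum_const, Finset.card_univ, Fintype.card_fin, nsmul_eq_mul]
        field_simp

/-! ### Lower bounds on the risk of clustering -/

theorem integral_lik (θ : Param J L) {n : ℕ} (x : Fin n → Fin J) :
    ∫ y, θ.lik y x ∂(Measure.pi fun _ => θ.mix) = θ.pathProb x := by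
  have h := θ.integral_pi_emission x fun _ => 1
  simp only [integral_const, probReal_univ, smul_eq_mul, mul_one] at h
  simp only [lik]
  rw [integral_const_mul, ← h, mul_one]

theorem integrable_lik (θ : Param J L) {n : ℕ} (x : Fin n → Fin J) :
    Integrable (fun y => θ.lik y x) (Measure.pi fun _ => θ.mix) := by
  simpa using θ.integrable_lik_mul x (F := fun _ => 1) measurable_const (C := 1) (by simp)

theorem sum_mul_g_pos (θ : Param J L) {v : Fin J → ℝ} (hv : ∀ b, 0 < v b) (y : 𝕐) :
    0 < ∑ b, v b * θ.g b y := by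
  have h0 : ∀ b, 0 ≤ v b * θ.g b y := fun b => mul_nonneg (hv b).le (θ.g_nonneg b y)
  refine lt_of_le_of_ne (Finset.sum_nonneg fun b _ => h0 b) fun h => ?_
  have h1 := (Finset.sum_eq_zero_iff_of_nonneg fun b _ => h0 b).1 h.symm
  have h2 := θ.sum_g y
  rw [Finset.sum_eq_zero] at h2
  · exact zero_ne_one h2
  · intro b hb
    exact (mul_eq_zero.1 (h1 b hb)).resolve_left (hv b).ne'

/-- Two labels: the risk of clustering is at least `1 - α` times a lower bound `τ` for the probability
of a wrong label. Given the observations, the labels form a Markov chain whose mixing is inherited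
from the prior chain. -/
theorem sub_le_bayesClust_of_two (θ : Param 2 L) {n : ℕ} (hn : 1 ≤ n) {ρ : ℝ} (hρ0 : 0 ≤ ρ)
    (hρ : ρ < 1) {v : Fin 2 → ℝ} (hv : ∀ b, 0 < v b)
    (hlo : ∀ (i : Fin n) a b, (1 - ρ) * v b ≤ θ.kern i a b)
    (hhi : ∀ (i : Fin n) a b, θ.kern i a b ≤ v b) {τ : ℝ}
    (hT : ∀ i : Fin n, ∃ T : (Fin n → 𝕐) → ℝ, Integrable T (Measure.pi fun _ => θ.mix) ∧
      ∫ y, T y ∂(Measure.pi fun _ => θ.mix) = τ ∧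
      ∀ y b, T y ≤ ∑ x, if x i ≠ b then θ.lik y x else 0)
    {α : ℝ} (hα0 : 0 ≤ α) (hα1 : α ≤ 1) (hα : (1 + ρ) / (1 - ρ) ≤ α ^ 2 * n) :
    (1 - α) * τ ≤ θ.bayesClust n := by
  have hn' : (0 : ℝ) < n := by exact_mod_cast hn
  choose T hTi hTτ hTle using hT
  have h1 : (1 - α) * τ = ∫ y, (1 / n : ℝ) * ((1 - α) * ∑ i, T i y)
      ∂(Measure.pi fun _ => θ.mix) := by
    rw [integral_const_mul, integral_const_mul, integral_finsetSum _ fun i _ => hTi i]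
    simp only [hTτ, Finset.sum_const, Finset.card_univ, Fintype.card_fin, nsmul_eq_mul]
    field_simp
  rw [h1]
  refine θ.le_bayesClust (((integrable_finsetSum _ fun i _ => hTi i).const_mul _).const_mul _)
    fun y A => ?_
  obtain ⟨s, hs⟩ := exists_labelling_sum_min_mis_le (θ.lik y) (θ.lik_nonneg y) A
  have hk := fun x => θ.lik_eq 0 y x
  have h2 := sum_chainWeight_mul_min_mis_ge hn hρ0 hρ
    (k := fun i a b => θ.kern i a b * θ.g b (y i)) (fun i b => v b * θ.g b (y i))
    (fun i b => mul_nonneg (hv b).le (θ.g_nonneg _ _)) (fun i => θ.sum_mul_g_pos hv (y i))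
    (fun i a b => by
      rw [← mul_assoc]; exact mul_le_mul_of_nonneg_right (hlo i a b) (θ.g_nonneg _ _))
    (fun i a b => mul_le_mul_of_nonneg_right (hhi i a b) (θ.g_nonneg _ _)) 0 s
    (t := fun i => T i y) (fun i b => by simpa only [hk] using hTle i y b) hα0 hα1 hα
  simp only [← hk] at h2
  rw [one_div_mul_eq_div, div_le_iff₀ hn']
  refine h2.trans (hs.trans (le_of_eq ?_))
  rw [Finset.sum_mul]
  refine Finset.sum_congr rfl fun x _ => ?_
  rw [mul_assoc, loss, sub_mul, div_mul_cancel₀ _ hn'.ne', one_mul]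

/-- Any number of labels: the risk of clustering is at least a fraction of a lower bound `τ` for the
probability of a wrong label, up to the probability that some pair of labels is rare. The factor
`1 / 2` is the price of reducing arbitrary partitions to labellings. -/
theorem half_le_bayesClust (θ : Param J L) {n : ℕ} (hn : 1 ≤ n) (hJ : 2 ≤ J) {ρ : ℝ}
    (hρ0 : 0 ≤ ρ) (hρ : ρ < 1) {v : Fin J → ℝ} (hv : ∀ b, 0 < v b)
    (hlo : ∀ (i : Fin n) a b, (1 - ρ) * v b ≤ θ.kern i a b)
    (hhi : ∀ (i : Fin n) a b, θ.kern i a b ≤ v b) {τ : ℝ}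
    (hT : ∀ i : Fin n, ∃ T : (Fin n → 𝕐) → ℝ, Integrable T (Measure.pi fun _ => θ.mix) ∧
      ∫ y, T y ∂(Measure.pi fun _ => θ.mix) = τ ∧
      ∀ y b, T y ≤ ∑ x, if x i ≠ b then θ.lik y x else 0)
    {β c κ B : ℝ} (hβ : 0 < β) (hc0 : 0 < c) (hc : c < 1 / 4) (hκ0 : 0 ≤ κ) (hκ1 : κ ≤ 1)
    (hlarge : 1 / (1 - ρ) * Real.sqrt (Real.log (Nat.factorial J) / (2 * n)) ≤ (1 - κ) * c * β)
    (hsmall : (1 + ρ) / (1 - ρ) ≤ 4 * (1 / 4 - c) ^ 2 * (1 - κ) * (n * β))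
    (hB : ∑ x : Fin n → Fin J, θ.pathProb x *
      (open Classical in if PairsFrequent (n * β / 2) x then (0 : ℝ) else 1) ≤ B) :
    1 / 2 * (κ * τ - B) ≤ θ.bayesClust n := by
  classical
  have hn' : (0 : ℝ) < n := by exact_mod_cast hn
  choose T hTi hTτ hTle using hT
  let r : (Fin n → Fin J) → ℝ := fun x => if PairsFrequent (n * β / 2) x then 0 else 1
  have hri : ∀ x, Integrable (fun y => θ.lik y x * r x) (Measure.pi fun _ => θ.mix) := fun x =>
    (θ.integrable_lik x).mul_const _
  have h1 : 1 / 2 * (κ * τ - ∑ x, θ.pathProb x * r x) =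
      ∫ y, (1 / (2 * n) : ℝ) * (κ * ∑ i, T i y - n * ∑ x, θ.lik y x * r x)
        ∂(Measure.pi fun _ => θ.mix) := by
    rw [integral_const_mul, integral_sub ((integrable_finsetSum _ fun i _ => hTi i).const_mul _)
      ((integrable_finsetSum _ fun x _ => hri x).const_mul _), integral_const_mul,
      integral_const_mul, integral_finsetSum _ fun i _ => hTi i,
      integral_finsetSum _ fun x _ => hri x]
    simp only [integral_mul_const, integral_lik, hTτ, Finset.sum_const, Finset.card_univ,
      Fintype.card_fin, nsmul_eq_mul]
    field_simp
  have h0 : 1 / 2 * (κ * τ - B) ≤ 1 / 2 * (κ * τ - ∑ x, θ.pathProb x * r x) := by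
    have : ∑ x, θ.pathProb x * r x ≤ B := hB
    linarith
  refine h0.trans ?_
  rw [h1]
  refine θ.le_bayesClust ((((integrable_finsetSum _ fun i _ => hTi i).const_mul _).sub
    ((integrable_finsetSum _ fun x _ => hri x).const_mul _)).const_mul _) fun y A => ?_
  obtain ⟨s, hs⟩ := exists_labelling_minMis_le θ.J_pos A
  let a₀ : Fin J := ⟨0, θ.J_pos⟩
  have hk := fun x => θ.lik_eq a₀ y x
  have h2 := sum_chainWeight_mul_minMis_ge hn hJ hρ0 hρ
    (k := fun i a b => θ.kern i a b * θ.g b (y i)) (fun i b => v b * θ.g b (y i))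
    (fun i b => mul_nonneg (hv b).le (θ.g_nonneg _ _)) (fun i => θ.sum_mul_g_pos hv (y i))
    (fun i a b => by
      rw [← mul_assoc]; exact mul_le_mul_of_nonneg_right (hlo i a b) (θ.g_nonneg _ _))
    (fun i a b => mul_le_mul_of_nonneg_right (hhi i a b) (θ.g_nonneg _ _)) a₀ s
    (t := fun i => T i y) (fun i b => by simpa only [hk] using hTle i y b) hβ hc0 hc hκ0 hκ1
    hlarge hsmall
  simp only [← hk] at h2
  rw [one_div_mul_eq_div, div_le_iff₀ (by positivity)]
  have h3 : ∑ x, θ.lik y x * (minMis s x : ℝ) ≤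
      (∑ x, θ.lik y x * loss A (labelPart x)) * (2 * n) := by
    rw [Finset.sum_mul]
    refine Finset.sum_le_sum fun x _ => ?_
    rw [mul_assoc]
    refine mul_le_mul_of_nonneg_left ?_ (θ.lik_nonneg y x)
    have h4 : (minMis s x : ℝ) + 2 * overlap A (labelPart x) ≤ 2 * n := by exact_mod_cast hs x
    have h5 : loss A (labelPart x) * (2 * n) = 2 * n - 2 * overlap A (labelPart x) := by
      rw [loss]; field_simp
    linarith
  have h6 : ∑ x, θ.lik y x * r x = ∑ x, θ.lik y x *
      (if PairsFrequent (n * β / 2) x then (0 : ℝ) else 1) := rfl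
  linarith

/-! ### Frequency of the pairs of labels -/

theorem β_le (θ : Param J L) {n : ℕ} (i : Fin n) {j k : Fin J} (hjk : j ≠ k) :
    θ.β n ≤ ∑ x : Fin n → Fin J, θ.pathProb x * (if x i = j ∨ x i = k then 1 else 0) := by
  have h : θ.β n ≤ (θ.law n).real {ω | ω.1 i = j ∨ ω.1 i = k} :=
    ciInf_le (f := fun t : {t : Fin n × Fin J × Fin J // t.2.1 ≠ t.2.2} =>
      (θ.law n).real {ω | ω.1 t.1.1 = t.1.2.1 ∨ ω.1 t.1.1 = t.1.2.2})
      (Set.finite_range _).bddBelow ⟨(i, j, k), hjk⟩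
  refine h.trans (le_of_eq ?_)
  have hS : MeasurableSet {ω : (Fin n → Fin J) × (Fin n → 𝕐) | ω.1 i = j ∨ ω.1 i = k} :=
    measurable_fst (Set.to_countable {x : Fin n → Fin J | x i = j ∨ x i = k}).measurableSet
  rw [← integral_indicator_one hS]
  have hF : ∀ ω : (Fin n → Fin J) × (Fin n → 𝕐),
      Set.indicator {ω : (Fin n → Fin J) × (Fin n → 𝕐) | ω.1 i = j ∨ ω.1 i = k} 1 ω =
        if ω.1 i = j ∨ ω.1 i = k then (1 : ℝ) else 0 := fun ω => by
    rw [Set.indicator_apply]; rfl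
  simp only [hF]
  rw [θ.integral_law_eq_sum (F := fun ω => if ω.1 i = j ∨ ω.1 i = k then (1 : ℝ) else 0)
    (fun x => (measurable_const :
      Measurable fun _ : Fin n → 𝕐 => if x i = j ∨ x i = k then (1 : ℝ) else 0)) (C := 1)
      fun ω => by split_ifs <;> simp]
  refine Finset.sum_congr rfl fun x _ => ?_
  refine congrArg (θ.pathProb x * ·)
    ((integral_const (if x i = j ∨ x i = k then (1 : ℝ) else 0)).trans ?_)
  rw [probReal_univ, one_smul]

theorem β_nonneg (θ : Param J L) (n : ℕ) : 0 ≤ θ.β n :=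
  Real.iInf_nonneg fun _ => measureReal_nonneg

theorem β_le_one (θ : Param J L) {n : ℕ} (hn : 1 ≤ n) (hJ : 2 ≤ J) : θ.β n ≤ 1 := by
  refine (θ.β_le ⟨0, hn⟩ (j := ⟨0, by omega⟩) (k := ⟨1, by omega⟩) (by simp)).trans ?_
  refine le_trans (Finset.sum_le_sum fun x _ => ?_) (θ.sum_pathProb n).le
  have := θ.pathProb_nonneg x
  split_ifs <;> simp [this]

theorem one_sub_pos (θ : Param J L) (hm : θ.Mixing) : 0 < 1 - ((J : ℝ) - 1) * θ.δ := by
  have := θ.J_mul_δ_le hm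
  have := hm.1
  linarith

theorem one_le_sub_mul (θ : Param J L) (hm : θ.Mixing) :
    1 ≤ (1 - ((J : ℝ) - 1) * θ.δ) * J := by
  have h1 := θ.J_mul_δ_le hm
  have h2 : (1 : ℝ) ≤ J := by exact_mod_cast θ.J_pos
  nlinarith

theorem one_sub_ρ₀ (θ : Param J L) (hm : θ.Mixing) :
    1 - θ.ρ₀ = θ.δ / (1 - ((J : ℝ) - 1) * θ.δ) := by
  have := (θ.one_sub_pos hm).ne'
  unfold ρ₀
  rw [eq_div_iff this, sub_mul, div_mul_cancel₀ _ this]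
  ring

theorem ρ₀_nonneg (θ : Param J L) (hm : θ.Mixing) : 0 ≤ θ.ρ₀ :=
  div_nonneg (by have := θ.J_mul_δ_le hm; linarith) (θ.one_sub_pos hm).le

theorem ρ₀_lt_one (θ : Param J L) (hm : θ.Mixing) : θ.ρ₀ < 1 := by
  have := div_pos hm.1 (θ.one_sub_pos hm)
  rw [← θ.one_sub_ρ₀ hm] at this
  linarith

theorem isDoeblin_kern (θ : Param J L) (hm : θ.Mixing) (n : ℕ) :
    IsDoeblin θ.ρ₀ (θ.kern (n := n)) := by
  have hJ : (0 : ℝ) < J := by exact_mod_cast θ.J_pos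
  refine ⟨θ.kern_sum, fun i => ⟨fun _ => 1 / J, fun _ => by positivity, by simp [hJ.ne'],
    fun a b => le_trans ?_ (θ.δ_le_kern hm i a b)⟩⟩
  rw [θ.one_sub_ρ₀ hm, mul_one_div, div_div, div_le_iff₀ (mul_pos (θ.one_sub_pos hm) hJ)]
  exact le_mul_of_one_le_right hm.1.le (θ.one_le_sub_mul hm)

theorem sum_not_pairsFrequent_le (θ : Param J L) (hm : θ.Mixing) {n : ℕ} (hn : 1 ≤ n)
    (hβ : 0 < θ.β n) :
    ∑ x : Fin n → Fin J, θ.pathProb x *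
      (open Classical in if PairsFrequent (n * θ.β n / 2) x then (0 : ℝ) else 1) ≤
      (J : ℝ) ^ 2 * Real.exp (-(n * (1 - θ.ρ₀) ^ 2 * θ.β n ^ 2) / 2) := by
  refine sum_mul_not_pairsFrequent_le θ.pathProb_nonneg (Real.exp_nonneg _) fun j k hjk => ?_
  have hk := fun x : Fin n → Fin J => θ.pathProb_eq ⟨0, θ.J_pos⟩ x
  have h := (θ.isDoeblin_kern hm n).lower_tail hn (θ.ρ₀_nonneg hm) (θ.ρ₀_lt_one hm)
    ⟨0, θ.J_pos⟩ (φ := fun b => if b = j ∨ b = k then 1 else 0)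
    (fun b => by split_ifs <;> simp) (fun b => by split_ifs <;> simp) hβ fun i => ?_
  · simpa only [hk] using h
  · simpa only [hk] using θ.β_le i hjk

theorem pathProb_eq_prod (θ : Param J L) (hI : θ.IsInd) {n : ℕ} (x : Fin n → Fin J) :
    θ.pathProb x = ∏ i, θ.ν (x i) := by
  unfold pathProb
  refine Finset.prod_congr rfl fun i _ => ?_
  rw [hI, ite_self]

theorem sum_not_pairsFrequent_le_of_isInd (θ : Param J L) (hI : θ.IsInd) {n : ℕ} (hn : 1 ≤ n) :
    ∑ x : Fin n → Fin J, θ.pathProb x *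
      (open Classical in if PairsFrequent (n * θ.β n / 2) x then (0 : ℝ) else 1) ≤
      (J : ℝ) ^ 2 * Real.exp (-(n * θ.β n) / 8) := by
  refine sum_mul_not_pairsFrequent_le θ.pathProb_nonneg (Real.exp_nonneg _) fun j k hjk => ?_
  simp only [θ.pathProb_eq_prod hI]
  refine sum_prod_mul_lower_tail θ.ν_nonneg θ.ν_sum
    (φ := fun b => if b = j ∨ b = k then (1 : ℝ) else 0)
    (fun b => by by_cases h : b = j ∨ b = k <;> simp [h]) (θ.β_nonneg n) ?_
  have h := θ.β_le (n := n) ⟨0, hn⟩ hjk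
  simp only [θ.pathProb_eq_prod hI] at h
  rwa [sum_prod_mul_apply θ.ν_sum (fun b => if b = j ∨ b = k then (1 : ℝ) else 0)] at h

/-! ### Two labels and independent observations: the risk of classification -/

/-- The probability that the Bayes classifier fails on one observation, for two labels with law
`ν`. -/
def err (θ : Param 2 L) : ℝ := ∫ y, min (θ.ν 0 * θ.g 0 y) (θ.ν 1 * θ.g 1 y) ∂θ.mix

theorem integrable_ν_mul_g (θ : Param J L) (b : Fin J) :
    Integrable (fun y => θ.ν b * θ.g b y) θ.mix := (θ.integrable_g b).const_mul _

theorem integral_ν_mul_g (θ : Param J L) (b : Fin J) : ∫ y, θ.ν b * θ.g b y ∂θ.mix = θ.ν b := by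
  rw [integral_const_mul, integral_g, mul_one]

theorem ν_mul_g_nonneg (θ : Param J L) (b : Fin J) (y : 𝕐) : 0 ≤ θ.ν b * θ.g b y :=
  mul_nonneg (θ.ν_nonneg b) (θ.g_nonneg b y)

theorem integrable_min (θ : Param 2 L) :
    Integrable (fun y => min (θ.ν 0 * θ.g 0 y) (θ.ν 1 * θ.g 1 y)) θ.mix :=
  (θ.integrable_ν_mul_g 0).inf (θ.integrable_ν_mul_g 1)

theorem integrable_max (θ : Param 2 L) :
    Integrable (fun y => max (θ.ν 0 * θ.g 0 y) (θ.ν 1 * θ.g 1 y)) θ.mix :=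
  (θ.integrable_ν_mul_g 0).sup (θ.integrable_ν_mul_g 1)

theorem integral_max (θ : Param 2 L) :
    ∫ y, max (θ.ν 0 * θ.g 0 y) (θ.ν 1 * θ.g 1 y) ∂θ.mix = 1 - θ.err := by
  have h : ∀ y, max (θ.ν 0 * θ.g 0 y) (θ.ν 1 * θ.g 1 y) = θ.ν 0 * θ.g 0 y + θ.ν 1 * θ.g 1 y -
      min (θ.ν 0 * θ.g 0 y) (θ.ν 1 * θ.g 1 y) := fun y => by
    have := min_add_max (θ.ν 0 * θ.g 0 y) (θ.ν 1 * θ.g 1 y)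
    linarith
  have hν := θ.ν_sum
  rw [Fin.sum_univ_two] at hν
  simp only [h]
  rw [integral_sub (f := fun y => θ.ν 0 * θ.g 0 y + θ.ν 1 * θ.g 1 y)
    ((θ.integrable_ν_mul_g 0).add (θ.integrable_ν_mul_g 1)) θ.integrable_min,
    integral_add (θ.integrable_ν_mul_g 0) (θ.integrable_ν_mul_g 1)]
  simp only [integral_ν_mul_g]
  rw [hν, err]

theorem err_nonneg (θ : Param 2 L) : 0 ≤ θ.err :=
  integral_nonneg fun y => le_min (θ.ν_mul_g_nonneg 0 y) (θ.ν_mul_g_nonneg 1 y)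

theorem err_le_half (θ : Param 2 L) : θ.err ≤ 1 / 2 := by
  have h : θ.err ≤ 1 - θ.err := by
    rw [← integral_max]
    exact integral_mono θ.integrable_min θ.integrable_max fun y => min_le_max
  linarith

theorem δ_mul_Λ_le_err (θ : Param 2 L) (hm : θ.Mixing) : θ.δ * θ.Λ ≤ θ.err := by
  rw [Λ_eq, ← integral_const_mul]
  refine integral_mono (θ.integrable_minG.const_mul _) θ.integrable_min fun y => ?_
  have h0 := θ.minG_le 0 y
  have h1 := θ.minG_le 1 y
  have e0 : (Finset.univ : Finset (Fin 2)).erase 0 = {1} := by decide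
  have e1 : (Finset.univ : Finset (Fin 2)).erase 1 = {0} := by decide
  rw [e0, Finset.sum_singleton] at h0
  rw [e1, Finset.sum_singleton] at h1
  exact le_min (mul_le_mul (hm.2 0) h1 (θ.minG_nonneg y) (θ.ν_nonneg 0))
    (mul_le_mul (hm.2 1) h0 (θ.minG_nonneg y) (θ.ν_nonneg 1))

/-- The joint density of the observations and of the event that the Bayes label of the observation
`i` is wrong. -/
def errDensity (θ : Param 2 L) {n : ℕ} (i : Fin n) (y : Fin n → 𝕐) : ℝ :=
  ∏ j, if j = i then min (θ.ν 0 * θ.g 0 (y j)) (θ.ν 1 * θ.g 1 (y j))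
    else θ.ν 0 * θ.g 0 (y j) + θ.ν 1 * θ.g 1 (y j)

theorem integrable_errDensity (θ : Param 2 L) {n : ℕ} (i : Fin n) :
    Integrable (θ.errDensity i) (Measure.pi fun _ => θ.mix) := by
  refine Integrable.fintype_prod (f := fun j y => if j = i then
    min (θ.ν 0 * θ.g 0 y) (θ.ν 1 * θ.g 1 y) else θ.ν 0 * θ.g 0 y + θ.ν 1 * θ.g 1 y) fun j => ?_
  by_cases h : j = i
  · simp only [if_pos h]; exact θ.integrable_min
  · simp only [if_neg h]; exact (θ.integrable_ν_mul_g 0).add (θ.integrable_ν_mul_g 1)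

theorem integral_errDensity (θ : Param 2 L) {n : ℕ} (i : Fin n) :
    ∫ y, θ.errDensity i y ∂(Measure.pi fun _ => θ.mix) = θ.err := by
  unfold errDensity
  rw [integral_fintype_prod_eq_prod (fun j y => if j = i then
    min (θ.ν 0 * θ.g 0 y) (θ.ν 1 * θ.g 1 y) else θ.ν 0 * θ.g 0 y + θ.ν 1 * θ.g 1 y),
    Finset.prod_eq_single i]
  · simp only [if_true, err]
  · intro j _ hj
    simp only [if_neg hj]
    rw [integral_add (θ.integrable_ν_mul_g 0) (θ.integrable_ν_mul_g 1)]
    simp only [integral_ν_mul_g]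
    have hν := θ.ν_sum
    rwa [Fin.sum_univ_two] at hν
  · simp

theorem lik_eq_prod (θ : Param J L) (hI : θ.IsInd) {n : ℕ} (y : Fin n → 𝕐) (x : Fin n → Fin J) :
    θ.lik y x = ∏ i, θ.ν (x i) * θ.g (x i) (y i) := by
  rw [lik, θ.pathProb_eq_prod hI, Finset.prod_mul_distrib]

theorem sum_lik_wrong (θ : Param 2 L) (hI : θ.IsInd) {n : ℕ} (y : Fin n → 𝕐) (i : Fin n)
    (b : Fin 2) : ∑ x, θ.lik y x * (if b ≠ x i then (1 : ℝ) else 0) =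
      ∏ j, if j = i then θ.ν (b + 1) * θ.g (b + 1) (y j)
        else θ.ν 0 * θ.g 0 (y j) + θ.ν 1 * θ.g 1 (y j) := by
  have h : ∀ x : Fin n → Fin 2, θ.lik y x * (if b ≠ x i then (1 : ℝ) else 0) =
      ∏ j, θ.ν (x j) * θ.g (x j) (y j) * (if j = i then (if b ≠ x j then (1 : ℝ) else 0) else 1) :=
    fun x => by
      rw [θ.lik_eq_prod hI, Finset.prod_mul_distrib (g := fun j => if j = i then _ else _),
        Finset.prod_ite_eq' Finset.univ i, if_pos (Finset.mem_univ i)]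
  simp only [h]
  rw [sum_prod_apply fun j c => θ.ν c * θ.g c (y j) *
    (if j = i then (if b ≠ c then (1 : ℝ) else 0) else 1)]
  refine Finset.prod_congr rfl fun j _ => ?_
  rw [Fin.sum_univ_two]
  by_cases hj : j = i
  · simp only [if_pos hj]
    fin_cases b <;> simp
  · simp only [if_neg hj, mul_one]

theorem classRisk_eq (θ : Param J L) {n : ℕ} (h : Classifier J 𝕐 n) :
    θ.classRisk n h = ∫ y, (1 / n : ℝ) * ∑ i, ∑ x, θ.lik y x * (if h.1 y i ≠ x i then 1 else 0)
      ∂(Measure.pi fun _ => θ.mix) := by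
  have hm : ∀ (i : Fin n) (b : Fin J),
      Measurable fun y : Fin n → 𝕐 => if h.1 y i ≠ b then (1 : ℝ) else 0 := fun i b =>
    (measurable_of_countable fun c : Fin J => if c ≠ b then (1 : ℝ) else 0).comp
      ((measurable_pi_apply i).comp h.2)
  have h1 := θ.integral_law (n := n)
    (F := fun ω => (1 / (n : ℝ)) * ∑ i : Fin n, (if h.1 ω.2 i ≠ ω.1 i then (1 : ℝ) else 0))
    (fun x => (Finset.measurable_sum _ fun i _ => hm i (x i)).const_mul _)
    (C := (1 / (n : ℝ)) * n) fun ω => ?_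
  · rw [classRisk, h1]
    congr 1
    funext y
    rw [Finset.sum_comm, Finset.mul_sum]
    refine Finset.sum_congr rfl fun x _ => ?_
    rw [← Finset.mul_sum]
    ring
  · have h0 : 0 ≤ ∑ i : Fin n, (if h.1 ω.2 i ≠ ω.1 i then (1 : ℝ) else 0) :=
      Finset.sum_nonneg fun i _ => by split_ifs <;> simp
    rw [abs_of_nonneg (mul_nonneg (by positivity) h0)]
    refine mul_le_mul_of_nonneg_left ?_ (by positivity)
    calc _ ≤ ∑ _i : Fin n, (1 : ℝ) :=
          Finset.sum_le_sum fun i _ => by split_ifs <;> simp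
      _ = n := by simp

/-- For independent observations the best classifier labels each observation separately. -/
theorem bayesClass_eq_err (θ : Param 2 L) (hI : θ.IsInd) {n : ℕ} (hn : 1 ≤ n) :
    θ.bayesClass n = θ.err := by
  have hn' : (0 : ℝ) < n := by exact_mod_cast hn
  have hE : ∫ y, (1 / n : ℝ) * ∑ i : Fin n, θ.errDensity i y ∂(Measure.pi fun _ => θ.mix) =
      θ.err := by
    rw [integral_const_mul, integral_finsetSum _ fun i _ => θ.integrable_errDensity i]
    simp only [integral_errDensity, Finset.sum_const, Finset.card_univ, Fintype.card_fin,
      nsmul_eq_mul]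
    field_simp
  have hnn : ∀ b y, 0 ≤ θ.ν b * θ.g b y := θ.ν_mul_g_nonneg
  have hlow : ∀ h : Classifier 2 𝕐 n, θ.err ≤ θ.classRisk n h := by
    intro h
    rw [classRisk_eq, ← hE]
    have hm : ∀ (i : Fin n) (b : Fin 2),
        Measurable fun y : Fin n → 𝕐 => if h.1 y i ≠ b then (1 : ℝ) else 0 := fun i b =>
      (measurable_of_countable fun c : Fin 2 => if c ≠ b then (1 : ℝ) else 0).comp
        ((measurable_pi_apply i).comp h.2)
    refine integral_mono ((integrable_finsetSum _ fun i _ =>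
      θ.integrable_errDensity i).const_mul _) ((integrable_finsetSum _ fun i _ =>
        integrable_finsetSum _ fun x _ => θ.integrable_lik_mul x (hm i (x i)) (C := 1)
          fun y => by split_ifs <;> simp).const_mul _) fun y => ?_
    refine mul_le_mul_of_nonneg_left (Finset.sum_le_sum fun i _ => ?_) (by positivity)
    rw [θ.sum_lik_wrong hI]
    refine Finset.prod_le_prod (fun j _ => ?_) fun j _ => ?_
    · split_ifs
      · exact le_min (hnn _ _) (hnn _ _)
      · exact add_nonneg (hnn _ _) (hnn _ _)
    · split_ifs
      · generalize h.1 y i + 1 = c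
        fin_cases c
        · exact min_le_left _ _
        · exact min_le_right _ _
      · exact le_rfl
  obtain ⟨t, ht, hmax⟩ := exists_measurable_argmax (J := 2) two_pos
    (f := fun b y => θ.ν b * θ.g b y) fun b => (θ.measurable_g b).const_mul _
  let h : Classifier 2 𝕐 n := ⟨fun y i => t (y i),
    measurable_pi_lambda _ fun i => ht.comp (measurable_pi_apply i)⟩
  have : Nonempty (Classifier 2 𝕐 n) := ⟨h⟩
  refine le_antisymm ?_ (le_ciInf hlow)
  refine (ciInf_le ⟨θ.err, by rintro _ ⟨h, rfl⟩; exact hlow h⟩ h).trans (le_of_eq ?_)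
  rw [classRisk_eq, ← hE]
  congr 1
  funext y
  congr 1
  refine Finset.sum_congr rfl fun i _ => ?_
  rw [θ.sum_lik_wrong hI]
  refine Finset.prod_congr rfl fun j _ => ?_
  by_cases hj : j = i
  · rw [if_pos hj, if_pos hj, hj]
    change θ.ν (t (y i) + 1) * θ.g (t (y i) + 1) (y i) = _
    have h0 := hmax (y i) 0
    have h1 := hmax (y i) 1
    revert h0 h1
    generalize t (y i) = c
    intro h0 h1
    fin_cases c
    · exact (min_eq_right h1).symm
    · exact (min_eq_left h0).symm
  · rw [if_neg hj, if_neg hj]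

/-- The risk of clustering falls short of the risk of classification by at most the probability,
estimated by a Laplace transform of parameter `l`, that the Bayes labels make more than `n / 2`
errors. -/
theorem err_sub_le_bayesClust (θ : Param 2 L) (hI : θ.IsInd) {n : ℕ} (hn : 1 ≤ n) {l : ℝ}
    (hl : 0 < l) :
    θ.err - 2 / (Real.exp 1 * l * n) *
      ((1 - θ.err) * Real.exp (-(l / 2)) + θ.err * Real.exp (l / 2)) ^ n ≤ θ.bayesClust n := by
  have hn' : (0 : ℝ) < n := by exact_mod_cast hn
  let m : 𝕐 → ℝ := fun y => min (θ.ν 0 * θ.g 0 y) (θ.ν 1 * θ.g 1 y)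
  let M : 𝕐 → ℝ := fun y => max (θ.ν 0 * θ.g 0 y) (θ.ν 1 * θ.g 1 y)
  let q : 𝕐 → ℝ := fun y => M y * Real.exp (-(l / 2)) + m y * Real.exp (l / 2)
  have hq : Integrable q θ.mix :=
    (θ.integrable_max.mul_const _).add (θ.integrable_min.mul_const _)
  have hqi : ∫ y, q y ∂θ.mix =
      (1 - θ.err) * Real.exp (-(l / 2)) + θ.err * Real.exp (l / 2) := by
    rw [← integral_max, err, ← integral_mul_const, ← integral_mul_const]
    exact integral_add (θ.integrable_max.mul_const _) (θ.integrable_min.mul_const _)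
  have hprod : Integrable (fun y : Fin n → 𝕐 => ∏ i, q (y i)) (Measure.pi fun _ => θ.mix) :=
    Integrable.fintype_prod fun _ => hq
  have hsum : Integrable (fun y : Fin n → 𝕐 => ∑ i, θ.errDensity i y)
      (Measure.pi fun _ => θ.mix) := integrable_finsetSum _ fun i _ => θ.integrable_errDensity i
  have h1 : θ.err - 2 / (Real.exp 1 * l * n) *
      ((1 - θ.err) * Real.exp (-(l / 2)) + θ.err * Real.exp (l / 2)) ^ n =
      ∫ y : Fin n → 𝕐, (1 / n : ℝ) * (∑ i, θ.errDensity i y -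
        2 / (Real.exp 1 * l) * ∏ i, q (y i)) ∂(Measure.pi fun _ => θ.mix) := by
    rw [integral_const_mul, integral_sub hsum (hprod.const_mul _),
      integral_finsetSum _ fun i _ => θ.integrable_errDensity i, integral_const_mul,
      integral_fintype_prod_eq_prod (fun _ => q)]
    simp only [integral_errDensity, hqi, Finset.sum_const, Finset.prod_const, Finset.card_univ,
      Fintype.card_fin, nsmul_eq_mul]
    have := Real.exp_pos 1
    field_simp
  rw [h1]
  refine θ.le_bayesClust ((hsum.sub (hprod.const_mul _)).const_mul _) fun y A => ?_
  obtain ⟨s, hs⟩ := exists_labelling_sum_min_mis_le (θ.lik y) (θ.lik_nonneg y) A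
  have h2 := sum_prod_mul_min_mis_ge (w := fun i b => θ.ν b * θ.g b (y i))
    (fun i b => θ.ν_mul_g_nonneg b (y i)) s hl
  simp only [← θ.lik_eq_prod hI y] at h2
  rw [one_div_mul_eq_div, div_le_iff₀ hn']
  refine h2.trans (hs.trans (le_of_eq ?_))
  rw [Finset.sum_mul]
  refine Finset.sum_congr rfl fun x _ => ?_
  rw [mul_assoc, loss, sub_mul, div_mul_cancel₀ _ hn'.ne', one_mul]

/-! ### Explicit constants: two labels -/

/-- The bound behind the second term of `α_n`. -/
theorem err_sub_sqrt_le_bayesClust (θ : Param 2 L) (hI : θ.IsInd) {n : ℕ} (hn : 1 ≤ n) :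
    θ.err - Real.sqrt (Real.pi / (2 * n)) ≤ θ.bayesClust n := by
  have hn' : (0 : ℝ) < n := by exact_mod_cast hn
  set r := Real.sqrt n with hr
  have hr0 : 0 < r := Real.sqrt_pos.2 hn'
  have hrr : r * r = n := Real.mul_self_sqrt hn'.le
  -- this `l` minimizes `exp (n * l ^ 2 / 8) / l`
  have h := θ.err_sub_le_bayesClust hI hn (l := 2 / r) (by positivity)
  refine le_trans (sub_le_sub_left ?_ _) h
  have hl : 2 / r / 2 = 1 / r := by ring
  rw [hl]
  set Z := (1 - θ.err) * Real.exp (-(1 / r)) + θ.err * Real.exp (1 / r) with hZ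
  have hZ0 : 0 ≤ Z := add_nonneg
    (mul_nonneg (by linarith [θ.err_le_half]) (Real.exp_nonneg _))
    (mul_nonneg θ.err_nonneg (Real.exp_nonneg _))
  have hZ1 : Z ≤ Real.exp ((1 / r) ^ 2 / 2) := by
    refine le_trans ?_ (Real.cosh_le_exp_half_sq (1 / r))
    rw [Real.cosh_eq, hZ]
    have h1 : Real.exp (-(1 / r)) ≤ Real.exp (1 / r) := by
      have : 0 < 1 / r := by positivity
      exact Real.exp_le_exp.2 (by linarith)
    nlinarith [θ.err_le_half]
  have hZn : Z ^ n ≤ Real.exp (1 / 2) := by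
    refine (pow_le_pow_left₀ hZ0 hZ1 n).trans (le_of_eq ?_)
    rw [← Real.exp_nat_mul]
    congr 1
    rw [← hrr]
    field_simp
  have hZn1 : Z ^ n ≤ Real.exp 1 := hZn.trans (Real.exp_le_exp.2 (by norm_num))
  calc 2 / (Real.exp 1 * (2 / r) * n) * Z ^ n
      ≤ 2 / (Real.exp 1 * (2 / r) * n) * Real.exp 1 :=
        mul_le_mul_of_nonneg_left hZn1 (by positivity)
    _ = 1 / r := by
        have := Real.exp_pos 1
        rw [← hrr]
        field_simp
    _ ≤ _ := by
        refine Real.le_sqrt_of_sq_le ?_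
        rw [div_pow, one_pow, sq, hrr, div_le_div_iff₀ hn' (by positivity)]
        nlinarith [Real.two_le_pi]

/-- The bound behind the first term of `α_n`, written with the risk of classification
`1 / 2 - ε = err`. -/
theorem err_sub_log_le_bayesClust (θ : Param 2 L) (hI : θ.IsInd) {n : ℕ} (hn : 1 ≤ n)
    (h0 : 0 < θ.err) (h1 : θ.err < 1 / 2) :
    θ.err - θ.err * (2 * (2 * (3 / 2 - θ.err) * ((4 * θ.err * (1 - θ.err)) ^ (((n : ℝ) - 2) / 2) /
      (n * Real.log ((1 - θ.err) / θ.err))))) ≤ θ.bayesClust n := by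
  have hn' : (0 : ℝ) < n := by exact_mod_cast hn
  set q := θ.err with hq
  have hR1 : 1 < (1 - q) / q := by rw [lt_div_iff₀ h0]; linarith
  -- this `l` minimizes the Laplace transform
  set l := Real.log ((1 - q) / q) with hl
  have hl0 : 0 < l := Real.log_pos hR1
  have h := θ.err_sub_le_bayesClust hI hn hl0
  refine le_trans (sub_le_sub_left ?_ _) h
  rw [← hq]
  set E := Real.exp (l / 2) with hE
  have hE0 : 0 < E := Real.exp_pos _
  have hEE : E * E = (1 - q) / q := by
    rw [hE, ← Real.exp_add, add_halves, hl, Real.exp_log (by linarith)]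
  have hq1 : 1 - q = q * (E * E) := by rw [hEE, mul_div_cancel₀ _ h0.ne']
  have hq0 : 0 < 1 - q := by linarith
  have hv : 0 < 4 * q * (1 - q) := by positivity
  have hZ : (1 - q) * Real.exp (-(l / 2)) + q * E = Real.sqrt (4 * q * (1 - q)) := by
    rw [Real.exp_neg, ← hE]
    symm
    rw [Real.sqrt_eq_iff_mul_self_eq hv.le (by positivity), hq1]
    field_simp
    ring
  have hZn : ((1 - q) * Real.exp (-(l / 2)) + q * E) ^ n =
      (4 * q * (1 - q)) ^ (((n : ℝ) - 2) / 2) * (4 * q * (1 - q)) := by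
    rw [hZ, Real.sqrt_eq_rpow, ← Real.rpow_natCast, ← Real.rpow_mul hv.le]
    nth_rewrite 3 [← Real.rpow_one (4 * q * (1 - q))]
    rw [← Real.rpow_add hv]
    congr 1
    ring
  rw [hZn]
  set W := (4 * q * (1 - q)) ^ (((n : ℝ) - 2) / 2) with hW
  have hW0 : 0 ≤ W := Real.rpow_nonneg hv.le _
  have he : 2 ≤ Real.exp 1 := by linarith [Real.exp_one_gt_d9]
  have e1 : 2 / (Real.exp 1 * l * n) * (W * (4 * q * (1 - q))) =
      (W * 4 * q / (l * n)) * (2 / Real.exp 1 * (1 - q)) := by field_simp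
  have e2 : q * (2 * (2 * (3 / 2 - q) * (W / (n * l)))) =
      (W * 4 * q / (l * n)) * (3 / 2 - q) := by field_simp; ring
  rw [e1, e2]
  refine mul_le_mul_of_nonneg_left ?_ (by positivity)
  have e3 : 2 / Real.exp 1 ≤ 1 := by rw [div_le_one (Real.exp_pos 1)]; exact he
  nlinarith

theorem bayesClust_ge_of_two_isInd (θ : Param 2 L) (hm : θ.Mixing) (hI : θ.IsInd) {n : ℕ}
    (hn : 1 ≤ n) : (1 - θ.α n) * θ.δ * θ.Λ ≤ θ.bayesClust n := by
  have hle := θ.δ_mul_Λ_le_err hm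
  have hδΛ : 0 ≤ θ.δ * θ.Λ := mul_nonneg hm.1.le θ.Λ_nonneg
  have hε : θ.ε n = 1 / 2 - θ.err := by rw [ε, θ.bayesClass_eq_err hI hn]
  rw [mul_assoc]
  -- if classification is perfect then `Λ = 0`, and the value of `α` does not matter
  rcases θ.err_nonneg.eq_or_lt with h0 | h0
  · have : θ.δ * θ.Λ = 0 := le_antisymm (by linarith) hδΛ
    rw [this, mul_zero]
    exact θ.bayesClust_nonneg n
  have key : (1 - θ.α n) * θ.err ≤ θ.bayesClust n := by
    have hs := θ.err_sub_sqrt_le_bayesClust hI hn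
    set S := Real.sqrt (Real.pi / (2 * n)) with hS
    have e1 : 1 - 2 * θ.ε n = 2 * θ.err := by rw [hε]; ring
    have hs' : (1 - 2 * (1 / (1 - 2 * θ.ε n) * S)) * θ.err ≤ θ.bayesClust n := by
      have : (1 - 2 * (1 / (1 - 2 * θ.ε n) * S)) * θ.err = θ.err - S := by
        rw [e1]; field_simp
      rwa [this]
    unfold α
    split_ifs with hε0
    · exact hs'
    · rcases min_cases (2 * (1 + θ.ε n) * ((1 - 4 * θ.ε n ^ 2) ^ (((n : ℝ) - 2) / 2) /
        (n * Real.log ((1 + 2 * θ.ε n) / (1 - 2 * θ.ε n)))))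
        (1 / (1 - 2 * θ.ε n) * S) with ⟨h, -⟩ | ⟨h, -⟩
      · rw [h]
        have h1 : θ.err < 1 / 2 := lt_of_le_of_ne θ.err_le_half fun h => hε0 (by rw [hε, h]; ring)
        have := θ.err_sub_log_le_bayesClust hI hn h0 h1
        have e2 : 1 - 4 * θ.ε n ^ 2 = 4 * θ.err * (1 - θ.err) := by rw [hε]; ring
        have e3 : (1 + 2 * θ.ε n) / (1 - 2 * θ.ε n) = (1 - θ.err) / θ.err := by
          rw [e1, hε, ← mul_div_mul_left (1 - θ.err) θ.err two_ne_zero]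
          congr 1
          ring
        have e4 : 1 + θ.ε n = 3 / 2 - θ.err := by rw [hε]; ring
        rw [e2, e3, e4]
        linarith
      · rw [h]
        exact hs'
  rcases le_or_gt (θ.α n) 1 with h1 | h1
  · exact (mul_le_mul_of_nonneg_left hle (by linarith)).trans key
  · exact (mul_nonpos_of_nonpos_of_nonneg (by linarith) hδΛ).trans (θ.bayesClust_nonneg n)

/-- When `α̃_n ≤ 1`, its power is of a number less than one with exponent at most one, hence at least
that number, which is of order `n ^ (-1 / 2)`. -/
theorem two_mul_le_αTilde_sq (θ : Param 2 L) (hm : θ.Mixing) {n : ℕ} (hn : 1 ≤ n)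
    (h1 : θ.αTilde n ≤ 1) : 2 * ((1 - θ.δ) / θ.δ) ≤ θ.αTilde n ^ 2 * n := by
  have hn' : (1 : ℝ) ≤ n := by exact_mod_cast hn
  have hδ := hm.1
  have h2δ := θ.J_mul_δ_le hm
  rw [Nat.cast_ofNat] at h2δ
  set r := (1 - θ.δ) / θ.δ with hr
  have hr1 : 1 ≤ r := by rw [hr, le_div_iff₀ hδ]; linarith
  set S := Real.sqrt (Real.log 2 / (2 * n)) with hS
  have hlog := Real.log_two_gt_d9
  have hlog' := Real.log_two_lt_d9
  have hS0 : 0 < S := Real.sqrt_pos.2 (by positivity)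
  have hSS : S ^ 2 * n = Real.log 2 / 2 := by
    rw [hS, Real.sq_sqrt (by positivity)]
    field_simp
  have he := Real.exp_one_gt_d9
  have hb0 : 0 < r * S := by positivity
  have hα : θ.αTilde n = 2 * Real.exp 1 * r ^ 4 * (r * S) ^ (1 - 2 / (n : ℝ)) := rfl
  have hr4 : 1 ≤ r ^ 4 := one_le_pow₀ hr1
  have hc : 1 < 2 * Real.exp 1 * r ^ 4 := by nlinarith
  have hpow : r * S ≤ (r * S) ^ (1 - 2 / (n : ℝ)) := by
    -- otherwise the power is at least one, and so is `αTilde`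
    by_contra hcon
    have hone : 1 ≤ (r * S) ^ (1 - 2 / (n : ℝ)) := by
      rcases le_or_gt 1 (r * S) with hb | hb
      · rcases hn.eq_or_lt with h | h
        · exfalso
          have hn1 : (n : ℝ) = 1 := by exact_mod_cast h.symm
          rw [hα, hn1] at h1
          norm_num at h1
          rw [Real.rpow_neg_one] at h1
          have hS1 : S ≤ 1 := by
            rw [hn1] at hSS
            nlinarith
          have h3 : r * S ≤ r ^ 4 := by
            calc r * S ≤ r * 1 := mul_le_mul_of_nonneg_left hS1 (by linarith)
              _ = r ^ 1 := by ring
              _ ≤ r ^ 4 := pow_le_pow_right₀ hr1 (by norm_num)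
          rw [← div_eq_mul_inv, div_le_one hb0] at h1
          nlinarith
        · refine Real.one_le_rpow hb ?_
          have : (2 : ℝ) ≤ n := by exact_mod_cast h
          rw [sub_nonneg, div_le_one (by linarith)]
          exact this
      · exfalso
        apply hcon
        conv_lhs => rw [← Real.rpow_one (r * S)]
        refine Real.rpow_le_rpow_of_exponent_ge hb0 hb.le ?_
        have : (0 : ℝ) ≤ 2 / n := by positivity
        linarith
    rw [hα] at h1
    nlinarith
  have hge : 2 * Real.exp 1 * r ^ 4 * (r * S) ≤ θ.αTilde n := by
    rw [hα]
    exact mul_le_mul_of_nonneg_left hpow (by positivity)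
  calc 2 * r ≤ 8 * r ^ 10 * (Real.log 2 / 2) := by
        have : r ≤ r ^ 10 := le_self_pow₀ hr1 (by norm_num)
        nlinarith
    _ ≤ (2 * Real.exp 1) ^ 2 * r ^ 10 * (Real.log 2 / 2) := by
        refine mul_le_mul_of_nonneg_right (mul_le_mul_of_nonneg_right ?_ (by positivity))
          (by positivity)
        nlinarith
    _ = (2 * Real.exp 1 * r ^ 4 * (r * S)) ^ 2 * n := by rw [← hSS]; ring
    _ ≤ θ.αTilde n ^ 2 * n :=
        mul_le_mul_of_nonneg_right (pow_le_pow_left₀ (by positivity) hge 2) (by positivity)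

theorem sub_mul_le_kern (θ : Param J L) (hm : θ.Mixing) {n : ℕ} (i : Fin n) (a b : Fin J) :
    (1 - θ.ρ₀) * (1 - ((J : ℝ) - 1) * θ.δ) ≤ θ.kern i a b := by
  rw [θ.one_sub_ρ₀ hm, div_mul_cancel₀ _ (θ.one_sub_pos hm).ne']
  exact θ.δ_le_kern hm i a b

theorem bayesClust_ge_of_two (θ : Param 2 L) (hm : θ.Mixing) {n : ℕ} (hn : 1 ≤ n) :
    θ.δ ^ 2 * (1 - θ.αTilde n) / (1 - θ.δ) * θ.Λ ≤ θ.bayesClust n := by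
  have hδ := hm.1
  have h2δ := θ.J_mul_δ_le hm
  have hρ := θ.one_sub_ρ₀ hm
  have hD := θ.one_sub_pos hm
  rw [Nat.cast_ofNat] at h2δ
  have hD' : 1 - (((2 : ℕ) : ℝ) - 1) * θ.δ = 1 - θ.δ := by norm_num
  rw [hD'] at hρ hD
  have hα0 : 0 ≤ θ.αTilde n :=
    mul_nonneg (by positivity)
      (Real.rpow_nonneg (mul_nonneg (div_nonneg hD.le hδ.le) (Real.sqrt_nonneg _)) _)
  rcases le_or_gt (θ.αTilde n) 1 with h1 | h1
  · have hcond : (1 + θ.ρ₀) / (1 - θ.ρ₀) ≤ θ.αTilde n ^ 2 * n := by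
      refine le_trans ?_ (θ.two_mul_le_αTilde_sq hm hn h1)
      rw [hρ, div_div_eq_mul_div, mul_div_assoc]
      refine mul_le_mul_of_nonneg_right ?_ (div_nonneg hD.le hδ.le)
      linarith [θ.ρ₀_lt_one hm]
    have h := θ.sub_le_bayesClust_of_two hn (θ.ρ₀_nonneg hm) (θ.ρ₀_lt_one hm)
      (fun _ => θ.one_sub_pos hm) (fun i a b => θ.sub_mul_le_kern hm i a b)
      (fun i a b => θ.kern_le hm i a b) (fun i => θ.exists_wrong_label_lower_of_mixing hm i)
      hα0 h1 hcond
    refine le_trans ?_ h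
    have h3 : 1 / (1 - θ.δ) ≤ 2 := by rw [div_le_iff₀ hD]; linarith
    calc θ.δ ^ 2 * (1 - θ.αTilde n) / (1 - θ.δ) * θ.Λ
        = (1 - θ.αTilde n) * (θ.δ ^ 2 * θ.Λ) * (1 / (1 - θ.δ)) := by ring
      _ ≤ (1 - θ.αTilde n) * (θ.δ ^ 2 * θ.Λ) * 2 := by
          refine mul_le_mul_of_nonneg_left h3 (mul_nonneg (by linarith) ?_)
          exact mul_nonneg (sq_nonneg _) θ.Λ_nonneg
      _ = _ := by push_cast; ring
  · refine le_trans (mul_nonpos_of_nonpos_of_nonneg (div_nonpos_of_nonpos_of_nonneg ?_ hD.le)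
      θ.Λ_nonneg) (θ.bayesClust_nonneg n)
    exact mul_nonpos_of_nonneg_of_nonpos (sq_nonneg _) (by linarith)

end Param

/-! ### Explicit constants: more than two labels -/

theorem log_factorial_ge {J : ℕ} (hJ : 2 < J) : 1.38 ≤ Real.log (Nat.factorial J) := by
  have h : (4 : ℝ) ≤ Nat.factorial J := by
    have h1 : Nat.factorial 3 ≤ Nat.factorial J := Nat.factorial_le hJ
    have h2 : 4 ≤ Nat.factorial J := le_trans (by decide) h1
    exact_mod_cast h2
  have h4 : Real.log 4 = 2 * Real.log 2 := by
    rw [show (4 : ℝ) = 2 ^ 2 by norm_num, Real.log_pow]; norm_num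
  have := Real.log_le_log (by norm_num) h
  linarith [Real.log_two_gt_d9]

namespace Param

variable {J : ℕ} {𝕐 : Type*} [MeasurableSpace 𝕐] {L : Measure 𝕐}

theorem δ_mul_Λ_le_one (θ : Param J L) (hm : θ.Mixing) : θ.δ * θ.Λ ≤ 1 := by
  refine (mul_le_mul_of_nonneg_left θ.Λ_le hm.1.le).trans ?_
  rw [mul_comm]
  exact θ.J_mul_δ_le hm

theorem bayesClust_ge_of_isInd (θ : Param J L) (hm : θ.Mixing) (hI : θ.IsInd) (hJ : 2 < J) {n : ℕ}
    (hn : 1 ≤ n)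
    (hΛ : 4 * (J : ℝ) ^ 2 * Real.exp (-(n * θ.β n) / 8) ≤ θ.δ * θ.Λ) (hξ : θ.ξ n ≤ 1 / 2) :
    θ.δ / 4 * θ.Λ ≤ θ.bayesClust n := by
  have hn' : (0 : ℝ) < n := by exact_mod_cast hn
  have hJ3 : (3 : ℝ) ≤ J := by exact_mod_cast hJ
  have hlog := log_factorial_ge hJ
  have he := Real.exp_one_gt_d9
  set b := θ.β n with hb
  have hb1 : b ≤ 1 := θ.β_le_one hn hJ.le
  -- `δ * Λ ≤ 1` forces the exponential in the first hypothesis to be small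
  have hnb : 8 < n * b := by
    by_contra hcon
    push Not at hcon
    have h1 : Real.exp (-1) ≤ Real.exp (-(n * b) / 8) := Real.exp_le_exp.2 (by linarith)
    have h2 : 1 / 3 ≤ Real.exp (-1) := by
      rw [Real.exp_neg, ← one_div]
      exact one_div_le_one_div_of_le (Real.exp_pos 1) (by linarith [Real.exp_one_lt_d9])
    have h3 := θ.δ_mul_Λ_le_one hm
    nlinarith
  have hb0 : 0 < b := by
    by_contra hcon
    push Not at hcon
    nlinarith
  set s := Real.sqrt (Real.log (Nat.factorial J) / (2 * n)) with hs
  have hs0 : 0 < s := Real.sqrt_pos.2 (by positivity)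
  have hξ' : 4 * Real.exp 1 / b * s ^ (1 - 4 / (n * b)) ≤ 1 / 2 := hξ
  have h4 : 4 / (n * b) ≤ 1 := by rw [div_le_one (by linarith)]; linarith
  -- `21 < 8 e`
  have h5 : s ^ (1 - 4 / (n * b)) ≤ b / 21 := by
    have h6 : 4 * Real.exp 1 * s ^ (1 - 4 / (n * b)) ≤ 1 / 2 * b := by
      rwa [div_mul_eq_mul_div, div_le_iff₀ hb0] at hξ'
    have h7 : 0 ≤ s ^ (1 - 4 / (n * b)) := Real.rpow_nonneg hs0.le _
    nlinarith
  have hs1 : s ≤ 1 := by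
    by_contra hcon
    push Not at hcon
    have := Real.one_le_rpow hcon.le (sub_nonneg.2 h4)
    linarith
  have hsb : s ≤ b / 21 := by
    refine le_trans ?_ h5
    conv_lhs => rw [← Real.rpow_one s]
    refine Real.rpow_le_rpow_of_exponent_ge hs0 hs1 ?_
    have : 0 ≤ 4 / (n * b) := by positivity
    linarith
  have hnb' : 304 ≤ n * b := by
    have h6 : s ^ 2 ≤ (b / 21) ^ 2 := pow_le_pow_left₀ hs0.le hsb 2
    rw [hs, Real.sq_sqrt (by positivity), div_le_iff₀ (by positivity)] at h6
    have h7 : n * b * b ≤ n * b := mul_le_of_le_one_right (by linarith) hb1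
    nlinarith
  -- with `κ = 3 / 4`, the smallest `c` allowed by `hsb` is `4 / 21`
  have h := θ.half_le_bayesClust hn hJ.le le_rfl zero_lt_one
    (fun b => hm.1.trans_le (hm.2 b)) (fun i a b => ?_) (fun i a b => ?_)
    (fun i => θ.exists_wrong_label_lower_of_isInd hm hI i) (c := 4 / 21) (κ := 3 / 4) hb0
    (by norm_num) (by norm_num) (by norm_num) (by norm_num) ?_ ?_
    (θ.sum_not_pairsFrequent_le_of_isInd hI hn)
  · refine le_trans ?_ h
    linarith
  · simp only [kern, hI a b, ite_self, sub_zero, one_mul, le_refl]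
  · simp only [kern, hI a b, ite_self, le_refl]
  · rw [sub_zero, div_one, one_mul]
    linarith
  · norm_num
    linarith

theorem bayesClust_ge (θ : Param J L) (hm : θ.Mixing) (hJ : 2 < J) {n : ℕ} (hn : 1 ≤ n)
    (hΛ : 4 * (1 - ((J : ℝ) - 1) * θ.δ) * ((J : ℝ) ^ 2 + 1) *
      Real.exp (-(2 * n * (1 - θ.ρ₀) ^ 2 * θ.β n ^ 2) / 15) ≤ θ.δ ^ 2 * θ.Λ)
    (hξ : θ.ξTilde n ≤ 1 / 2) :
    θ.δ ^ 2 / (4 * (1 - θ.δ)) * θ.Λ ≤ θ.bayesClust n := by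
  have hn' : (0 : ℝ) < n := by exact_mod_cast hn
  have hJ3 : (3 : ℝ) ≤ J := by exact_mod_cast hJ
  have hlog := log_factorial_ge hJ
  have hδ := hm.1
  have hJδ := θ.J_mul_δ_le hm
  have hD := θ.one_le_sub_mul hm
  have hD0 := θ.one_sub_pos hm
  have hΛ0 := θ.Λ_nonneg
  have hρ0 := θ.ρ₀_nonneg hm
  have hρ1 := θ.ρ₀_lt_one hm
  have hb1 : θ.β n ≤ 1 := θ.β_le_one hn hJ.le
  have hb0 : 0 < θ.β n := by
    refine lt_of_le_of_ne (θ.β_nonneg n) fun h => ?_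
    rw [← h] at hΛ
    norm_num at hΛ
    have h1 : θ.δ ^ 2 * θ.Λ ≤ θ.δ := by nlinarith [θ.δ_mul_Λ_le_one hm]
    nlinarith
  set D := 1 - ((J : ℝ) - 1) * θ.δ with hDdef
  set b := θ.β n with hb
  set g := 1 - θ.ρ₀ with hg
  have hg0 : 0 < g := by linarith
  set s := Real.sqrt (Real.log (Nat.factorial J) / (2 * n)) with hs
  have hs0 : 0 ≤ s := Real.sqrt_nonneg _
  have hsb : s ≤ b * g / 10 := by
    have h1 : 5 / (b * g) * s ≤ 1 / 2 := hξ
    rw [div_mul_eq_mul_div, div_le_iff₀ (by positivity)] at h1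
    linarith
  have hz : 69 ≤ n * g ^ 2 * b ^ 2 := by
    have h6 : s ^ 2 ≤ (b * g / 10) ^ 2 := pow_le_pow_left₀ hs0 hsb 2
    rw [hs, Real.sq_sqrt (by positivity), div_le_iff₀ (by positivity)] at h6
    linarith
  have hB : ∑ x : Fin n → Fin J, θ.pathProb x *
      (open Classical in if PairsFrequent (n * b / 2) x then (0 : ℝ) else 1) ≤
      1 / 8 * (J * θ.δ ^ 2 * θ.Λ) := by
    refine (θ.sum_not_pairsFrequent_le hm hn hb0).trans ?_
    rw [← hb, ← hg]
    have h1 : Real.exp (-(n * g ^ 2 * b ^ 2) / 2) ≤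
        1 / 2 * Real.exp (-(2 * n * g ^ 2 * b ^ 2) / 15) := by
      have h2 : -(n * g ^ 2 * b ^ 2) / 2 =
          -(11 / 30 * (n * g ^ 2 * b ^ 2)) + -(2 * n * g ^ 2 * b ^ 2) / 15 := by ring
      rw [h2, Real.exp_add]
      refine mul_le_mul_of_nonneg_right ?_ (Real.exp_nonneg _)
      calc Real.exp (-(11 / 30 * (n * g ^ 2 * b ^ 2))) ≤ Real.exp (-1) :=
            Real.exp_le_exp.2 (by linarith)
        _ ≤ 1 / 2 := by
            rw [Real.exp_neg, ← one_div]
            exact one_div_le_one_div_of_le two_pos (by linarith [Real.exp_one_gt_d9])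
    set E := Real.exp (-(2 * n * g ^ 2 * b ^ 2) / 15) with hE
    have hE0 : 0 < E := Real.exp_pos _
    have h3 : (J : ℝ) ^ 2 * E ≤ J * (θ.δ ^ 2 * θ.Λ) / 4 := by
      have h4 : J * (4 * D * ((J : ℝ) ^ 2 + 1) * E) ≤ J * (θ.δ ^ 2 * θ.Λ) :=
        mul_le_mul_of_nonneg_left hΛ (by positivity)
      have h5 : (J : ℝ) ^ 2 * E ≤ (D * J) * (((J : ℝ) ^ 2 + 1) * E) := by
        calc (J : ℝ) ^ 2 * E ≤ 1 * (((J : ℝ) ^ 2 + 1) * E) := by linarith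
          _ ≤ _ := mul_le_mul_of_nonneg_right hD (by positivity)
      linarith
    have h6 : (J : ℝ) ^ 2 * Real.exp (-(n * g ^ 2 * b ^ 2) / 2) ≤ (J : ℝ) ^ 2 * (1 / 2 * E) :=
      mul_le_mul_of_nonneg_left h1 (by positivity)
    linarith
  -- with `κ = 2 / 5`, the smallest `c` allowed by `hsb` is `1 / 6`
  have h := θ.half_le_bayesClust hn hJ.le hρ0 hρ1 (fun _ => hD0)
    (fun i a b => θ.sub_mul_le_kern hm i a b) (fun i a b => θ.kern_le hm i a b)
    (fun i => θ.exists_wrong_label_lower_of_mixing hm i) (c := 1 / 6) (κ := 2 / 5) hb0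
    (by norm_num) (by norm_num) (by norm_num) (by norm_num) ?_ ?_ hB
  · refine le_trans ?_ h
    have h1 : θ.δ ≤ 1 / 3 := by nlinarith
    have h2 : 1 / (4 * (1 - θ.δ)) ≤ 3 / 8 := by
      rw [div_le_iff₀ (by linarith)]; linarith
    have h3 : 0 ≤ θ.δ ^ 2 * θ.Λ := by positivity
    calc θ.δ ^ 2 / (4 * (1 - θ.δ)) * θ.Λ = θ.δ ^ 2 * θ.Λ * (1 / (4 * (1 - θ.δ))) := by ring
      _ ≤ θ.δ ^ 2 * θ.Λ * (3 / 8) := mul_le_mul_of_nonneg_left h2 h3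
      _ ≤ 1 / 2 * (2 / 5 * (J * θ.δ ^ 2 * θ.Λ) - 1 / 8 * (J * θ.δ ^ 2 * θ.Λ)) := by
          have h4 : 3 * (θ.δ ^ 2 * θ.Λ) ≤ J * (θ.δ ^ 2 * θ.Λ) :=
            mul_le_mul_of_nonneg_right hJ3 h3
          linarith
  · rw [← hg, ← hs, one_div_mul_eq_div, div_le_iff₀ hg0]
    linarith
  · rw [← hg, div_le_iff₀ hg0]
    have h1 : n * g ^ 2 * b ^ 2 ≤ n * g ^ 2 * b := by
      refine mul_le_mul_of_nonneg_left ?_ (by positivity)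
      rw [sq]
      exact mul_le_of_le_one_left hb0.le hb1
    have h2 : 1 + θ.ρ₀ = 2 - g := by rw [hg]; ring
    rw [h2]
    have h3 : (2 - g) * g ≤ 1 := by nlinarith [sq_nonneg (1 - g)]
    have h4 : (2 - g) * g ≤ (4 * (1 / 4 - 1 / 6) ^ 2 * (1 - 2 / 5) * (n * b) * g) * g := by
      nlinarith
    exact le_of_mul_le_mul_right h4 hg0

end Param

end HMMClustering

end

theorem mainTheorem12 {J n : ℕ} {𝕐 : Type*} [TopologicalSpace 𝕐] [PolishSpace 𝕐]
    [MeasurableSpace 𝕐] [BorelSpace 𝕐] (L : MeasureTheory.Measure 𝕐)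
    (θ : HMMClustering.Param J L) (hn : 1 ≤ n) (hmix : θ.Mixing) :
    (J = 2 →
      (θ.IsInd →
        (1 - θ.α n) * θ.δ * θ.Λ ≤ θ.bayesClust n ∧
        θ.bayesClust n ≤ (1 - θ.δ) * θ.Λ) ∧
      (θ.IsDep →
        θ.δ ^ 2 * (1 - θ.αTilde n) / (1 - θ.δ) * θ.Λ ≤ θ.bayesClust n ∧
        θ.bayesClust n ≤ (1 - θ.δ) * θ.Λ)) ∧
    (2 < J → θ.IsInd →
      4 * (J : ℝ) ^ 2 * Real.exp (-(n * θ.β n) / 8) ≤ θ.δ * θ.Λ →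
      θ.ξ n ≤ 1 / 2 →
        θ.δ / 4 * θ.Λ ≤ θ.bayesClust n ∧
        θ.bayesClust n ≤ (1 - ((J : ℝ) - 1) * θ.δ) * θ.Λ) ∧
    (2 < J → θ.IsDep →
      4 * (1 - ((J : ℝ) - 1) * θ.δ) * ((J : ℝ) ^ 2 + 1) *
          Real.exp (-(2 * n * (1 - θ.ρ₀) ^ 2 * θ.β n ^ 2) / 15) ≤ θ.δ ^ 2 * θ.Λ →
      θ.ξTilde n ≤ 1 / 2 →
        θ.δ ^ 2 / (4 * (1 - θ.δ)) * θ.Λ ≤ θ.bayesClust n ∧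
        θ.bayesClust n ≤ (1 - ((J : ℝ) - 1) * θ.δ) * θ.Λ) := by
  have hupper := θ.bayesClust_le_mul_Λ hmix hn
  refine ⟨fun hJ => ?_, fun hJ hI hΛ hξ => ⟨θ.bayesClust_ge_of_isInd hmix hI hJ hn hΛ hξ, hupper⟩,
    fun hJ _ hΛ hξ => ⟨θ.bayesClust_ge hmix hJ hn hΛ hξ, hupper⟩⟩
  subst hJ
  have hD : 1 - (((2 : ℕ) : ℝ) - 1) * θ.δ = 1 - θ.δ := by norm_num
  rw [hD] at hupper
  exact ⟨fun hI => ⟨θ.bayesClust_ge_of_two_isInd hmix hI hn, hupper⟩,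
    fun _ => ⟨θ.bayesClust_ge_of_two hmix hn, hupper⟩⟩
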